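/- **Setting.** Let $D\ge 0$. On $\mathbb R^{D}\times\mathbb R^{D}\ni(x,\tilde x)$ let $\mathcal E_{ij}$ be a matrix-valued and $d$ a real-valued field, $g_{ij}=\frac12(\mathcal E_{ij}+\mathcal E_{ji})$ invertible with inverse $g^{ij}$ (used to raise indices), $\mathcal D_i=\partial_i-\mathcal E_{ik}\tilde\partial^k$, $\bar{\mathcal D}_i=\partial_i+\mathcal E_{ki}\tilde\partial^k$, and $$S=\int dx\,d\tilde x\;e^{-2d}\Big[-\tfrac14 g^{ik}g^{jl}\mathcal D^p\mathcal E_{kl}\mathcal D_p\mathcal E_{ij}+\tfrac14 g^{kl}(\mathcal D^j\mathcal E_{ik}\mathcal D^i\mathcal E_{jl}+\bar{\mathcal D}^j\mathcal E_{ki}\bar{\mathcal D}^i\mathcal E_{lj})+(\mathcal D^id\,\bar{\mathcal D}^j\mathcal E_{ij}+\bar{\mathcal D}^id\,\mathcal D^j\mathcal E_{ji})+4\mathcal D^id\,\mathcal D_id\Big].$$ Define $\mathcal K^{pq}$ and $\mathcal R$ as the variational (Euler–Lagrange) derivatives of $S$: $\delta_{\mathcal E}S=\int e^{-2d}\,\delta\mathcal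 E_{pq}\,\mathcal K^{pq}$ and $\delta_dS=\int e^{-2d}(-2\,\delta d)\,\mathcal R$ after integration by parts; $\mathcal K_{pq}=g_{pk}g_{ql}\mathcal K^{kl}$. The double field theory (DFT) equations of motion are $\mathcal K_{pq}=0$ and $\mathcal R=0$. The indices of $\mathcal D_i$, and the first indices of $\mathcal E_{ij}$ and $\mathcal K_{ij}$, are unbarred; those of $\bar{\mathcal D}_i$, and the second indices of $\mathcal E_{ij}$ and $\mathcal K_{ij}$, are barred. The covariant derivative $\nabla_i$ (resp. $\bar\nabla_i$) is $\mathcal D_i$ (resp. $\bar{\mathcal D}_i$) minus one connection term for each lower index, with symbols $$\Gamma^k_{ij}=\tfrac12g^{kl}\mathcal D_i\mathcal E_{jl},\qquad \Gamma^{\bar k}_{i\bar j}=\tfrac12g^{kl}(\mathcal D_i\mathcal E_{lj}+\bar{\mathcal D}_j\mathcal E_{il}-\bar{\mathcal D}_l\mathcal E_{ij}),$$ $$\Gamma^{\bar k}_{\bar i\bar j}=\tfrac12g^{kl}\bar{\mathcal D}_i\mathcal E_{lj},\qquad \Gamma^{k}_{\bar ij}=\tfrac12g^{kl}(\bar{\mathcal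 D}_i\mathcal E_{jl}+\mathcal D_j\mathcal E_{li}-\mathcal D_l\mathcal E_{ji}).$$ The DFT Bianchi identities are $B_q=0$ and $\bar B_p=0$, where $$B_q=\big[\nabla^p-\tfrac12g^{ps}(\bar{\mathcal D}^r\mathcal E_{sr}+4\mathcal D_sd)\big]\mathcal K_{pq}+\tfrac12\bar{\mathcal D}_q\mathcal R,$$ $$\bar B_p=\big[\bar\nabla^q-\tfrac12g^{qs}(\mathcal D^r\mathcal E_{rs}+4\bar{\mathcal D}_sd)\big]\mathcal K_{pq}+\tfrac12\mathcal D_p\mathcal R .$$ **Theorem.** Let $V\subseteq\mathbb R^D$ be open, and let $g_{ij}$ (symmetric, invertible, of any signature), $b_{ij}$ (antisymmetric) and $\phi$ be smooth on $V$. Suppose that for $x\in V$ and all $\tilde x$ the fields have no $\tilde x$ dependence: $\mathcal E_{ij}(x,\tilde x)=g_{ij}(x)+b_{ij}(x)$ and $e^{-2d(x,\tilde x)}=\sqrt{|\det g(x)|}\,e^{-2\phi(x)}$. Let $H_{ijk}=3\partial_{[i}b_{jk]}=\partial_ib_{jk}+\partial_jb_{ki}+\partial_kb_{ij}$, and on the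 right-hand sides below, and in all expressions in $g,b,\phi$, let $\nabla$, $R_{ij}=R^k{}_{ikj}$, $R$ be the Levi-Civita derivative, Ricci tensor and scalar curvature of $g$. Then, at every $(x,\tilde x)$ with $x\in V$: 1. $\mathcal K_{pq}=\big[-R_{pq}+\frac14H_p{}^{rs}H_{qrs}-2\nabla_p\nabla_q\phi\big]+\big[\frac12\nabla^sH_{spq}-H_{spq}\nabla^s\phi\big]$ and $\mathcal R=R+4(\nabla^2\phi-(\partial\phi)^2)-\frac1{12}H^2$. Moreover $\mathcal K_{pq}$ equals the covariant expression (with $\nabla,\bar\nabla$ those of DFT) $$\begin{aligned}&\tfrac14(\nabla^s\mathcal D_s\mathcal E_{pq}+\bar\nabla^s\bar{\mathcal D}_s\mathcal E_{pq}-2\nabla^s\mathcal D_p\mathcal E_{sq}-2\bar\nabla^s\bar{\mathcal D}_q\mathcal E_{ps})-(\bar\nabla_q\mathcal D_pd+\nabla_p\bar{\mathcal D}_qd)\\&+\tfrac14g^{jk}(\bar{\mathcal D}_q\mathcal E_{pj}\mathcal D^i\mathcal E_{ik}+\tfrac12\bar{\mathcal D}_q\mathcal E_{ik}\mathcal D^i\mathcal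 E_{pj}+\mathcal D_p\mathcal E_{jq}\bar{\mathcal D}^i\mathcal E_{ki}+\tfrac12\mathcal D_p\mathcal E_{ki}\bar{\mathcal D}^i\mathcal E_{jq})\\&-\tfrac14(\bar{\mathcal D}^j\mathcal E_{iq}\mathcal D^i\mathcal E_{pj}+\tfrac12\bar{\mathcal D}^i\mathcal E_{ji}\mathcal D^j\mathcal E_{pq}+\tfrac12\bar{\mathcal D}^i\mathcal E_{pq}\mathcal D^j\mathcal E_{ji})-\tfrac14g^{ik}g^{jl}\bar{\mathcal D}_q\mathcal E_{ij}\mathcal D_p\mathcal E_{kl}.\end{aligned}$$ 2. $\mathcal K_{pq}=0$ for all $p,q$ if and only if $R_{ij}-\frac14H_i{}^{pq}H_{jpq}+2\nabla_i\nabla_j\phi=0$ and $\frac12\nabla^pH_{pij}-H_{pij}\nabla^p\phi=0$ for all $i,j$; and $\mathcal R=0$ if and only if $\Phi=0$. Here the standard metric, $B$-field and dilaton equations are $G_{ij}=0$, $\mathcal B^{ij}=0$, $\Phi=0$ with $$G_{ij}=R_{ij}-\tfrac12g_{ij}R+2(-g_{ij}\nabla^2\phi+\nabla_i\nabla_j\phi+g_{ij}(\partial\phi)^2)-\tfrac14(H_i{}^{pq}H_{jpq}-\tfrac16g_{ij}H^2),$$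 $$\mathcal B^{ij}=\tfrac12\nabla_pH^{ijp}-H^{ijp}\nabla_p\phi,\qquad \Phi=R+4(\nabla^2\phi-(\partial\phi)^2)-\tfrac1{12}H^2 .$$ The equation $\frac12\nabla^pH_{pij}-H_{pij}\nabla^p\phi=0$ (all $i,j$) is equivalent to $\mathcal B^{ij}=0$ (all $i,j$); one has $G_{ij}+\frac12g_{ij}\Phi=R_{ij}+2\nabla_i\nabla_j\phi-\frac14H_i{}^{pq}H_{jpq}$; and the DFT equations of motion ($\mathcal K_{pq}=0$ for all $p,q$, and $\mathcal R=0$) hold if and only if $G_{ij}=0$, $\mathcal B^{ij}=0$ for all $i,j$, and $\Phi=0$. 3. $B_q=\frac12\big[\nabla^p\nabla^sH_{spq}+(\frac12H_p{}^{rs}\nabla^pH_{qrs}-\frac1{12}\nabla_qH^2)\big]+\big(-\nabla^pR_{pq}+\frac12\nabla_qR\big)$, and $\bar B_p=\frac12\big[\nabla^q\nabla^sH_{spq}+(\frac12H_q{}^{rs}\nabla^qH_{prs}-\frac1{12}\nabla_pH^2)\big]+\big(-\nabla^qR_{pq}+\frac12\nabla_pR\big)$. Here $\nabla^p\nabla^sH_{spq}=0$,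 $\nabla^q\nabla^sH_{spq}=0$ and $\frac12H_p{}^{rs}\nabla^pH_{qrs}-\frac1{12}\nabla_qH^2=0$, so that $B_j=\bar B_j=-(\nabla^iR_{ij}-\frac12\nabla_jR)$: both DFT Bianchi identities reduce to the contracted Bianchi identity $\nabla^iR_{ij}-\frac12\nabla_jR=0$, which holds. -/

import Mathlib

open scoped ContDiff

noncomputable section

namespace DoubleField

/-! Ordinary points `x`, doubled points `X = (x, x̃)`, and partial derivatives. -/

abbrev Pt (D : ℕ) := Fin D → ℝ

abbrev DPt (D : ℕ) := Pt D × Pt D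

/-- Square matrices; `E i j` is the component with lower indices `i j`. -/
abbrev Mat (D : ℕ) := Matrix (Fin D) (Fin D) ℝ

variable {D : ℕ}

/-- `∂_i` on functions of `x`. -/
def pd (i : Fin D) (f : Pt D → ℝ) (x : Pt D) : ℝ :=
  fderiv ℝ f x (Pi.single i 1)

/-- `∂_i` on functions of `X = (x, x̃)`. -/
def dx (i : Fin D) (f : DPt D → ℝ) (X : DPt D) : ℝ :=
  fderiv ℝ f X (Pi.single i 1, 0)

/-- `∂̃^i` on functions of `X = (x, x̃)`. -/
def dxt (i : Fin D) (f : DPt D → ℝ) (X : DPt D) : ℝ :=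
  fderiv ℝ f X (0, Pi.single i 1)

/-! ### Conventional geometry of `(g, b, φ)` in a coordinate chart -/

/-- Tensor fields with `n` lower indices, in components. -/
abbrev TensorField (D n : ℕ) := (Fin n → Fin D) → Pt D → ℝ

/-- `Γ^k_{ij} = ½ g^{kl} (∂_i g_{jl} + ∂_j g_{il} - ∂_l g_{ij})`. -/
def christoffel (g : Pt D → Mat D) (k i j : Fin D) (x : Pt D) : ℝ :=
  (1 / 2) * ∑ l, (g x)⁻¹ k l *
    (pd i (fun y => g y j l) x + pd j (fun y => g y i l) x - pd l (fun y => g y i j) x)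

/-- The Levi-Civita derivative `∇_i T_{j₁ … jₙ}`; the index of the derivative comes first. -/
def cov (g : Pt D → Mat D) {n : ℕ} (T : TensorField D n) : TensorField D (n + 1) :=
  fun J x => pd (J 0) (T (Fin.tail J)) x -
    ∑ a : Fin n, ∑ k, christoffel g k (J 0) (Fin.tail J a) x *
      T (Function.update (Fin.tail J) a k) x

/-- `R^i_{jkl} = ∂_k Γ^i_{lj} - ∂_l Γ^i_{kj} + Γ^i_{km} Γ^m_{lj} - Γ^i_{lm} Γ^m_{kj}`. -/
def riemann (g : Pt D → Mat D) (i j k l : Fin D) (x : Pt D) : ℝ :=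
  pd k (christoffel g i l j) x - pd l (christoffel g i k j) x +
    ∑ m, (christoffel g i k m x * christoffel g m l j x -
      christoffel g i l m x * christoffel g m k j x)

/-- `R_{ij} = R^k_{ikj}`. -/
def ricci (g : Pt D → Mat D) : TensorField D 2 :=
  fun J x => ∑ k, riemann g k (J 0) k (J 1) x

/-- `R = g^{ij} R_{ij}`. -/
def scalarCurv (g : Pt D → Mat D) (x : Pt D) : ℝ :=
  ∑ i, ∑ j, (g x)⁻¹ i j * ricci g ![i, j] x

/-- `H_{ijk} = 3 ∂_{[i} b_{jk]} = ∂_i b_{jk} + ∂_j b_{ki} + ∂_k b_{ij}` (`b` antisymmetric). -/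
def fieldStrength (b : Pt D → Mat D) : TensorField D 3 :=
  fun J x => pd (J 0) (fun y => b y (J 1) (J 2)) x + pd (J 1) (fun y => b y (J 2) (J 0)) x +
    pd (J 2) (fun y => b y (J 0) (J 1)) x

/-- `∇_i φ`. -/
def grad (φ : Pt D → ℝ) : TensorField D 1 := fun J x => pd (J 0) φ x

/-- `∇_i ∇_j φ`. -/
def hess (g : Pt D → Mat D) (φ : Pt D → ℝ) : TensorField D 2 := cov g (grad φ)

/-- `∇^i ∇_i φ`. -/
def laplace (g : Pt D → Mat D) (φ : Pt D → ℝ) (x : Pt D) : ℝ :=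
  ∑ i, ∑ j, (g x)⁻¹ i j * hess g φ ![i, j] x

/-- `(∂φ)² = g^{ij} ∂_i φ ∂_j φ`. -/
def gradSq (g : Pt D → Mat D) (φ : Pt D → ℝ) (x : Pt D) : ℝ :=
  ∑ i, ∑ j, (g x)⁻¹ i j * pd i φ x * pd j φ x

/-- `H_i^{rs} H_{jrs}`. -/
def hSq (g b : Pt D → Mat D) (i j : Fin D) (x : Pt D) : ℝ :=
  ∑ r, ∑ s, ∑ t, ∑ u, (g x)⁻¹ r t * (g x)⁻¹ s u *
    fieldStrength b ![i, r, s] x * fieldStrength b ![j, t, u] x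

/-- `H² = H^{irs} H_{irs}`. -/
def hNorm (g b : Pt D → Mat D) (x : Pt D) : ℝ :=
  ∑ i, ∑ j, (g x)⁻¹ i j * hSq g b i j x

/-- `∇^s H_{spq}`. -/
def divH (g b : Pt D → Mat D) (p q : Fin D) (x : Pt D) : ℝ :=
  ∑ s, ∑ t, (g x)⁻¹ s t * cov g (fieldStrength b) ![t, s, p, q] x

/-- `H_{spq} ∇^s φ`. -/
def hGrad (g b : Pt D → Mat D) (φ : Pt D → ℝ) (p q : Fin D) (x : Pt D) : ℝ :=
  ∑ s, ∑ t, (g x)⁻¹ s t * fieldStrength b ![s, p, q] x * pd t φ x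

/-- `∇^p ∇^s H_{spq}`. -/
def divDivH (g b : Pt D → Mat D) (q : Fin D) (x : Pt D) : ℝ :=
  ∑ p, ∑ a, ∑ s, ∑ c, (g x)⁻¹ p a * (g x)⁻¹ s c *
    cov g (cov g (fieldStrength b)) ![a, c, s, p, q] x

/-- `∇^q ∇^s H_{spq}`. -/
def divDivH' (g b : Pt D → Mat D) (p : Fin D) (x : Pt D) : ℝ :=
  ∑ q, ∑ a, ∑ s, ∑ c, (g x)⁻¹ q a * (g x)⁻¹ s c *
    cov g (cov g (fieldStrength b)) ![a, c, s, p, q] x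

/-- `H_p^{rs} ∇^p H_{qrs}`. -/
def hCovH (g b : Pt D → Mat D) (q : Fin D) (x : Pt D) : ℝ :=
  ∑ p, ∑ a, ∑ r, ∑ c, ∑ s, ∑ e, (g x)⁻¹ p a * (g x)⁻¹ r c * (g x)⁻¹ s e *
    fieldStrength b ![p, c, e] x * cov g (fieldStrength b) ![a, q, r, s] x

/-- `∇^p R_{pq}`. -/
def divRicci (g : Pt D → Mat D) (q : Fin D) (x : Pt D) : ℝ :=
  ∑ p, ∑ a, (g x)⁻¹ p a * cov g (ricci g) ![a, p, q] x

/-! The field equations of the action `∫ √|g| e^{-2φ} (R + 4 (∂φ)² - H²/12)`. -/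

/-- Coefficient of `δg^{ij}`:
`R_{ij} - ½ g_{ij} R + 2 (-g_{ij} ∇²φ + ∇_i ∇_j φ + g_{ij} (∂φ)²) - ¼ (H_i^{pq} H_{jpq} - ⅙ g_{ij} H²)`. -/
def metricEq (g b : Pt D → Mat D) (φ : Pt D → ℝ) (i j : Fin D) (x : Pt D) : ℝ :=
  ricci g ![i, j] x - (1 / 2) * g x i j * scalarCurv g x +
    2 * (-(g x i j * laplace g φ x) + hess g φ ![i, j] x + g x i j * gradSq g φ x) -
    (1 / 4) * (hSq g b i j x - (1 / 6) * g x i j * hNorm g b x)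

/-- Coefficient of `δb_{ij}`: `½ ∇_p H^{ijp} - H^{ijp} ∇_p φ`. -/
def bFieldEq (g b : Pt D → Mat D) (φ : Pt D → ℝ) (i j : Fin D) (x : Pt D) : ℝ :=
  ∑ k, ∑ l, ∑ m, ∑ p, (g x)⁻¹ i k * (g x)⁻¹ j l * (g x)⁻¹ m p *
    ((1 / 2) * cov g (fieldStrength b) ![p, k, l, m] x -
      fieldStrength b ![k, l, m] x * pd p φ x)

/-- Coefficient of `-2 δφ`: `R + 4 (∇²φ - (∂φ)²) - H²/12`. -/
def dilatonEq (g b : Pt D → Mat D) (φ : Pt D → ℝ) (x : Pt D) : ℝ :=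
  scalarCurv g x + 4 * (laplace g φ x - gradSq g φ x) - (1 / 12) * hNorm g b x

/-! ### Double field theory -/

/-- Unbarred indices (as in `𝒟_i`) and barred indices (as in `𝒟̄_i`). -/
inductive Side
  | un
  | bar

open Side

/-- The metric `g_{ij} = ½ (ℰ_{ij} + ℰ_{ji})`. -/
def metric (e : Mat D) : Mat D := (1 / 2 : ℝ) • (e + e.transpose)

/-- First-order jets of `(ℰ, d)`: `e`, `d` are the values, `de i j k` is `∂_i ℰ_{jk}`,
`dte i j k` is `∂̃^i ℰ_{jk}`, `dd i` is `∂_i d`, and `ddt i` is `∂̃^i d`. -/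
structure Jet (D : ℕ) where
  e : Mat D
  d : ℝ
  de : Fin D → Mat D
  dte : Fin D → Mat D
  dd : Fin D → ℝ
  ddt : Fin D → ℝ

/-- `𝒟_i ℰ_{jk}` and `𝒟̄_i ℰ_{jk}` in terms of the jet, where
`𝒟_i = ∂_i - ℰ_{il} ∂̃^l` and `𝒟̄_i = ∂_i + ℰ_{li} ∂̃^l`. -/
def Jet.DE (J : Jet D) : Side → Fin D → Fin D → Fin D → ℝ
  | un, i, j, k => J.de i j k - ∑ l, J.e i l * J.dte l j k
  | bar, i, j, k => J.de i j k + ∑ l, J.e l i * J.dte l j k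

/-- `𝒟_i d` and `𝒟̄_i d` in terms of the jet. -/
def Jet.Dd (J : Jet D) : Side → Fin D → ℝ
  | un, i => J.dd i - ∑ l, J.e i l * J.ddt l
  | bar, i => J.dd i + ∑ l, J.e l i * J.ddt l

/-- The Lagrangian density of the double field theory action
`S = ∫ dx dx̃ e^{-2d} [ -¼ g^{ik} g^{jl} 𝒟^p ℰ_{kl} 𝒟_p ℰ_{ij}
 + ¼ g^{kl} (𝒟^j ℰ_{ik} 𝒟^i ℰ_{jl} + 𝒟̄^j ℰ_{ki} 𝒟̄^i ℰ_{lj})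
 + (𝒟^i d 𝒟̄^j ℰ_{ij} + 𝒟̄^i d 𝒟^j ℰ_{ji}) + 4 𝒟^i d 𝒟_i d ]`. -/
def lagrangian (J : Jet D) : ℝ :=
  let G := (metric J.e)⁻¹
  Real.exp (-2 * J.d) *
    (-(1 / 4) * (∑ i, ∑ j, ∑ k, ∑ l, ∑ p, ∑ r,
        G i k * G j l * G p r * J.DE un r k l * J.DE un p i j) +
      (1 / 4) * (∑ i, ∑ j, ∑ k, ∑ l, ∑ m, ∑ n, G k l * G j m * G i n *
        (J.DE un m i k * J.DE un n j l + J.DE bar m k i * J.DE bar n l j)) +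
      (∑ i, ∑ j, ∑ k, ∑ l, G i k * G j l *
        (J.Dd un k * J.DE bar l i j + J.Dd bar k * J.DE un l j i)) +
      4 * ∑ i, ∑ j, G i j * J.Dd un i * J.Dd un j)

/-- The jet of the fields `(ℰ, d)` at `X`. -/
def jet (E : DPt D → Mat D) (d : DPt D → ℝ) (X : DPt D) : Jet D where
  e := E X
  d := d X
  de := fun i => Matrix.of fun j k => dx i (fun Y => E Y j k) X
  dte := fun i => Matrix.of fun j k => dxt i (fun Y => E Y j k) X
  dd := fun i => dx i d X
  ddt := fun i => dxt i d X

/-! Partial derivatives of the Lagrangian with respect to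
`ℰ_{pq}`, `∂_i ℰ_{pq}`, `∂̃^i ℰ_{pq}`, `d`, `∂_i d`, `∂̃^i d`. -/

def lagE (p q : Fin D) (J : Jet D) : ℝ :=
  deriv (fun ε : ℝ => lagrangian { J with e := J.e + ε • Matrix.single p q 1 }) 0

def lagDE (i p q : Fin D) (J : Jet D) : ℝ :=
  deriv (fun ε : ℝ => lagrangian
    { J with de := Function.update J.de i (J.de i + ε • Matrix.single p q 1) }) 0

def lagDtE (i p q : Fin D) (J : Jet D) : ℝ :=
  deriv (fun ε : ℝ => lagrangian
    { J with dte := Function.update J.dte i (J.dte i + ε • Matrix.single p q 1) }) 0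

def lagd (J : Jet D) : ℝ :=
  deriv (fun ε : ℝ => lagrangian { J with d := J.d + ε }) 0

def lagDd (i : Fin D) (J : Jet D) : ℝ :=
  deriv (fun ε : ℝ => lagrangian { J with dd := Function.update J.dd i (J.dd i + ε) }) 0

def lagDtd (i : Fin D) (J : Jet D) : ℝ :=
  deriv (fun ε : ℝ => lagrangian { J with ddt := Function.update J.ddt i (J.ddt i + ε) }) 0

/-- The variational derivative `δS/δℰ_{pq}`, i.e. the coefficient of `δℰ_{pq}` in `δS` after
integration by parts. -/
def varE (E : DPt D → Mat D) (d : DPt D → ℝ) (p q : Fin D) (X : DPt D) : ℝ :=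
  lagE p q (jet E d X) - ∑ i, dx i (fun Y => lagDE i p q (jet E d Y)) X -
    ∑ i, dxt i (fun Y => lagDtE i p q (jet E d Y)) X

/-- The variational derivative `δS/δd`. -/
def vard (E : DPt D → Mat D) (d : DPt D → ℝ) (X : DPt D) : ℝ :=
  lagd (jet E d X) - ∑ i, dx i (fun Y => lagDd i (jet E d Y)) X -
    ∑ i, dxt i (fun Y => lagDtd i (jet E d Y)) X

/-- `𝒦_{pq} = g_{pk} g_{ql} 𝒦^{kl}`, where `δ_ℰ S = ∫ e^{-2d} δℰ_{pq} 𝒦^{pq}`. -/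
def K (E : DPt D → Mat D) (d : DPt D → ℝ) (p q : Fin D) (X : DPt D) : ℝ :=
  ∑ k, ∑ l, metric (E X) p k * metric (E X) q l * (Real.exp (2 * d X) * varE E d k l X)

/-- The scalar `ℛ`, where `δ_d S = ∫ e^{-2d} (-2 δd) ℛ`. -/
def R (E : DPt D → Mat D) (d : DPt D → ℝ) (X : DPt D) : ℝ :=
  -(1 / 2) * Real.exp (2 * d X) * vard E d X

/-- `𝒟_i = ∂_i - ℰ_{ik} ∂̃^k` and `𝒟̄_i = ∂_i + ℰ_{ki} ∂̃^k` on functions. -/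
def calD (E : DPt D → Mat D) : Side → Fin D → (DPt D → ℝ) → DPt D → ℝ
  | un, i, f, X => dx i f X - ∑ k, E X i k * dxt k f X
  | bar, i, f, X => dx i f X + ∑ k, E X k i * dxt k f X

/-- `𝒟_i ℰ_{jk}` and `𝒟̄_i ℰ_{jk}`. -/
def calDE (E : DPt D → Mat D) (s : Side) (i j k : Fin D) (X : DPt D) : ℝ :=
  calD E s i (fun Y => E Y j k) X

/-- The Christoffel-like symbols: `gam E s t k i j` has the lower index `i` of kind `s` (that of
the derivative), the lower index `j` of kind `t`, and the upper index `k` of kind `t`. -/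
def gam (E : DPt D → Mat D) : Side → Side → Fin D → Fin D → Fin D → DPt D → ℝ
  | un, un, k, i, j, X => (1 / 2) * ∑ l, (metric (E X))⁻¹ k l * calDE E un i j l X
  | bar, bar, k, i, j, X => (1 / 2) * ∑ l, (metric (E X))⁻¹ k l * calDE E bar i l j X
  | un, bar, k, i, j, X => (1 / 2) * ∑ l, (metric (E X))⁻¹ k l *
      (calDE E un i l j X + calDE E bar j i l X - calDE E bar l i j X)
  | bar, un, k, i, j, X => (1 / 2) * ∑ l, (metric (E X))⁻¹ k l *
      (calDE E bar i j l X + calDE E un j l i X - calDE E un l j i X)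

/-- `∇_i T_J` (for `s = un`) and `∇̄_i T_J` (for `s = bar`), where `κ a` is the kind of the
`a`-th lower index of `T`. -/
def calCov (E : DPt D → Mat D) (s : Side) {n : ℕ} (κ : Fin n → Side)
    (T : (Fin n → Fin D) → DPt D → ℝ) (i : Fin D) (J : Fin n → Fin D) (X : DPt D) : ℝ :=
  calD E s i (T J) X -
    ∑ a : Fin n, ∑ k, gam E s (κ a) k i (J a) X * T (Function.update J a k) X

/-- `∇_t 𝒟_i ℰ_{jk}` (for `s = un`) and `∇̄_t 𝒟̄_i ℰ_{jk}` (for `s = bar`). -/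
def covDE (E : DPt D → Mat D) (s : Side) (t i j k : Fin D) (X : DPt D) : ℝ :=
  calCov E s ![s, un, bar] (fun J => calDE E s (J 0) (J 1) (J 2)) t ![i, j, k] X

/-- The covariant expression
`¼ (∇^s 𝒟_s ℰ_{pq} + ∇̄^s 𝒟̄_s ℰ_{pq} - 2 ∇^s 𝒟_p ℰ_{sq} - 2 ∇̄^s 𝒟̄_q ℰ_{ps})
 - (∇̄_q 𝒟_p d + ∇_p 𝒟̄_q d)
 + ¼ g^{jk} (𝒟̄_q ℰ_{pj} 𝒟^i ℰ_{ik} + ½ 𝒟̄_q ℰ_{ik} 𝒟^i ℰ_{pj}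
     + 𝒟_p ℰ_{jq} 𝒟̄^i ℰ_{ki} + ½ 𝒟_p ℰ_{ki} 𝒟̄^i ℰ_{jq})
 - ¼ (𝒟̄^j ℰ_{iq} 𝒟^i ℰ_{pj} + ½ 𝒟̄^i ℰ_{ji} 𝒟^j ℰ_{pq} + ½ 𝒟̄^i ℰ_{pq} 𝒟^j ℰ_{ji})
 - ¼ g^{ik} g^{jl} 𝒟̄_q ℰ_{ij} 𝒟_p ℰ_{kl}`. -/
def covariantK (E : DPt D → Mat D) (d : DPt D → ℝ) (p q : Fin D) (X : DPt D) : ℝ :=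
  let G := (metric (E X))⁻¹
  (1 / 4) * (∑ s, ∑ t, G s t * (covDE E un t s p q X + covDE E bar t s p q X -
      2 * covDE E un t p s q X - 2 * covDE E bar t q p s X)) -
    (calCov E bar ![un] (fun J => calD E un (J 0) d) q ![p] X +
      calCov E un ![bar] (fun J => calD E bar (J 0) d) p ![q] X) +
    (1 / 4) * (∑ j, ∑ k, ∑ i, ∑ m, G j k * G i m *
      (calDE E bar q p j X * calDE E un m i k X +
        (1 / 2) * calDE E bar q i k X * calDE E un m p j X +
        calDE E un p j q X * calDE E bar m k i X +
        (1 / 2) * calDE E un p k i X * calDE E bar m j q X)) -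
    (1 / 4) * (∑ i, ∑ n, ∑ j, ∑ m, G i n * G j m *
      (calDE E bar m i q X * calDE E un n p j X +
        (1 / 2) * calDE E bar n j i X * calDE E un m p q X +
        (1 / 2) * calDE E bar n p q X * calDE E un m j i X)) -
    (1 / 4) * ∑ i, ∑ j, ∑ k, ∑ l, G i k * G j l * calDE E bar q i j X * calDE E un p k l X

/-- The left-hand side of the first Bianchi identity,
`[∇^p - ½ g^{ps} (𝒟̄^r ℰ_{sr} + 4 𝒟_s d)] 𝒦_{pq} + ½ 𝒟̄_q ℛ`. -/
def bianchi₁ (E : DPt D → Mat D) (d : DPt D → ℝ) (q : Fin D) (X : DPt D) : ℝ :=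
  let G := (metric (E X))⁻¹
  (∑ p, ∑ s, G p s * calCov E un ![un, bar] (fun J => K E d (J 0) (J 1)) s ![p, q] X) -
    (1 / 2) * (∑ p, ∑ s, G p s *
      ((∑ r, ∑ t, G r t * calDE E bar t s r X) + 4 * calD E un s d X) * K E d p q X) +
    (1 / 2) * calD E bar q (R E d) X

/-- The left-hand side of the second Bianchi identity,
`[∇̄^q - ½ g^{qs} (𝒟^r ℰ_{rs} + 4 𝒟̄_s d)] 𝒦_{pq} + ½ 𝒟_p ℛ`. -/
def bianchi₂ (E : DPt D → Mat D) (d : DPt D → ℝ) (p : Fin D) (X : DPt D) : ℝ :=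
  let G := (metric (E X))⁻¹
  (∑ q, ∑ s, G q s * calCov E bar ![un, bar] (fun J => K E d (J 0) (J 1)) s ![p, q] X) -
    (1 / 2) * (∑ q, ∑ s, G q s *
      ((∑ r, ∑ t, G r t * calDE E un t r s X) + 4 * calD E bar s d X) * K E d p q X) +
    (1 / 2) * calD E un p (R E d) X

end DoubleField

end

noncomputable section

set_option linter.unusedSectionVars false

namespace DoubleField

/-! ### Contractions -/

section Contraction

variable {ι A : Type*} [Fintype ι] [CommRing A]

/-- The contraction `G^{ab} F_{ab}`. -/
def ct (G : Matrix ι ι A) (F : ι → ι → A) : A := ∑ a, ∑ b, G a b * F a b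

variable (G G' : Matrix ι ι A) (F F' : ι → ι → A)

theorem ct_eq_sum_prod : ct G F = ∑ x : ι × ι, G x.1 x.2 * F x.1 x.2 :=
  (Fintype.sum_prod_type' fun a b => G a b * F a b).symm

theorem ct_add : ct G (fun a b => F a b + F' a b) = ct G F + ct G F' := by
  simp only [ct, mul_add, Finset.sum_add_distrib]

theorem ct_neg : ct G (fun a b => -F a b) = -ct G F := by
  simp only [ct, mul_neg, Finset.sum_neg_distrib]

theorem ct_sub : ct G (fun a b => F a b - F' a b) = ct G F - ct G F' := by
  simp only [ct, mul_sub, Finset.sum_sub_distrib]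

theorem ct_mul_left (x : A) : ct G (fun a b => x * F a b) = x * ct G F := by
  simp only [ct, Finset.mul_sum, mul_left_comm]

theorem ct_mul_right (x : A) : ct G (fun a b => F a b * x) = ct G F * x := by
  simp only [ct, Finset.sum_mul, mul_assoc]

theorem ct_smul [Algebra ℝ A] (x : ℝ) : ct G (fun a b => x • F a b) = x • ct G F := by
  simp only [ct, Finset.smul_sum, mul_smul_comm]

theorem ct_sum {κ : Type*} [Fintype κ] (F : κ → ι → ι → A) :
    ct G (fun a b => ∑ k, F k a b) = ∑ k, ct G (F k) := by
  simp only [ct_eq_sum_prod, Finset.mul_sum]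
  exact Finset.sum_comm

theorem ct_zero : ct G (fun _ _ => 0) = 0 := by simp [ct]

/-- Contractions commute. -/
theorem ct_comm (F : ι → ι → ι → ι → A) :
    ct G (fun a b => ct G' (fun c d => F a b c d)) =
      ct G' (fun c d => ct G (fun a b => F a b c d)) := by
  simp only [ct_eq_sum_prod, Finset.mul_sum]
  rw [Finset.sum_comm]
  simp only [mul_left_comm]

variable {G G'}

theorem ct_swap (hG : ∀ a b, G a b = G b a) : ct G F = ct G (fun a b => F b a) := by
  unfold ct
  rw [Finset.sum_comm]
  simp only [hG]

/-- The pairs of a triple contraction may be rotated. -/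
theorem ct_ct_ct_rotate (F : ι → ι → ι → ι → ι → ι → A) :
    ct G (fun a a' => ct G (fun b b' => ct G (fun c c' => F b b' c c' a a'))) =
      ct G (fun a a' => ct G (fun b b' => ct G (fun c c' => F a a' b b' c c'))) := by
  rw [ct_comm]
  simp only [ct_comm G G (fun a b c d => F _ _ c d a b)]

variable [Algebra ℝ A]

theorem ct_eq_zero_of_swap (hG : ∀ a b, G a b = G b a) (h : ∀ a b, F a b + F b a = 0) :
    ct G F = 0 := by
  have h1 : ct G F + ct G (fun a b => F b a) = 0 := by
    rw [← ct_add]; simp only [h, ct_zero]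
  rw [← ct_swap F hG] at h1
  linear_combination (norm := algebra) (1 / 2 : ℝ) • h1

/-- A double contraction vanishes if the symmetrization of its argument over the swaps of the
contracted indices vanishes. -/
theorem ct_ct_eq_zero (hG : ∀ a b, G a b = G b a) (F : ι → ι → ι → ι → A)
    (h : ∀ a b c d, F a b c d + F b a c d + F a b d c + F b a d c +
      F c d a b + F d c a b + F c d b a + F d c b a = 0) :
    ct G (fun a b => ct G (fun c d => F a b c d)) = 0 := by
  have h1 : ∀ F : ι → ι → ι → ι → A, ct G (fun a b => ct G (fun c d => F a b c d)) =
      ct G (fun a b => ct G (fun c d => F a b d c)) := fun F => by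
    congr 1; funext a b; exact ct_swap _ hG
  have h2 : ∀ F : ι → ι → ι → ι → A, ct G (fun a b => ct G (fun c d => F a b c d)) =
      ct G (fun a b => ct G (fun c d => F b a c d)) := fun F => ct_swap _ hG
  have h3 : ∀ F : ι → ι → ι → ι → A, ct G (fun a b => ct G (fun c d => F a b c d)) =
      ct G (fun a b => ct G (fun c d => F c d a b)) := fun F => ct_comm _ _ _
  have key : ct G (fun a b => ct G (fun c d => F a b c d + F b a c d + F a b d c + F b a d c +
      F c d a b + F d c a b + F c d b a + F d c b a)) = 0 := by simp only [h, ct_zero]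
  simp only [ct_add] at key
  rw [← h2 F, ← h1 F, ← h2 (fun a b c d => F a b d c), ← h1 F,
    ← h3 F, ← h3 (fun a b c d => F b a c d), ← h2 F,
    ← h3 (fun a b c d => F a b d c), ← h1 F,
    ← h3 (fun a b c d => F b a d c), ← h2 (fun a b c d => F a b d c), ← h1 F] at key
  linear_combination (norm := algebra) (1 / 8 : ℝ) • key

theorem ct_ct_ct_eq_zero_of_rotate (F : ι → ι → ι → ι → ι → ι → A)
    (h : ∀ a a' b b' c c', F a a' b b' c c' + F b b' c c' a a' + F c c' a a' b b' = 0) :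
    ct G (fun a a' => ct G (fun b b' => ct G (fun c c' => F a a' b b' c c'))) = 0 := by
  have r1 := ct_ct_ct_rotate (G := G) F
  have r2 := ct_ct_ct_rotate (G := G) fun a a' b b' c c' => F b b' c c' a a'
  have r3 : ct G (fun a a' => ct G (fun b b' => ct G (fun c c' =>
    (F a a' b b' c c' + F b b' c c' a a' + F c c' a a' b b')))) = 0 := by
    simp only [h, ct_zero]
  simp only [ct_add] at r3
  rw [r2, r1] at r3
  linear_combination (norm := algebra) (1 / 3 : ℝ) • r3

/-- A triple contraction vanishes if the symmetrization of its argument over the permutations of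
the three pairs and the simultaneous swap vanishes. -/
theorem ct_ct_ct_eq_zero (hG : ∀ a b, G a b = G b a) (F : ι → ι → ι → ι → ι → ι → A)
    (h : ∀ a a' b b' c c', F a a' b b' c c' + F b b' c c' a a' + F c c' a a' b b' +
      F b b' a a' c c' + F a a' c c' b b' + F c c' b b' a a' +
      (F a' a b' b c' c + F b' b c' c a' a + F c' c a' a b' b +
      F b' b a' a c' c + F a' a c' c b' b + F c' c b' b a' a) = 0) :
    ct G (fun a a' => ct G (fun b b' => ct G (fun c c' => F a a' b b' c c'))) = 0 := by
  have h1 : ∀ F : ι → ι → ι → ι → ι → ι → A,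
      ct G (fun a a' => ct G (fun b b' => ct G (fun c c' => F a a' b b' c c'))) =
      ct G (fun a a' => ct G (fun b b' => ct G (fun c c' => F b b' a a' c c'))) :=
    fun F => ct_comm _ _ _
  have h2 : ∀ F : ι → ι → ι → ι → ι → ι → A,
      ct G (fun a a' => ct G (fun b b' => ct G (fun c c' => F a a' b b' c c'))) =
      ct G (fun a a' => ct G (fun b b' => ct G (fun c c' => F a a' c c' b b'))) := fun F => by
    congr 1; funext a b; exact ct_comm _ _ _
  have h3 : ∀ F : ι → ι → ι → ι → ι → ι → A,
      ct G (fun a a' => ct G (fun b b' => ct G (fun c c' => F a a' b b' c c'))) =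
      ct G (fun a a' => ct G (fun b b' => ct G (fun c c' => F a' a b' b c' c))) := fun F => by
    rw [ct_swap _ hG]
    congr 1; funext a b
    rw [ct_swap _ hG]
    congr 1; funext c d
    exact ct_swap _ hG
  have key : ct G (fun a a' => ct G (fun b b' => ct G (fun c c' =>
      F a a' b b' c c' + F b b' c c' a a' + F c c' a a' b b' +
      F b b' a a' c c' + F a a' c c' b b' + F c c' b b' a a' +
      (F a' a b' b c' c + F b' b c' c a' a + F c' c a' a b' b +
      F b' b a' a c' c + F a' a c' c b' b + F c' c b' b a' a)))) = 0 := by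
    simp only [h, ct_zero]
  simp only [ct_add] at key
  have e1 : ∀ F : ι → ι → ι → ι → ι → ι → A,
    ct G (fun a a' => ct G (fun b b' => ct G (fun c c' => F b b' c c' a a'))) =
      ct G (fun a a' => ct G (fun b b' => ct G (fun c c' => F a a' b b' c c'))) := fun F => by
    rw [h2 F, h1 (fun a a' b b' c c' => F a a' c c' b b')]
  have e2 : ∀ F : ι → ι → ι → ι → ι → ι → A,
    ct G (fun a a' => ct G (fun b b' => ct G (fun c c' => F c c' a a' b b'))) =
      ct G (fun a a' => ct G (fun b b' => ct G (fun c c' => F a a' b b' c c'))) := fun F => by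
    rw [h1 F, h2 (fun a a' b b' c c' => F b b' a a' c c')]
  have e3 : ∀ F : ι → ι → ι → ι → ι → ι → A,
    ct G (fun a a' => ct G (fun b b' => ct G (fun c c' => F c c' b b' a a'))) =
      ct G (fun a a' => ct G (fun b b' => ct G (fun c c' => F a a' b b' c c'))) := fun F => by
    rw [h1 F, ← e1 (fun a a' b b' c c' => F b b' a a' c c')]
  rw [e1 F, e2 F, ← h1 F, ← h2 F, e3 F, ← h3 F, e1 (fun a a' b b' c c' => F a' a b' b c' c),
    e2 (fun a a' b b' c c' => F a' a b' b c' c), ← h1 (fun a a' b b' c c' => F a' a b' b c' c),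
    ← h2 (fun a a' b b' c c' => F a' a b' b c' c), e3 (fun a a' b b' c c' => F a' a b' b c' c),
    ← h3 F] at key
  linear_combination (norm := algebra) (1 / 12 : ℝ) • key

end Contraction

end DoubleField

namespace DoubleField

/-! ### Levi-Civita geometry over a differential algebra -/

section DerivationMatrix

variable {ι A : Type*} [Fintype ι] [CommRing A] [Algebra ℝ A]

/-- Entrywise application of a derivation to a matrix. -/
def derMat (δ : Derivation ℝ A A) : Matrix ι ι A →+ Matrix ι ι A where
  toFun X := X.map δ
  map_zero' := by ext; simp
  map_add' X Y := by ext; simp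

variable (δ δ' : Derivation ℝ A A)

theorem derMat_apply (X : Matrix ι ι A) (i j : ι) : derMat δ X i j = δ (X i j) := rfl

theorem derMat_mul (X Y : Matrix ι ι A) :
    derMat δ (X * Y) = derMat δ X * Y + X * derMat δ Y := by
  ext i j
  simp only [derMat_apply, Matrix.mul_apply, Matrix.add_apply, map_sum, Derivation.leibniz,
    smul_eq_mul, Finset.sum_add_distrib]
  rw [add_comm]
  simp only [mul_comm]

theorem derMat_transpose (X : Matrix ι ι A) :
    derMat δ X.transpose = (derMat δ X).transpose := rfl

theorem derMat_one [DecidableEq ι] : derMat δ (1 : Matrix ι ι A) = 0 := by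
  ext i j
  by_cases h : i = j <;> simp [derMat_apply, h]

theorem derMat_comm (h : ∀ f, δ (δ' f) = δ' (δ f)) (X : Matrix ι ι A) :
    derMat δ (derMat δ' X) = derMat δ' (derMat δ X) := by
  ext i j
  exact h _

end DerivationMatrix

variable {ι A : Type*} [Fintype ι] [DecidableEq ι] [CommRing A] [Algebra ℝ A]

/-- `R^i_{jkl}` for the connection `Γ^i_{jk}`. -/
def riem (der : ι → Derivation ℝ A A) (Γ : ι → ι → ι → A) (i j k l : ι) : A :=
  der k (Γ i l j) - der l (Γ i k j) + ∑ m, (Γ i k m * Γ m l j - Γ i l m * Γ m k j)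

/-- `R_{jl} = R^k_{jkl}`. -/
def ric (der : ι → Derivation ℝ A A) (Γ : ι → ι → ι → A) (j l : ι) : A :=
  ∑ k, riem der Γ k j k l

/-- `∇_i T_j`. -/
def nab1 (der : ι → Derivation ℝ A A) (Γ : ι → ι → ι → A) (T : ι → A) (i j : ι) : A :=
  der i (T j) - ∑ m, Γ m i j * T m

/-- `∇_i T_{jk}`. -/
def nab2 (der : ι → Derivation ℝ A A) (Γ : ι → ι → ι → A) (T : ι → ι → A) (i j k : ι) : A :=
  der i (T j k) - ∑ m, Γ m i j * T m k - ∑ m, Γ m i k * T j m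

/-- `∇_i T_{jkl}`. -/
def nab3 (der : ι → Derivation ℝ A A) (Γ : ι → ι → ι → A) (T : ι → ι → ι → A)
    (i j k l : ι) : A :=
  der i (T j k l) - ∑ m, Γ m i j * T m k l - ∑ m, Γ m i k * T j m l - ∑ m, Γ m i l * T j k m

/-- `∇_i T_{jklp}`. -/
def nab4 (der : ι → Derivation ℝ A A) (Γ : ι → ι → ι → A) (T : ι → ι → ι → ι → A)
    (i j k l p : ι) : A :=
  der i (T j k l p) - ∑ m, Γ m i j * T m k l p - ∑ m, Γ m i k * T j m l p -
    ∑ m, Γ m i l * T j k m p - ∑ m, Γ m i p * T j k l m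

/-- `Γ` is the Levi-Civita connection of `g`, with inverse metric `G` and volume density `e^λ`,
with respect to commuting derivations. -/
structure LeviCivita (der : ι → Derivation ℝ A A) (g G : Matrix ι ι A) (Γ : ι → ι → ι → A)
    (lam : A) : Prop where
  comm : ∀ i j f, der i (der j f) = der j (der i f)
  g_symm : ∀ i j, g i j = g j i
  G_symm : ∀ i j, G i j = G j i
  G_mul : G * g = 1
  tors : ∀ k i j, Γ k i j = Γ k j i
  compat : ∀ i j k, der i (g j k) = ∑ l, (Γ l i j * g l k + Γ l i k * g j l)
  trace : ∀ i, ∑ k, Γ k i k = der i lam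

/-- The connection matrices `(Γ_k)^i_j`. -/
def connMat (Γ : ι → ι → ι → A) (k : ι) : Matrix ι ι A := Matrix.of fun i j => Γ i k j

/-- The curvature matrices `(R_{kl})^i_j`. -/
def curvMat (der : ι → Derivation ℝ A A) (Γ : ι → ι → ι → A) (k l : ι) : Matrix ι ι A :=
  derMat (der k) (connMat Γ l) - derMat (der l) (connMat Γ k) + connMat Γ k * connMat Γ l -
    connMat Γ l * connMat Γ k

/-- The matrices `(∇_m R_{kl})^i_j`. -/
def nabCurvMat (der : ι → Derivation ℝ A A) (Γ : ι → ι → ι → A) (m k l : ι) : Matrix ι ι A :=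
  derMat (der m) (curvMat der Γ k l) + connMat Γ m * curvMat der Γ k l -
    curvMat der Γ k l * connMat Γ m - ∑ a, Γ a m k • curvMat der Γ a l -
    ∑ a, Γ a m l • curvMat der Γ k a

theorem curvMat_apply (der : ι → Derivation ℝ A A) (Γ : ι → ι → ι → A) (i j k l : ι) :
    curvMat der Γ k l i j = riem der Γ i j k l := by
  simp only [curvMat, riem, connMat, Matrix.sub_apply, Matrix.add_apply, Matrix.mul_apply,
    derMat_apply, Matrix.of_apply, Finset.sum_sub_distrib]
  ring

namespace LeviCivita

variable {der : ι → Derivation ℝ A A} {g G : Matrix ι ι A} {Γ : ι → ι → ι → A} {lam : A}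

theorem mul_G (L : LeviCivita der g G Γ lam) : g * G = 1 := mul_eq_one_comm.mp L.G_mul

theorem derMat_g (L : LeviCivita der g G Γ lam) (k : ι) :
    derMat (der k) g = (connMat Γ k).transpose * g + g * connMat Γ k := by
  ext i j
  simp only [derMat_apply, L.compat, Matrix.add_apply, Matrix.mul_apply, connMat,
    Matrix.transpose_apply, Matrix.of_apply, Finset.sum_add_distrib]
  congr 1
  exact Finset.sum_congr rfl fun _ _ => mul_comm _ _

theorem derMat_G (L : LeviCivita der g G Γ lam) (k : ι) :
    derMat (der k) G = -(connMat Γ k * G + G * (connMat Γ k).transpose) := by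
  have h := derMat_mul (der k) G g
  rw [L.G_mul, derMat_one, L.derMat_g] at h
  have h2 : derMat (der k) G * (g * G) =
      -(G * (connMat Γ k).transpose * (g * G) + (G * g) * connMat Γ k * G) := by
    have := congrArg (· * G) h
    simp only [Matrix.zero_mul, add_mul, mul_add] at this
    rw [eq_neg_iff_add_eq_zero]
    simp only [mul_assoc] at this ⊢
    exact this.symm
  rw [L.mul_G, L.G_mul] at h2
  simpa [add_comm] using h2

theorem der_G (L : LeviCivita der g G Γ lam) (k a b : ι) :
    der k (G a b) = -∑ m, (Γ a k m * G m b + Γ b k m * G a m) := by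
  have h := congrFun (congrFun (L.derMat_G k) a) b
  simp only [derMat_apply, Matrix.neg_apply, Matrix.add_apply, Matrix.mul_apply, connMat,
    Matrix.transpose_apply, Matrix.of_apply] at h
  rw [h, Finset.sum_add_distrib]
  simp only [mul_comm]

theorem curvMat_swap (k l : ι) : curvMat der Γ l k = -curvMat der Γ k l := by
  unfold curvMat; abel

theorem curvMat_mul_G (L : LeviCivita der g G Γ lam) (k l : ι) :
    curvMat der Γ k l * G + G * (curvMat der Γ k l).transpose = 0 := by
  have h := derMat_comm (der k) (der l) (L.comm k l) G
  rw [L.derMat_G, L.derMat_G] at h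
  simp only [map_neg, map_add, derMat_mul, L.derMat_G, derMat_transpose] at h
  simp only [curvMat, Matrix.transpose_sub, Matrix.transpose_add, Matrix.transpose_mul]
  rw [← sub_eq_zero] at h
  rw [← neg_eq_zero, ← h]
  noncomm_ring

/-- `R_{kl}{}^{ie}` is antisymmetric in `i`, `e`. -/
theorem riem_antisymm (L : LeviCivita der g G Γ lam) (i e k l : ι) :
    ∑ j, riem der Γ i j k l * G j e = -∑ j, riem der Γ e j k l * G j i := by
  have h := congrFun (congrFun (L.curvMat_mul_G k l) i) e
  simp only [Matrix.add_apply, Matrix.mul_apply, Matrix.transpose_apply, curvMat_apply,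
    Matrix.zero_apply] at h
  rw [eq_neg_iff_add_eq_zero, ← h]
  congr 1
  exact Finset.sum_congr rfl fun j _ => by rw [L.G_symm i j, mul_comm]

theorem riem_swap (i j k l : ι) : riem der Γ i j l k = -riem der Γ i j k l := by
  simp only [← curvMat_apply]
  rw [curvMat_swap]; rfl

/-- The first Bianchi identity. -/
theorem riem_cyclic (L : LeviCivita der g G Γ lam) (i j k l : ι) :
    riem der Γ i j k l + riem der Γ i k l j + riem der Γ i l j k = 0 := by
  simp only [riem, Finset.sum_sub_distrib]
  rw [L.tors i l j, L.tors i k j, L.tors i l k]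
  have h1 := fun m => L.tors m l j
  have h2 := fun m => L.tors m k j
  have h3 := fun m => L.tors m l k
  simp only [h1, h2, h3]
  ring

/-- The second Bianchi identity. -/
theorem nabCurvMat_cyclic (L : LeviCivita der g G Γ lam) (m k l : ι) :
    nabCurvMat der Γ m k l + nabCurvMat der Γ k l m + nabCurvMat der Γ l m k = 0 := by
  have hW : ∀ m k l : ι,
      (derMat (der m) (curvMat der Γ k l) + connMat Γ m * curvMat der Γ k l -
        curvMat der Γ k l * connMat Γ m) +
      (derMat (der k) (curvMat der Γ l m) + connMat Γ k * curvMat der Γ l m -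
        curvMat der Γ l m * connMat Γ k) +
      (derMat (der l) (curvMat der Γ m k) + connMat Γ l * curvMat der Γ m k -
        curvMat der Γ m k * connMat Γ l) = 0 := by
    intro m k l
    simp only [curvMat, map_sub, map_add, derMat_mul]
    rw [derMat_comm (der m) (der k) (L.comm m k), derMat_comm (der m) (der l) (L.comm m l),
      derMat_comm (der k) (der l) (L.comm k l)]
    noncomm_ring
  have hs : ∀ m k l : ι, ∑ a, Γ a m k • curvMat der Γ a l + ∑ a, Γ a k m • curvMat der Γ l a = 0 := by
    intro m k l
    rw [← Finset.sum_add_distrib]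
    refine Finset.sum_eq_zero fun a _ => ?_
    rw [curvMat_swap a l, L.tors a k m, smul_neg, add_neg_cancel]
  unfold nabCurvMat
  have e := hW m k l
  have e1 := hs m k l
  have e2 := hs k l m
  have e3 := hs l m k
  rw [← sub_eq_zero] at e1 e2 e3
  simp only [sub_zero] at e1 e2 e3
  linear_combination (norm := abel) e - e1 - e2 - e3

theorem nabCurvMat_mul_G (L : LeviCivita der g G Γ lam) (m k l : ι) :
    nabCurvMat der Γ m k l * G + G * (nabCurvMat der Γ m k l).transpose = 0 := by
  have h := congrArg (derMat (der m)) (L.curvMat_mul_G k l)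
  simp only [map_add, derMat_mul, L.derMat_G, derMat_transpose, map_zero] at h
  have h0 := L.curvMat_mul_G k l
  have h1 : (∑ a, Γ a m k • curvMat der Γ a l) * G +
      G * (∑ a, Γ a m k • curvMat der Γ a l).transpose = 0 := by
    simp only [Matrix.transpose_sum, Matrix.transpose_smul, Matrix.mul_sum, Matrix.sum_mul,
      ← Finset.sum_add_distrib, Matrix.smul_mul, Matrix.mul_smul, ← smul_add, L.curvMat_mul_G,
      smul_zero, Finset.sum_const_zero]
  have h2 : (∑ a, Γ a m l • curvMat der Γ k a) * G +
      G * (∑ a, Γ a m l • curvMat der Γ k a).transpose = 0 := by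
    simp only [Matrix.transpose_sum, Matrix.transpose_smul, Matrix.mul_sum, Matrix.sum_mul,
      ← Finset.sum_add_distrib, Matrix.smul_mul, Matrix.mul_smul, ← smul_add, L.curvMat_mul_G,
      smul_zero, Finset.sum_const_zero]
  simp only [nabCurvMat, Matrix.transpose_sub, Matrix.transpose_add, Matrix.transpose_mul]
  have h3 : connMat Γ m * (curvMat der Γ k l * G + G * (curvMat der Γ k l).transpose) +
    (curvMat der Γ k l * G + G * (curvMat der Γ k l).transpose) * (connMat Γ m).transpose = 0 := by
    rw [h0]; simp
  linear_combination (norm := noncomm_ring) h + h3 - h1 - h2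

/-- The covariant derivative of the Riemann tensor, contracted to that of the Ricci tensor. -/
theorem sum_nabCurvMat (m j l : ι) :
    ∑ i, nabCurvMat der Γ m i l i j = nab2 der Γ (ric der Γ) m j l := by
  simp only [nabCurvMat, Matrix.sub_apply, Matrix.add_apply, Matrix.mul_apply, derMat_apply,
    Matrix.sum_apply, Matrix.smul_apply, curvMat_apply, smul_eq_mul, connMat, Matrix.of_apply,
    nab2, ric, map_sum, Finset.sum_sub_distrib, Finset.sum_add_distrib, Finset.mul_sum]
  rw [Finset.sum_comm (f := fun i a => riem der Γ i a i l * Γ a m j),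
    Finset.sum_comm (f := fun i a => Γ a m l * riem der Γ i j i a),
    Finset.sum_comm (f := fun i a => Γ i m a * riem der Γ a j i l)]
  simp only [mul_comm]
  ring

/-- The contracted Bianchi identity. -/
theorem div_ric (L : LeviCivita der g G Γ lam) (l : ι) :
    2 * ct G (fun a p => nab2 der Γ (ric der Γ) a p l) =
      ct G (fun j m => nab2 der Γ (ric der Γ) l j m) := by
  have anti : ∀ m k l i e, ∑ j, nabCurvMat der Γ m k l i j * G j e =
      -∑ j, nabCurvMat der Γ m k l e j * G j i := by
    intro m k l i e
    have h := congrFun (congrFun (L.nabCurvMat_mul_G m k l) i) e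
    simp only [Matrix.add_apply, Matrix.mul_apply, Matrix.transpose_apply,
      Matrix.zero_apply] at h
    rw [eq_neg_iff_add_eq_zero, ← h]
    congr 1
    exact Finset.sum_congr rfl fun j _ => by rw [L.G_symm i j, mul_comm]
  have swap : ∀ m k l i j, nabCurvMat der Γ m l k i j = -nabCurvMat der Γ m k l i j := by
    intro m k l i j
    have : nabCurvMat der Γ m l k = -nabCurvMat der Γ m k l := by
      simp only [nabCurvMat, curvMat_swap k l, fun a => curvMat_swap k a (der := der) (Γ := Γ),
        fun a => curvMat_swap a l (der := der) (Γ := Γ), map_neg, smul_neg,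
        Finset.sum_neg_distrib]
      noncomm_ring
    rw [this]; rfl
  have cyc : ∀ j m, nab2 der Γ (ric der Γ) m j l + ∑ i, nabCurvMat der Γ i l m i j -
      nab2 der Γ (ric der Γ) l j m = 0 := by
    intro j m
    rw [← sum_nabCurvMat, ← sum_nabCurvMat, ← Finset.sum_add_distrib, ← Finset.sum_sub_distrib]
    refine Finset.sum_eq_zero fun i _ => ?_
    have h := congrFun (congrFun (L.nabCurvMat_cyclic m i l) i) j
    simp only [Matrix.add_apply, Matrix.zero_apply] at h
    rw [swap l i m] at h
    linear_combination h
  have mid : ct G (fun j m => ∑ i, nabCurvMat der Γ i l m i j) =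
      ct G (fun a p => nab2 der Γ (ric der Γ) a p l) := by
    have e1 : ct G (fun j m => ∑ i, nabCurvMat der Γ i l m i j) =
        ∑ i, ∑ m, ∑ j, nabCurvMat der Γ i l m i j * G j m := by
      rw [ct_sum]
      refine Finset.sum_congr rfl fun i _ => ?_
      rw [ct, Finset.sum_comm]
      simp only [mul_comm]
    rw [e1]
    simp only [ct, ← sum_nabCurvMat, Finset.mul_sum]
    refine Finset.sum_congr rfl fun i _ => ?_
    rw [Finset.sum_congr rfl fun m _ => anti i l m i m]
    simp only [← Finset.sum_neg_distrib, ← neg_mul, ← swap]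
    rw [Finset.sum_comm]
    refine Finset.sum_congr rfl fun j _ => Finset.sum_congr rfl fun m _ => ?_
    rw [L.G_symm, mul_comm]
  have h : ct G (fun j m => nab2 der Γ (ric der Γ) m j l + ∑ i, nabCurvMat der Γ i l m i j -
      nab2 der Γ (ric der Γ) l j m) = 0 := by simp only [cyc, ct_zero]
  rw [ct_sub, ct_add, mid, ct_swap _ L.G_symm] at h
  linear_combination h

/-- The derivative of a contraction. -/
theorem der_ct (L : LeviCivita der g G Γ lam) (q : ι) (T : ι → ι → A) :
    der q (ct G T) = ct G (fun a b => nab2 der Γ T q a b) := by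
  have e1 : der q (ct G T) = (∑ a, ∑ b, G a b * der q (T a b)) -
      ∑ a, ∑ b, ∑ m, (Γ a q m * G m b + Γ b q m * G a m) * T a b := by
    simp only [ct, map_sum, Derivation.leibniz, smul_eq_mul, L.der_G, ← Finset.sum_sub_distrib]
    refine Finset.sum_congr rfl fun a _ => Finset.sum_congr rfl fun b _ => ?_
    rw [← Finset.sum_mul]; ring
  rw [e1]
  simp only [nab2, ct, mul_sub, Finset.sum_sub_distrib, Finset.mul_sum, add_mul,
    Finset.sum_add_distrib]
  have e2 : ∑ a, ∑ b, ∑ m, Γ a q m * G m b * T a b = ∑ a, ∑ b, ∑ m, G a b * (Γ m q a * T m b) := by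
    rw [Finset.sum_comm, Finset.sum_comm (f := fun a b => ∑ m, G a b * (Γ m q a * T m b))]
    refine Finset.sum_congr rfl fun b _ => ?_
    rw [Finset.sum_comm]
    exact Finset.sum_congr rfl fun _ _ => Finset.sum_congr rfl fun _ _ => by ring
  have e3 : ∑ a, ∑ b, ∑ m, Γ b q m * G a m * T a b = ∑ a, ∑ b, ∑ m, G a b * (Γ m q b * T a m) := by
    refine Finset.sum_congr rfl fun b _ => ?_
    rw [Finset.sum_comm]
    exact Finset.sum_congr rfl fun _ _ => Finset.sum_congr rfl fun _ _ => by ring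
  rw [e2, e3]; ring

/-- The Ricci tensor in terms of the volume density. -/
theorem ric_eq (L : LeviCivita der g G Γ lam) (j l : ι) :
    ric der Γ j l = ∑ k, der k (Γ k l j) - der l (der j lam) +
      ∑ m, der m lam * Γ m l j - ∑ k, ∑ m, Γ k l m * Γ m k j := by
  have h1 : ∑ k, ∑ m, Γ k k m * Γ m l j = ∑ m, der m lam * Γ m l j := by
    rw [Finset.sum_comm]
    refine Finset.sum_congr rfl fun m _ => ?_
    rw [← Finset.sum_mul, ← L.trace]
    simp only [L.tors _ m]
  have h2 : ∑ k, der l (Γ k k j) = der l (der j lam) := by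
    rw [← L.trace, map_sum]
    simp only [L.tors _ j]
  simp only [ric, riem, Finset.sum_add_distrib, Finset.sum_sub_distrib, h1, h2]
  ring

theorem ric_symm (L : LeviCivita der g G Γ lam) (j l : ι) : ric der Γ j l = ric der Γ l j := by
  rw [L.ric_eq, L.ric_eq, L.comm l j]
  have h1 : ∀ m, Γ m l j = Γ m j l := fun m => L.tors m l j
  simp only [h1]
  congr 1
  rw [Finset.sum_comm]
  refine Finset.sum_congr rfl fun m _ => Finset.sum_congr rfl fun k _ => ?_
  rw [L.tors k l m, L.tors m k j, mul_comm]

end LeviCivita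

end DoubleField

namespace DoubleField

theorem sum_sum_eq_of_swap {ι A : Type*} [Fintype ι] [AddCommMonoid A] {f h : ι → ι → A}
    (hf : ∀ m n, f m n = h n m) : ∑ m, ∑ n, f m n = ∑ m, ∑ n, h m n := by
  rw [Finset.sum_comm]
  exact Finset.sum_congr rfl fun _ _ => Finset.sum_congr rfl fun _ _ => hf _ _

variable {ι A : Type*} [Fintype ι] [DecidableEq ι] [CommRing A] [Algebra ℝ A]

/-- `H_i^{rs} H_{jrs}`. -/
def sqH (G : Matrix ι ι A) (H : ι → ι → ι → A) (i j : ι) : A :=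
  ct G fun r t => ct G fun s u => H i r s * H j t u

/-- `∇^s H_{spq}`. -/
def divForm (der : ι → Derivation ℝ A A) (G : Matrix ι ι A) (Γ H : ι → ι → ι → A) (p q : ι) : A :=
  ct G fun s t => nab3 der Γ H t s p q

/-- `H_{spq} u^s`. -/
def contrForm (G : Matrix ι ι A) (H : ι → ι → ι → A) (u : ι → A) (p q : ι) : A :=
  ct G fun s t => H s p q * u t

/-- A closed three-form. -/
structure ClosedForm (der : ι → Derivation ℝ A A) (H : ι → ι → ι → A) : Prop where
  swap₁₂ : ∀ i j k, H j i k = -H i j k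
  swap₂₃ : ∀ i j k, H i k j = -H i j k
  closed : ∀ q i r s, der q (H i r s) - der i (H q r s) - der r (H i q s) - der s (H i r q) = 0

namespace LeviCivita

variable {der : ι → Derivation ℝ A A} {g G : Matrix ι ι A} {Γ : ι → ι → ι → A} {lam : A}

theorem nab1_symm (L : LeviCivita der g G Γ lam) (φ : A) (i j : ι) :
    nab1 der Γ (fun k => der k φ) i j = nab1 der Γ (fun k => der k φ) j i := by
  simp only [nab1, L.comm i j, L.tors _ i j]

/-- The Ricci identity on covectors. -/
theorem ricci_identity₁ (L : LeviCivita der g G Γ lam) (v : ι → A) (a q p : ι) :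
    nab2 der Γ (nab1 der Γ v) a q p - nab2 der Γ (nab1 der Γ v) q a p =
      -∑ m, riem der Γ m p a q * v m := by
  simp only [nab2, nab1, riem, map_sub, map_sum, Derivation.leibniz, smul_eq_mul, mul_sub, sub_mul,
    add_mul, Finset.sum_sub_distrib, Finset.sum_add_distrib, Finset.mul_sum, Finset.sum_mul,
    L.comm a q, L.tors _ q a, ← mul_assoc]
  have e1 : ∑ m, ∑ n, Γ m a n * Γ n q p * v m = ∑ m, ∑ n, Γ m q p * Γ n a m * v n :=
    sum_sum_eq_of_swap fun _ _ => by ring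
  have e2 : ∑ m, ∑ n, Γ m q n * Γ n a p * v m = ∑ m, ∑ n, Γ m a p * Γ n q m * v n :=
    sum_sum_eq_of_swap fun _ _ => by ring
  rw [e1, e2]
  simp only [mul_comm (v _)]
  ring

/-- The Ricci identity on tensors with three lower indices. -/
theorem ricci_identity₃ (L : LeviCivita der g G Γ lam) (H : ι → ι → ι → A) (a c s p q : ι) :
    nab4 der Γ (nab3 der Γ H) a c s p q - nab4 der Γ (nab3 der Γ H) c a s p q =
      -(∑ m, riem der Γ m s a c * H m p q + ∑ m, riem der Γ m p a c * H s m q +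
        ∑ m, riem der Γ m q a c * H s p m) := by
  simp only [nab4, nab3, riem, map_sub, map_sum, Derivation.leibniz, smul_eq_mul, mul_sub, sub_mul,
    add_mul, Finset.sum_sub_distrib, Finset.sum_add_distrib, Finset.mul_sum, Finset.sum_mul,
    L.comm a c, L.tors _ c a, ← mul_assoc]
  have e1 : ∀ a c, ∑ m, ∑ n, Γ m a n * Γ n c s * H m p q = ∑ m, ∑ n, Γ m c s * Γ n a m * H n p q :=
    fun _ _ => sum_sum_eq_of_swap fun _ _ => by ring
  have e2 : ∀ a c, ∑ m, ∑ n, Γ m a n * Γ n c p * H s m q = ∑ m, ∑ n, Γ m c p * Γ n a m * H s n q :=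
    fun _ _ => sum_sum_eq_of_swap fun _ _ => by ring
  have e3 : ∀ a c, ∑ m, ∑ n, Γ m a n * Γ n c q * H s p m = ∑ m, ∑ n, Γ m c q * Γ n a m * H s p n :=
    fun _ _ => sum_sum_eq_of_swap fun _ _ => by ring
  have e4 : ∀ a c, ∑ m, ∑ n, Γ m a s * Γ n c p * H m n q = ∑ m, ∑ n, Γ m c p * Γ n a s * H n m q :=
    fun _ _ => sum_sum_eq_of_swap fun _ _ => by ring
  have e5 : ∀ a c, ∑ m, ∑ n, Γ m a s * Γ n c q * H m p n = ∑ m, ∑ n, Γ m c q * Γ n a s * H n p m :=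
    fun _ _ => sum_sum_eq_of_swap fun _ _ => by ring
  have e6 : ∀ a c, ∑ m, ∑ n, Γ m a p * Γ n c q * H s m n = ∑ m, ∑ n, Γ m c q * Γ n a p * H s n m :=
    fun _ _ => sum_sum_eq_of_swap fun _ _ => by ring
  simp only [e1, e2, e3, e4, e5, e6, mul_comm (H _ _ _) _]
  ring

/-- `R_{aq}{}^m{}_{p}` contracted over `a` and `p`. -/
theorem ct_riem (L : LeviCivita der g G Γ lam) (m q : ι) :
    ct G (fun a p => riem der Γ m p a q) = -∑ p, G m p * ric der Γ p q := by
  have h : ct G (fun a p => riem der Γ m p a q) = ∑ a, ∑ p, riem der Γ m p a q * G p a := by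
    unfold ct
    exact Finset.sum_congr rfl fun a _ => Finset.sum_congr rfl fun p _ => by
      rw [L.G_symm, mul_comm]
  rw [h, Finset.sum_congr rfl fun a _ => L.riem_antisymm m a a q]
  simp only [ric, Finset.mul_sum, Finset.sum_neg_distrib]
  rw [Finset.sum_comm]
  congr 1
  exact Finset.sum_congr rfl fun a _ => Finset.sum_congr rfl fun p _ => by
    rw [L.G_symm, mul_comm]

/-- The Bochner identity `∇^p ∇_p ∇_q φ = ∇_q ∇² φ + R_{qp} ∇^p φ`. -/
theorem bochner (L : LeviCivita der g G Γ lam) (φ : A) (q : ι) :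
    ct G (fun a p => nab2 der Γ (nab1 der Γ fun k => der k φ) a p q) =
      ct G (fun a p => nab2 der Γ (nab1 der Γ fun k => der k φ) q a p) +
      ct G (fun m p => ric der Γ p q * der m φ) := by
  have h1 : ∀ a p, nab2 der Γ (nab1 der Γ fun k => der k φ) a p q =
      nab2 der Γ (nab1 der Γ fun k => der k φ) q a p -
        ∑ m, riem der Γ m p a q * der m φ := by
    intro a p
    rw [sub_eq_add_neg, ← L.ricci_identity₁ (fun k => der k φ)]
    simp only [nab2, L.nab1_symm φ p, L.nab1_symm φ _ q]
    ring
  simp only [h1, ct_sub, ct_sum, ct_mul_right, L.ct_riem]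
  simp only [ct, neg_mul, Finset.sum_neg_distrib, Finset.sum_mul, mul_assoc, sub_neg_eq_add]

theorem closed_cov (L : LeviCivita der g G Γ lam) {H : ι → ι → ι → A} (hH : ClosedForm der H)
    (q i r s : ι) : nab3 der Γ H q i r s - nab3 der Γ H i q r s - nab3 der Γ H r i q s -
      nab3 der Γ H s i r q = 0 := by
  rw [← hH.closed q i r s]
  simp only [nab3, L.tors _ i q, L.tors _ r q, L.tors _ s q, L.tors _ r i, L.tors _ s i,
    L.tors _ s r]
  have e1 : ∑ m, Γ m r s * H i q m = -∑ m, Γ m r s * H i m q := by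
    rw [← Finset.sum_neg_distrib]
    exact Finset.sum_congr rfl fun m _ => by rw [hH.swap₂₃ i m q]; ring
  have e2 : ∑ m, Γ m i r * H q m s = -∑ m, Γ m i r * H m q s := by
    rw [← Finset.sum_neg_distrib]
    exact Finset.sum_congr rfl fun m _ => by rw [hH.swap₁₂ m q s]; ring
  have e3 : ∑ m, Γ m i s * H q r m = -∑ m, Γ m i s * H m r q := by
    rw [← Finset.sum_neg_distrib]
    exact Finset.sum_congr rfl fun m _ => by
      rw [hH.swap₁₂ r q m, hH.swap₂₃ r m q, hH.swap₁₂ m r q]; ring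
  rw [e1, e2, e3]
  ring

theorem nab3_swap₁₂ {H : ι → ι → ι → A} (hH : ClosedForm der H) (a i j k : ι) :
    nab3 der Γ H a j i k = -nab3 der Γ H a i j k := by
  simp only [nab3, hH.swap₁₂ i, fun m => hH.swap₁₂ m j k, map_neg,
    mul_neg, Finset.sum_neg_distrib]
  ring

theorem nab3_swap₂₃ {H : ι → ι → ι → A} (hH : ClosedForm der H) (a i j k : ι) :
    nab3 der Γ H a i k j = -nab3 der Γ H a i j k := by
  simp only [nab3, hH.swap₂₃ _ j, fun m => hH.swap₂₃ i m k, map_neg,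
    mul_neg, Finset.sum_neg_distrib]
  ring

end LeviCivita

end DoubleField

namespace DoubleField

variable {ι A : Type*} [Fintype ι] [DecidableEq ι] [CommRing A] [Algebra ℝ A]

namespace LeviCivita

variable {der : ι → Derivation ℝ A A} {g G : Matrix ι ι A} {Γ : ι → ι → ι → A} {lam : A}

theorem nab2_sqH (L : LeviCivita der g G Γ lam) (H : ι → ι → ι → A) (q i j : ι) :
    nab2 der Γ (sqH G H) q i j = ct G fun r t => ct G fun s u =>
      nab3 der Γ H q i r s * H j t u + H i r s * nab3 der Γ H q j t u := by
  have hm : ∀ i r s m a b x, H i r s * (Γ m a b * x) = Γ m a b * (H i r s * x) :=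
    fun i r s m a b x => mul_left_comm _ _ _
  simp only [nab2, sqH, L.der_ct, Derivation.leibniz, smul_eq_mul, nab3, sub_mul, mul_sub,
    Finset.sum_mul, Finset.mul_sum, mul_assoc, hm, ct_sub, ct_add, ct_sum, ct_mul_left]
  simp only [mul_comm (H j _ _) (der _ _)]
  ring

theorem nab2_contrForm (L : LeviCivita der g G Γ lam) (H : ι → ι → ι → A) (u : ι → A) (a p q : ι) :
    nab2 der Γ (contrForm G H u) a p q = ct G fun s t =>
      nab3 der Γ H a s p q * u t + H s p q * nab1 der Γ u a t := by
  have hm : ∀ i r s m a b x, H i r s * (Γ m a b * x) = Γ m a b * (H i r s * x) :=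
    fun i r s m a b x => mul_left_comm _ _ _
  simp only [nab2, contrForm, L.der_ct, Derivation.leibniz, smul_eq_mul, nab3, nab1, sub_mul,
    mul_sub, Finset.sum_mul, Finset.mul_sum, mul_assoc, hm, ct_sub, ct_add, ct_sum, ct_mul_left]
  simp only [mul_comm (u _) (der _ _)]
  ring

theorem nab2_divForm (L : LeviCivita der g G Γ lam) (H : ι → ι → ι → A) (a p q : ι) :
    nab2 der Γ (divForm der G Γ H) a p q = ct G fun s t =>
      nab4 der Γ (nab3 der Γ H) a t s p q := by
  simp only [divForm, nab2, nab4, L.der_ct, ct_sub, ct_sum, ct_mul_left]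
  ring

theorem der_gradSq (L : LeviCivita der g G Γ lam) (u : ι → A) (q : ι) :
    der q (ct G fun i j => u i * u j) = 2 * ct G (fun i j => u j * nab1 der Γ u q i) := by
  have h : ct G (fun i j => u i * nab1 der Γ u q j) = ct G (fun i j => u j * nab1 der Γ u q i) :=
    ct_swap _ L.G_symm
  rw [L.der_ct, two_mul]
  nth_rewrite 1 [← h]
  rw [← ct_add]
  congr 1; funext i j
  simp only [nab2, nab1, Derivation.leibniz, smul_eq_mul, mul_sub, Finset.mul_sum]
  rw [Finset.sum_congr rfl fun m _ => show Γ m q j * (u i * u m) = u i * (Γ m q j * u m) by ring,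
    Finset.sum_congr rfl fun m _ => show Γ m q i * (u m * u j) = u j * (Γ m q i * u m) by ring]
  ring

/-- `∇_q H² = 6 H_p{}^{rs} ∇^p H_{qrs}`. -/
theorem der_normH (L : LeviCivita der g G Γ lam) {H : ι → ι → ι → A} (hH : ClosedForm der H)
    (q : ι) : der q (ct G (sqH G H)) =
      (6 : A) * ct G fun p a => ct G fun r c => ct G fun s e => H p c e * nab3 der Γ H a q r s := by
  rw [L.der_ct]
  simp only [L.nab2_sqH, ct_add]
  set Z := ct G fun p a => ct G fun r c => ct G fun s e => H p c e * nab3 der Γ H a q r s with hZ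
  have z1 : ct G (fun i j => ct G fun r t => ct G fun s u => nab3 der Γ H i q r s * H j t u) = Z := by
    rw [hZ, ct_swap _ L.G_symm]
    simp only [mul_comm]
  have z2 : ct G (fun i j => ct G fun r t => ct G fun s u => nab3 der Γ H r i q s * H j t u) = Z := by
    rw [← z1, ct_comm]
    congr 1; funext i j; congr 1; funext r t; congr 1; funext s u
    rw [nab3_swap₁₂ hH i q r s, hH.swap₁₂ j t u]; ring
  have z3 : ct G (fun i j => ct G fun r t => ct G fun s u => nab3 der Γ H s i r q * H j t u) = Z := by
    rw [← z1, ← ct_ct_ct_rotate fun i j r t s u => nab3 der Γ H s i r q * H j t u]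
    congr 1; funext i j; congr 1; funext r t; congr 1; funext s u
    rw [nab3_swap₂₃ hH i r q s, nab3_swap₁₂ hH i q r s, hH.swap₂₃ t j u, hH.swap₁₂ j t u]; ring
  have z : ct G (fun i j => ct G fun r t => ct G fun s u => nab3 der Γ H q i r s * H j t u) =
      3 * Z := by
    have e : ∀ i r s, nab3 der Γ H q i r s =
        nab3 der Γ H i q r s + nab3 der Γ H r i q s + nab3 der Γ H s i r q := fun i r s => by
      linear_combination L.closed_cov hH q i r s
    simp only [e, add_mul, ct_add, z1, z2, z3]
    ring
  have z' : ct G (fun i j => ct G fun r t => ct G fun s u => H i r s * nab3 der Γ H q j t u) =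
      3 * Z := by
    rw [← z, ct_swap _ L.G_symm]
    congr 1; funext i j
    rw [ct_swap _ L.G_symm]
    congr 1; funext r t
    rw [ct_swap _ L.G_symm]
    simp only [mul_comm]
  rw [z, z']
  ring

theorem nab4_swap (H : ι → ι → ι → A) (hH : ClosedForm der H) (a c s p q : ι) :
    nab4 der Γ (nab3 der Γ H) a c p s q = -nab4 der Γ (nab3 der Γ H) a c s p q := by
  simp only [nab4, nab3_swap₁₂ hH _ s p q,
    fun m => nab3_swap₁₂ (Γ := Γ) hH c m p q,
    fun m => nab3_swap₁₂ (Γ := Γ) hH c s m q, fun m => nab3_swap₁₂ (Γ := Γ) hH c s p m,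
    map_neg, mul_neg, Finset.sum_neg_distrib]
  ring

theorem ct_ct_ric (L : LeviCivita der g G Γ lam) {B : ι → ι → A} (hB : ∀ i j, B i j = -B j i) :
    ct G (fun p a => ct G fun m e => ric der Γ e a * B m p) = 0 := by
  have h : ct G (fun p a => ct G fun m e => ric der Γ e a * B m p) =
      -ct G (fun p a => ct G fun m e => ric der Γ e a * B m p) := by
    conv_lhs => rw [ct_comm]
    rw [← ct_neg]
    congr 1; funext p a
    rw [← ct_neg]
    congr 1; funext m e
    rw [L.ric_symm e a, hB p m, mul_neg]
  linear_combination (norm := algebra) (1 / 2 : ℝ) • h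

/-- The divergence of the divergence of a three-form vanishes. -/
theorem div_div (L : LeviCivita der g G Γ lam) {H : ι → ι → ι → A} (hH : ClosedForm der H)
    (q : ι) : ct G (fun p a => ct G fun s c => nab4 der Γ (nab3 der Γ H) a c s p q) = 0 := by
  have h1 : ct G (fun p a => ct G fun s c => nab4 der Γ (nab3 der Γ H) a c s p q) =
      -ct G (fun p a => ct G fun s c => nab4 der Γ (nab3 der Γ H) c a s p q) := by
    rw [ct_comm, ← ct_neg]
    congr 1; funext p a
    rw [← ct_neg]
    congr 1; funext s c
    rw [nab4_swap H hH]
  have t1 : ct G (fun p a => ct G fun s c => ∑ m, riem der Γ m s a c * H m p q) = 0 := by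
    have e : ∀ m a, ct G (fun s c => riem der Γ m s a c) = ∑ e, G m e * ric der Γ e a := by
      intro m a
      have := L.ct_riem m a
      rw [ct_swap _ L.G_symm] at this
      simp only [fun b c => riem_swap (der := der) (Γ := Γ) m b a c, ct_neg, neg_inj] at this
      exact this
    simp only [ct_sum, ct_mul_right, e]
    have := L.ct_ct_ric (B := fun m p => H m p q) (fun i j => hH.swap₁₂ _ _ _)
    rw [← this]
    simp only [← ct_sum]
    congr 1; funext p a
    simp only [ct, Finset.sum_mul, mul_assoc]
  have t2 : ct G (fun p a => ct G fun s c => ∑ m, riem der Γ m p a c * H s m q) = 0 := by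
    have e : ∀ m c, ct G (fun p a => riem der Γ m p a c) = -∑ e, G m e * ric der Γ e c := by
      intro m a
      rw [← L.ct_riem m a, ct_swap _ L.G_symm]
    rw [ct_comm]
    simp only [ct_sum, ct_mul_right, e]
    have := L.ct_ct_ric (B := fun m p => H m p q) (fun i j => hH.swap₁₂ _ _ _)
    rw [← this]
    simp only [← ct_sum]
    congr 1; funext p a
    simp only [ct, Finset.sum_mul, mul_assoc, neg_mul, Finset.sum_neg_distrib]
    rw [← Finset.sum_neg_distrib]
    refine Finset.sum_congr rfl fun m _ => ?_
    rw [← Finset.sum_neg_distrib]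
    exact Finset.sum_congr rfl fun e _ => by rw [hH.swap₁₂ m p q]; ring
  have t3 : ct G (fun p a => ct G fun s c => ∑ m, riem der Γ m q a c * H s p m) = 0 := by
    have low : ∀ m a c, riem der Γ m q a c =
        -∑ e, ∑ j, g e q * (riem der Γ e j a c * G j m) := by
      intro m a c
      have e1 : ∑ e, (∑ j, riem der Γ m j a c * G j e) * g e q = riem der Γ m q a c := by
        have h : curvMat der Γ a c * G * g = curvMat der Γ a c := by
          rw [mul_assoc, L.G_mul, mul_one]
        have := congrFun (congrFun h m) q
        simp only [Matrix.mul_apply, curvMat_apply] at this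
        exact this
      rw [← e1, ← Finset.sum_neg_distrib]
      refine Finset.sum_congr rfl fun e _ => ?_
      rw [L.riem_antisymm, neg_mul, Finset.sum_mul]
      congr 1
      exact Finset.sum_congr rfl fun _ _ => mul_comm _ _
    have cyc : ∀ e, ct G (fun p a => ct G fun s c => ct G fun m j =>
        riem der Γ e j a c * H s p m) = 0 := by
      intro e
      refine ct_ct_ct_eq_zero_of_rotate (fun p a s c m j => riem der Γ e j a c * H s p m)
        fun p a s c m j => ?_
      have b := L.riem_cyclic e j a c
      have h1 : H m s p = H s p m := by rw [hH.swap₁₂ s m p, hH.swap₂₃ s p m, neg_neg]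
      have h2 : H p m s = H s p m := by rw [hH.swap₂₃ p s m, hH.swap₁₂ s p m, neg_neg]
      simp only [h1, h2]
      linear_combination H s p m * b
    have e2 : ∀ a c s p, ∑ m, riem der Γ m q a c * H s p m =
        -∑ e, g e q * ct G (fun m j => riem der Γ e j a c * H s p m) := by
      intro a c s p
      simp only [low, neg_mul, Finset.sum_neg_distrib, Finset.sum_mul, ct, Finset.mul_sum]
      rw [Finset.sum_comm]
      congr 1
      refine Finset.sum_congr rfl fun e _ => Finset.sum_congr rfl fun m _ =>
        Finset.sum_congr rfl fun j _ => ?_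
      rw [L.G_symm m j]; ring
    simp only [e2, ct_neg, ct_sum, ct_mul_left, cyc, mul_zero, Finset.sum_const_zero, neg_zero]
  have h2 : ct G (fun p a => ct G fun s c => nab4 der Γ (nab3 der Γ H) a c s p q -
      nab4 der Γ (nab3 der Γ H) c a s p q) = 0 := by
    simp only [L.ricci_identity₃, ct_neg, ct_add, t1, t2, t3, add_zero, neg_zero]
  simp only [ct_sub] at h2
  linear_combination (norm := algebra) (1 / 2 : ℝ) • h1 + (1 / 2 : ℝ) • h2

end LeviCivita

end DoubleField

namespace DoubleField

variable {ι A : Type*} [Fintype ι] [DecidableEq ι] [CommRing A] [Algebra ℝ A]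

/-- `-R_{pq} + ¼ H_p^{rs} H_{qrs} - 2 ∇_p ∇_q φ + ½ ∇^s H_{spq} - H_{spq} ∇^s φ`. -/
def kForm (der : ι → Derivation ℝ A A) (G : Matrix ι ι A) (Γ H : ι → ι → ι → A) (φ : A)
    (p q : ι) : A :=
  -ric der Γ p q + (1 / 4 : ℝ) • sqH G H p q - (2 : ℝ) • nab1 der Γ (fun k => der k φ) p q +
    ((1 / 2 : ℝ) • divForm der G Γ H p q - contrForm G H (fun k => der k φ) p q)

/-- `R + 4 (∇²φ - (∂φ)²) - H²/12`. -/
def rForm (der : ι → Derivation ℝ A A) (G : Matrix ι ι A) (Γ H : ι → ι → ι → A) (φ : A) : A :=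
  ct G (ric der Γ) + (4 : ℝ) • (ct G (nab1 der Γ fun k => der k φ) -
    ct G (fun i j => der i φ * der j φ)) - (1 / 12 : ℝ) • ct G (sqH G H)

namespace LeviCivita

variable {der : ι → Derivation ℝ A A} {g G : Matrix ι ι A} {Γ : ι → ι → ι → A} {lam : A}

theorem nab2_kForm (H : ι → ι → ι → A) (φ : A) (s p q : ι) :
    nab2 der Γ (kForm der G Γ H φ) s p q = -nab2 der Γ (ric der Γ) s p q +
      (1 / 4 : ℝ) • nab2 der Γ (sqH G H) s p q -
      (2 : ℝ) • nab2 der Γ (nab1 der Γ fun k => der k φ) s p q +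
      ((1 / 2 : ℝ) • nab2 der Γ (divForm der G Γ H) s p q -
        nab2 der Γ (contrForm G H fun k => der k φ) s p q) := by
  simp only [nab2, kForm, map_add, map_sub, map_neg, Derivation.map_smul, mul_add, mul_sub, mul_neg,
    mul_smul_comm, Finset.sum_add_distrib, Finset.sum_sub_distrib, Finset.sum_neg_distrib,
    ← Finset.smul_sum]
  module

/-- A symmetric tensor contracted with the first two indices of a three-form. -/
theorem ct_ct_symm_form {H : ι → ι → ι → A}
    (hH : ClosedForm der H) {S : ι → ι → A} (hS : ∀ i j, S i j = S j i) (q : ι) :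
    ct G (fun p s => ct G fun k l => H l s q * S p k) = 0 := by
  have h : ct G (fun p s => ct G fun k l => H l s q * S p k) =
      -ct G (fun p s => ct G fun k l => H l s q * S p k) := by
    conv_lhs => rw [ct_comm]
    rw [← ct_neg]
    congr 1; funext p s
    rw [← ct_neg]
    congr 1; funext k l
    rw [hH.swap₁₂ l s q, hS k p, neg_mul]
  linear_combination (norm := algebra) (1 / 2 : ℝ) • h

theorem sqH_symm (L : LeviCivita der g G Γ lam) (H : ι → ι → ι → A) (i j : ι) :
    sqH G H i j = sqH G H j i := by
  unfold sqH
  rw [ct_swap _ L.G_symm]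
  congr 1; funext r t
  rw [ct_swap _ L.G_symm]
  simp only [mul_comm]

/-- The generalized contracted Bianchi identity. -/
theorem bianchi_kForm (L : LeviCivita der g G Γ lam) {H : ι → ι → ι → A} (hH : ClosedForm der H)
    (φ : A) (q : ι) :
    ct G (fun p s => nab2 der Γ (kForm der G Γ H φ) s p q) -
      (2 : ℝ) • ct G (fun p s => der s φ * kForm der G Γ H φ p q) +
      (1 / 2 : ℝ) • ct G (fun p s => ct G fun k l => H l s q * kForm der G Γ H φ p k) +
      (1 / 2 : ℝ) • der q (rForm der G Γ H φ) = 0 := by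
  have i1 := L.div_ric q
  rw [← L.der_ct q (ric der Γ)] at i1
  have i1' : ct G (fun p s => nab2 der Γ (ric der Γ) s p q) =
      ct G (fun a p => nab2 der Γ (ric der Γ) a p q) := ct_swap _ L.G_symm
  have i2 : ct G (fun p s => nab2 der Γ (sqH G H) s p q) =
      ct G (fun r t => ct G fun s u => divForm der G Γ H r s * H q t u) +
      ct G (fun p a => ct G fun r c => ct G fun s e => H p c e * nab3 der Γ H a q r s) := by
    simp only [L.nab2_sqH, ct_add]
    congr 1
    · simp only [divForm, ← ct_mul_right]
      rw [ct_comm]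
      congr 1; funext r t
      rw [ct_comm]
    · congr 1; funext p a
      rw [ct_swap _ L.G_symm]
      congr 1; funext r c
      rw [ct_swap _ L.G_symm]
  have i3 : ct G (fun p s => nab2 der Γ (nab1 der Γ fun k => der k φ) s p q) =
      der q (ct G (nab1 der Γ fun k => der k φ)) + ct G (fun p m => ric der Γ p q * der m φ) := by
    rw [L.der_ct, ct_swap _ L.G_symm, L.bochner, ct_swap (fun m p => ric der Γ p q * der m φ) L.G_symm]
  have i4 : ct G (fun p s => nab2 der Γ (divForm der G Γ H) s p q) = 0 := by
    simp only [L.nab2_divForm]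
    exact L.div_div hH q
  have i5 : ct G (fun p s => nab2 der Γ (contrForm G H fun k => der k φ) s p q) =
      -ct G (fun p s => der s φ * divForm der G Γ H p q) := by
    simp only [L.nab2_contrForm, ct_add]
    have z : ct G (fun p s => ct G fun c t => H c p q * nab1 der Γ (fun k => der k φ) s t) = 0 := by
      have := ct_ct_symm_form (G := G) hH (L.nab1_symm φ) q
      rw [← this, ct_swap _ L.G_symm]
      congr 1; funext p s
      exact ct_swap _ L.G_symm
    rw [z, add_zero, ct_comm, ← ct_neg]
    congr 1; funext p s
    simp only [divForm, ← ct_mul_left, ← ct_neg]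
    congr 1; funext c t
    rw [nab3_swap₁₂ hH]; ring
  have i6 := L.der_gradSq (fun k => der k φ) q
  have i7 := L.der_normH hH q
  have j1 : ct G (fun p s => ct G fun k l => H l s q * divForm der G Γ H p k) =
      -ct G (fun r t => ct G fun s u => divForm der G Γ H r s * H q t u) := by
    rw [← ct_neg]
    congr 1; funext p s
    rw [← ct_neg]
    congr 1; funext k l
    rw [hH.swap₁₂ s l q, hH.swap₂₃ s q l, hH.swap₁₂ q s l]; ring
  have j2 : ct G (fun p s => ct G fun k l => H l s q * contrForm G H (fun k => der k φ) p k) =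
      -ct G (fun p s => der s φ * sqH G H p q) := by
    have e : ∀ p k, contrForm G H (fun k => der k φ) p k = ct G fun c t => der t φ * H c p k :=
      fun p k => by simp only [contrForm, mul_comm]
    simp only [e, sqH, ← ct_mul_left]
    rw [← ct_ct_ct_rotate]
    rw [← ct_neg]
    congr 1; funext p s
    rw [← ct_neg]
    congr 1; funext k l
    rw [← ct_neg]
    congr 1; funext m n
    rw [hH.swap₁₂ l n q, hH.swap₂₃ l q n, hH.swap₁₂ q l n]; ring
  have j3 : ct G (fun p s => der s φ * contrForm G H (fun k => der k φ) p q) = 0 := by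
    have := ct_ct_symm_form (G := G) hH (S := fun p k => der p φ * der k φ) (fun _ _ => mul_comm _ _) q
    rw [← this, ct_swap _ L.G_symm]
    simp only [contrForm, ← ct_mul_left]
    congr 1; funext p s
    rw [ct_swap _ L.G_symm]
    congr 1; funext k l
    ring
  have j4 := ct_ct_symm_form (G := G) hH L.ric_symm q
  have j5 := ct_ct_symm_form (G := G) hH (L.sqH_symm H) q
  have j6 := ct_ct_symm_form (G := G) hH (L.nab1_symm φ) q
  have k1 : ct G (fun p m => ric der Γ p q * der m φ) =
      ct G (fun p s => der s φ * ric der Γ p q) := by simp only [mul_comm]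
  have k2 : ct G (fun i j => der j φ * nab1 der Γ (fun k => der k φ) q i) =
      ct G (fun p s => der s φ * nab1 der Γ (fun k => der k φ) p q) := by
    simp only [L.nab1_symm φ q]
  simp only [nab2_kForm, kForm, rForm, mul_add, mul_sub, mul_neg, mul_smul_comm, ct_add, ct_sub,
    ct_neg, ct_smul, map_add, map_sub, Derivation.map_smul]
  rw [i2, i3, i4, i5, i6, i7, j1, j2, j3, j4, j5, j6, k1, k2, i1']
  linear_combination (norm := algebra) (-1 / 2 : ℝ) • i1

end LeviCivita

end DoubleField

namespace DoubleField

variable {ι A : Type*} [Fintype ι] [DecidableEq ι] [CommRing A] [Algebra ℝ A]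

/-! ### The field equations of double field theory over a differential algebra -/

/-- The symmetric part of `e`. -/
def symPart (e : Matrix ι ι A) : Matrix ι ι A := Matrix.of fun i j => (1 / 2 : ℝ) • (e i j + e j i)

/-- `Γ_{l,ij}` for the metric `g`. -/
def chrLow (der : ι → Derivation ℝ A A) (g : Matrix ι ι A) (l i j : ι) : A :=
  (1 / 2 : ℝ) • (der i (g j l) + der j (g i l) - der l (g i j))

/-- `Γ^k_{ij}` for the metric `g` with inverse `G`. -/
def chr (der : ι → Derivation ℝ A A) (g G : Matrix ι ι A) (k i j : ι) : A :=
  ∑ l, G k l * chrLow der g l i j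

/-- The field strength of the antisymmetric part of `e`. -/
def formH (der : ι → Derivation ℝ A A) (e : Matrix ι ι A) (i j k : ι) : A :=
  (1 / 2 : ℝ) • (der i (e j k) - der i (e k j) + (der j (e k i) - der j (e i k)) +
    (der k (e i j) - der k (e j i)))

/-- The connection with torsion, `Γ_{a,pq} - ½ H_{apq}`. -/
def mLow (der : ι → Derivation ℝ A A) (e : Matrix ι ι A) (a p q : ι) : A :=
  (1 / 2 : ℝ) • (der p (e a q) + der q (e p a) - der a (e p q))

/-- `Γ^i_{pq} - ½ H^i_{pq}`. -/
def mUp (der : ι → Derivation ℝ A A) (e G : Matrix ι ι A) (i p q : ι) : A :=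
  ∑ a, G i a * mLow der e a p q

/-- The generalized Ricci tensor in terms of the connection with torsion. -/
def kInt (der : ι → Derivation ℝ A A) (e G : Matrix ι ι A) (d : A) (p q : ι) : A :=
  -(∑ i, der i (mUp der e G i p q)) + ∑ i, ∑ m, mUp der e G i p m * mUp der e G m i q -
    (2 : ℝ) • der p (der q d) + (2 : ℝ) • ∑ m, mUp der e G m p q * der m d

variable {der : ι → Derivation ℝ A A} {g G e : Matrix ι ι A} {lam d φ : A}

theorem sum_sum_raise (X Y : ι → ι → A) :
    ∑ i, ∑ m, (∑ a, G i a * X a m) * (∑ b, G m b * Y b i) =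
      ct G fun i a => ct G fun m b => X a m * Y b i := by
  simp only [ct, Finset.sum_mul_sum]
  simp only [Finset.mul_sum]
  refine Finset.sum_congr rfl fun i _ => ?_
  rw [Finset.sum_comm]
  exact Finset.sum_congr rfl fun a _ => Finset.sum_congr rfl fun m _ =>
    Finset.sum_congr rfl fun b _ => by ring

theorem closedForm_formH (comm : ∀ i j f, der i (der j f) = der j (der i f)) :
    ClosedForm der (formH der e) where
  swap₁₂ i j k := by unfold formH; algebra
  swap₂₃ i j k := by unfold formH; algebra
  closed q i r s := by
    simp only [formH, Derivation.map_smul, map_add, map_sub, comm i q, comm r q, comm s q,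
      comm r i, comm s i, comm s r]
    algebra

theorem leviCivita_chr (comm : ∀ i j f, der i (der j f) = der j (der i f))
    (g_symm : ∀ i j, g i j = g j i) (G_symm : ∀ i j, G i j = G j i) (G_mul : G * g = 1)
    (trace : ∀ i, ∑ k, chr der g G k i k = der i lam) :
    LeviCivita der g G (chr der g G) lam where
  comm := comm
  g_symm := g_symm
  G_symm := G_symm
  G_mul := G_mul
  trace := trace
  tors k i j := by
    unfold chr chrLow
    exact Finset.sum_congr rfl fun l _ => by rw [g_symm i j, add_comm (der i _)]
  compat i j k := by
    have hl : ∀ i j k, ∑ l, chr der g G l i j * g l k = chrLow der g k i j := by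
      intro i j k
      have h : ∀ m, ∑ l, G l m * g l k = if m = k then 1 else 0 := by
        intro m
        have := congrFun (congrFun G_mul m) k
        simp only [Matrix.mul_apply, Matrix.one_apply] at this
        simp only [G_symm _ m, this]
      simp only [chr, Finset.sum_mul]
      rw [Finset.sum_comm]
      have : ∀ m, ∑ l, G l m * chrLow der g m i j * g l k =
          (if m = k then 1 else 0) * chrLow der g m i j := by
        intro m
        rw [← h, Finset.sum_mul]
        exact Finset.sum_congr rfl fun _ _ => by ring
      simp [this]
    have hr : ∑ l, chr der g G l i k * g j l = chrLow der g j i k := by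
      rw [← hl]; simp only [g_symm j]
    rw [Finset.sum_add_distrib, hl, hr]
    unfold chrLow
    rw [g_symm k j, g_symm i k, g_symm i j]
    algebra

namespace LeviCivita

variable {Γ : ι → ι → ι → A}

/-- The divergence of a vector field. -/
theorem sum_der_raise (L : LeviCivita der g G Γ lam) (Y : ι → A) :
    ∑ i, der i (∑ a, G i a * Y a) =
      ct G (fun i a => nab1 der Γ Y i a) - ∑ i, der i lam * ∑ a, G i a * Y a := by
  simp only [map_sum, Derivation.leibniz, smul_eq_mul, L.der_G, nab1, ct, mul_sub,
    Finset.sum_sub_distrib, Finset.sum_add_distrib, mul_neg, Finset.sum_neg_distrib,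
    Finset.mul_sum, mul_add, ← L.trace, Finset.sum_mul]
  have e1 : ∑ i, ∑ a, ∑ m, Y a * (Γ i i m * G m a) = ∑ i, ∑ a, ∑ m, Γ m i m * (G i a * Y a) := by
    rw [Finset.sum_comm, Finset.sum_comm (f := fun i a => ∑ m, Γ m i m * (G i a * Y a))]
    refine Finset.sum_congr rfl fun a _ => ?_
    refine sum_sum_eq_of_swap fun i m => ?_
    rw [L.tors i i m]; ring
  have e2 : ∑ i, ∑ a, ∑ m, Y a * (Γ a i m * G i m) = ∑ i, ∑ a, ∑ m, G i a * (Γ m i a * Y m) := by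
    refine Finset.sum_congr rfl fun i _ => sum_sum_eq_of_swap fun a m => ?_
    ring
  rw [e1, e2]
  ring

theorem divForm_eq (L : LeviCivita der g G Γ lam) (H : ι → ι → ι → A) (p q : ι) :
    divForm der G Γ H p q = ∑ i, der i (∑ a, G i a * H a p q) +
      ∑ i, der i lam * ∑ a, G i a * H a p q -
      ∑ i, ∑ m, Γ m i p * ∑ a, G i a * H a m q - ∑ i, ∑ m, Γ m i q * ∑ a, G i a * H a p m := by
  rw [L.sum_der_raise fun a => H a p q]
  unfold divForm
  rw [ct_swap _ L.G_symm]
  simp only [nab3, nab1, ct_sub, ct_sum]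
  have e : ∀ (X : ι → ι → ι → A) (p : ι), ct G (fun a b => ∑ m, Γ m a p * X b m p) =
      ∑ i, ∑ m, Γ m i p * ∑ a, G i a * X a m p := by
    intro X p
    simp only [ct, Finset.mul_sum]
    refine Finset.sum_congr rfl fun i _ => sum_sum_eq_of_swap fun a m => ?_
    ring
  rw [← e fun a m p => H a m q, ← e fun a m q => H a p m]
  simp only [ct_sum]
  ring

/-- `H^i_{pq}`. -/
def _root_.DoubleField.hUp (der : ι → Derivation ℝ A A) (e G : Matrix ι ι A) (i p q : ι) : A :=
  ∑ a, G i a * formH der e a p q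

theorem _root_.DoubleField.mLow_eq (a p q : ι) :
    mLow der e a p q = chrLow der (symPart e) a p q - (1 / 2 : ℝ) • formH der e a p q := by
  simp only [mLow, chrLow, symPart, formH, Matrix.of_apply, Derivation.map_smul, map_add]
  algebra

theorem _root_.DoubleField.mUp_eq (i p q : ι) :
    mUp der e G i p q = chr der (symPart e) G i p q - (1 / 2 : ℝ) • hUp der e G i p q := by
  simp only [mUp, chr, hUp, mLow_eq, mul_sub, Finset.sum_sub_distrib, mul_smul_comm,
    ← Finset.smul_sum]

theorem kInt_eq_kForm (L : LeviCivita der (symPart e) G (chr der (symPart e) G) lam)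
    (hd : ∀ i, der i d = der i φ - (1 / 2 : ℝ) • der i lam) (p q : ι) :
    kInt der e G d p q = kForm der G (chr der (symPart e) G) (formH der e) φ p q := by
  have hH := closedForm_formH (e := e) L.comm
  set Γ := chr der (symPart e) G with hΓ
  have e1 : ∑ i, ∑ m, Γ i p m * hUp der e G m i q = ∑ i, ∑ m, Γ m i p * hUp der e G i m q :=
    sum_sum_eq_of_swap fun i m => by rw [L.tors i p m]
  have e2 : ∑ i, ∑ m, hUp der e G i p m * Γ m i q = ∑ i, ∑ m, Γ m i q * hUp der e G i p m := by
    simp only [mul_comm]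
  have e3 : ∑ i, ∑ m, hUp der e G i p m * hUp der e G m i q = sqH G (formH der e) p q := by
    have : sqH G (formH der e) p q = ct G fun i a => ct G fun m b =>
        formH der e a p m * formH der e b i q := by
      unfold sqH
      rw [ct_comm, ct_swap _ L.G_symm]
      congr 1; funext i a
      congr 1; funext m b
      rw [hH.swap₁₂ p a m, hH.swap₂₃ p m a, hH.swap₂₃ b q i, hH.swap₁₂ q b i]; ring
    rw [this]
    exact sum_sum_raise _ _
  have e4 := L.divForm_eq (formH der e) p q
  have e5 := L.ric_eq q p
  have c : contrForm G (formH der e) (fun k => der k φ) p q =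
      ∑ m, hUp der e G m p q * der m φ := by
    simp only [contrForm, ct, hUp, Finset.sum_mul]
    refine sum_sum_eq_of_swap fun s t => ?_
    rw [L.G_symm]; ring
  have s1 : ∑ i, der i (mUp der e G i p q) = ∑ i, der i (Γ i p q) -
      (1 / 2 : ℝ) • ∑ i, der i (hUp der e G i p q) := by
    simp only [mUp_eq, map_sub, Derivation.map_smul, Finset.sum_sub_distrib, Finset.smul_sum, hΓ]
  have s2 : ∑ i, ∑ m, mUp der e G i p m * mUp der e G m i q = ∑ i, ∑ m, Γ i p m * Γ m i q -
      (1 / 2 : ℝ) • (∑ i, ∑ m, Γ i p m * hUp der e G m i q +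
        ∑ i, ∑ m, hUp der e G i p m * Γ m i q) +
      (1 / 4 : ℝ) • ∑ i, ∑ m, hUp der e G i p m * hUp der e G m i q := by
    simp only [Finset.smul_sum, ← Finset.sum_add_distrib, ← Finset.sum_sub_distrib, mUp_eq, ← hΓ]
    exact Finset.sum_congr rfl fun i _ => Finset.sum_congr rfl fun m _ => by algebra
  have s3 : ∑ m, mUp der e G m p q * der m d = ∑ m, Γ m p q * der m φ -
      (1 / 2 : ℝ) • ∑ m, der m lam * Γ m p q - (1 / 2 : ℝ) • ∑ m, hUp der e G m p q * der m φ +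
      (1 / 4 : ℝ) • ∑ m, der m lam * hUp der e G m p q := by
    simp only [Finset.smul_sum, ← Finset.sum_add_distrib, ← Finset.sum_sub_distrib, mUp_eq, ← hΓ,
      hd]
    exact Finset.sum_congr rfl fun i _ => by algebra
  rw [kInt, kForm, s1, s2, s3, e1, e2, e3, e4, L.ric_symm p q, e5, hd, c]
  simp only [nab1, map_sub, Derivation.map_smul, hUp]
  algebra

end LeviCivita

end DoubleField

namespace DoubleField

variable {ι A : Type*} [Fintype ι] [DecidableEq ι] [CommRing A] [Algebra ℝ A]
  {der : ι → Derivation ℝ A A} {g G e : Matrix ι ι A} {lam d φ : A}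

/-- `Γ^k_{ij}` with unbarred indices. -/
def gUU (der : ι → Derivation ℝ A A) (e G : Matrix ι ι A) (k i j : ι) : A :=
  ∑ l, G k l * ((1 / 2 : ℝ) • der i (e j l))

/-- `Γ^k_{ij}` with barred indices. -/
def gBB (der : ι → Derivation ℝ A A) (e G : Matrix ι ι A) (k i j : ι) : A :=
  ∑ l, G k l * ((1 / 2 : ℝ) • der i (e l j))

/-- `∇_t 𝒟_i ℰ_{jk}`. -/
def covU (der : ι → Derivation ℝ A A) (e G : Matrix ι ι A) (t i j k : ι) : A :=
  der t (der i (e j k)) - ∑ m, gUU der e G m t i * der m (e j k) -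
    ∑ m, gUU der e G m t j * der i (e m k) - ∑ m, mUp der e G m t k * der i (e j m)

/-- `∇̄_t 𝒟̄_i ℰ_{jk}`. -/
def covB (der : ι → Derivation ℝ A A) (e G : Matrix ι ι A) (t i j k : ι) : A :=
  der t (der i (e j k)) - ∑ m, gBB der e G m t i * der m (e j k) -
    ∑ m, mUp der e G m j t * der i (e m k) - ∑ m, gBB der e G m t k * der i (e j m)

theorem sum_raise_mul (X Y : ι → A) :
    ∑ m, (∑ l, G m l * X l) * Y m = ct G fun m l => X l * Y m := by
  simp only [ct, Finset.sum_mul, mul_assoc]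

namespace LeviCivita

variable {Γ : ι → ι → ι → A}

theorem derMat_G' (L : LeviCivita der g G Γ lam) (k : ι) :
    derMat (der k) G = -(G * derMat (der k) g * G) := by
  have h := derMat_mul (der k) G g
  rw [L.G_mul, derMat_one] at h
  have h2 := congrArg (· * G) h
  simp only [Matrix.zero_mul, add_mul, mul_assoc, L.mul_G, mul_one] at h2
  rw [eq_neg_iff_add_eq_zero, mul_assoc]
  exact h2.symm

theorem der_G' (L : LeviCivita der g G Γ lam) (k a b : ι) :
    der k (G a b) = -∑ m, ∑ n, G a m * der k (g m n) * G n b := by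
  have h := congrFun (congrFun (L.derMat_G' k) a) b
  simp only [derMat_apply, Matrix.neg_apply, Matrix.mul_apply, Finset.sum_mul] at h
  rw [h, Finset.sum_comm]

theorem sum_der_raise' (L : LeviCivita der g G Γ lam) (Y : ι → A) :
    ∑ i, der i (∑ a, G i a * Y a) = ct G (fun i a => der i (Y a)) -
      ct G (fun i m => ct G fun n a => der i (g m n) * Y a) := by
  simp only [map_sum, Derivation.leibniz, smul_eq_mul, L.der_G', ct, mul_neg,
    Finset.sum_add_distrib, Finset.sum_neg_distrib, sub_eq_add_neg]
  congr 2
  simp only [Finset.mul_sum]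
  refine Finset.sum_congr rfl fun i _ => ?_
  rw [Finset.sum_comm]
  refine Finset.sum_congr rfl fun m _ => ?_
  rw [Finset.sum_comm]
  exact Finset.sum_congr rfl fun _ _ => Finset.sum_congr rfl fun _ _ => by ring

end LeviCivita

theorem covariant_quadratic (hG : ∀ a b, G a b = G b a) (x : ι → ι → ι → A) (p q : ι)
    (ml : ι → ι → ι → A) (hml : ∀ a p q, ml a p q = (1 / 2 : ℝ) • (x p a q + x q p a - x a p q)) :
    ct G (fun a b => ct G fun c d =>
      (-1 / 4 : ℝ) • ((1 / 2 : ℝ) • x b a d * x c p q + (1 / 2 : ℝ) • x b p d * x a c q +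
        ml d b q * x a p c + (1 / 2 : ℝ) • x b d a * x c p q + ml d p b * x a c q +
        (1 / 2 : ℝ) • x b d q * x a p c) +
      (1 / 2 : ℝ) • ((1 / 2 : ℝ) • x b p d * x c a q + (1 / 2 : ℝ) • x b a d * x p c q +
        ml d b q * x p a c + (1 / 2 : ℝ) • x b d q * x c p a + ml d p b * x q c a +
        (1 / 2 : ℝ) • x b d a * x q p c) +
      (1 / 4 : ℝ) • (x q p a * x d c b + (1 / 2 : ℝ) • (x q c b * x d p a) + x p a q * x d b c +
        (1 / 2 : ℝ) • (x p b c * x d a q)) -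
      (1 / 4 : ℝ) • (x d a q * x b p c + (1 / 2 : ℝ) • (x b c a * x d p q) +
        (1 / 2 : ℝ) • (x b p q * x d c a)) -
      (1 / 4 : ℝ) • (x q a c * x p b d) -
      ((1 / 2 : ℝ) • (x a b c + x a c b) * ml d p q + ml b p c * ml d a q)) = 0 := by
  refine ct_ct_eq_zero hG _ fun a b c d => ?_
  simp only [hml]
  algebra

/-- The covariant expression for the generalized Ricci tensor. -/
def covK (der : ι → Derivation ℝ A A) (e G : Matrix ι ι A) (d : A) (p q : ι) : A :=
  (1 / 4 : ℝ) • ct G (fun s t => covU der e G t s p q + covB der e G t s p q -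
    (2 : ℝ) • covU der e G t p s q - (2 : ℝ) • covB der e G t q p s) -
  ((der q (der p d) - ∑ k, mUp der e G k p q * der k d) +
    (der p (der q d) - ∑ k, mUp der e G k p q * der k d)) +
  (1 / 4 : ℝ) • ct G (fun j k => ct G fun i m =>
    der q (e p j) * der m (e i k) + (1 / 2 : ℝ) • (der q (e i k) * der m (e p j)) +
      der p (e j q) * der m (e k i) + (1 / 2 : ℝ) • (der p (e k i) * der m (e j q))) -
  (1 / 4 : ℝ) • ct G (fun i n => ct G fun j m =>
    der m (e i q) * der n (e p j) + (1 / 2 : ℝ) • (der n (e j i) * der m (e p q)) +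
      (1 / 2 : ℝ) • (der n (e p q) * der m (e j i))) -
  (1 / 4 : ℝ) • ct G (fun i k => ct G fun j l => der q (e i j) * der p (e k l))

theorem LeviCivita.covK_eq_kInt {Γ : ι → ι → ι → A} (L : LeviCivita der (symPart e) G Γ lam)
    (p q : ι) : covK der e G d p q = kInt der e G d p q := by
  have hq := covariant_quadratic L.G_symm (fun i j k => der i (e j k)) p q (mLow der e)
    fun _ _ _ => rfl
  simp only [ct_add, ct_sub, ct_smul] at hq
  have h2 := L.sum_der_raise' fun a => mLow der e a p q
  have h3 := sum_sum_raise (G := G) (fun a m => mLow der e a p m) (fun b i => mLow der e b i q)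
  have h4 : ∀ i m n, der i (symPart e m n) = (1 / 2 : ℝ) • (der i (e m n) + der i (e n m)) :=
    fun i m n => by simp [symPart]
  have h5 : ct G (fun i a => der i (mLow der e a p q)) = (1 / 2 : ℝ) • (
      ct G (fun a i => der i (der p (e a q))) + ct G (fun a i => der i (der q (e p a))) -
      ct G (fun a i => der i (der a (e p q)))) := by
    rw [ct_swap _ L.G_symm]
    simp only [mLow, Derivation.map_smul, map_add, map_sub, ct_smul, ct_add, ct_sub]
  rw [h5] at h2
  simp only [h4] at h2
  unfold covK kInt
  have e1 : ∑ i, der i (mUp der e G i p q) =  ∑ i, der i (∑ a, G i a * mLow der e a p q) := rfl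
  have e2 : ∑ i, ∑ m, mUp der e G i p m * mUp der e G m i q =
    ∑ i, ∑ m, (∑ a, G i a * mLow der e a p m) * (∑ b, G m b * mLow der e b i q) := rfl
  rw [e1, e2, h2, h3, L.comm q p]
  simp only [covU, covB, gUU, gBB, mUp, sum_raise_mul (G := G), ct_add, ct_sub, ct_smul]
  linear_combination (norm := skip) hq
  simp only [ct_add, ct_smul, add_mul, smul_mul_assoc]
  module

end DoubleField

namespace DoubleField

variable {ι A : Type*} [Fintype ι] [DecidableEq ι] [CommRing A] [Algebra ℝ A]

/-! ### The Lagrangian and its partial derivatives -/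

/-- The Lagrangian (without the factor `e^{-2d}`) for fields independent of the dual coordinates, in
terms of the inverse metric `G`, `x = ∂ℰ` and `v = ∂d`. -/
def ell (G : Matrix ι ι A) (x : ι → ι → ι → A) (v : ι → A) : A :=
  (-1 / 4 : ℝ) • ct G (fun i k => ct G fun j l => ct G fun p r => x r k l * x p i j) +
  (1 / 4 : ℝ) • ct G (fun k l => ct G fun j m => ct G fun i n =>
    x m i k * x n j l + x m k i * x n l j) +
  ct G (fun i k => ct G fun j l => v k * x l i j + v k * x l j i) +
  (4 : ℝ) • ct G (fun i j => v i * v j)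

/-- The part quadratic in `∂ℰ` of the partial derivative of `ell` with respect to `G^{ab}`. -/
def ellGquad (G : Matrix ι ι A) (x : ι → ι → ι → A) (a b : ι) : A :=
  (-1 / 4 : ℝ) • (ct G (fun j l => ct G fun p r => x r b l * x p a j) +
    ct G (fun i k => ct G fun p r => x r k b * x p i a) +
    ct G (fun i k => ct G fun j l => x b k l * x a i j)) +
  (1 / 4 : ℝ) • (ct G (fun j m => ct G fun i n => x m i a * x n j b + x m a i * x n b j) +
    ct G (fun k l => ct G fun i n => x b i k * x n a l + x b k i * x n l a) +
    ct G (fun k l => ct G fun j m => x m a k * x b j l + x m k a * x b l j))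

/-- The part linear in `∂ℰ` of the partial derivative of `ell` with respect to `G^{ab}`. -/
def ellGlin (G : Matrix ι ι A) (x : ι → ι → ι → A) (v : ι → A) (a b : ι) : A :=
  ct G (fun j l => v b * x l a j + v b * x l j a) + ct G (fun i k => v k * x b i a + v k * x b a i)

/-- The partial derivative of `ell` with respect to `G^{ab}`. -/
def ellG (G : Matrix ι ι A) (x : ι → ι → ι → A) (v : ι → A) (a b : ι) : A :=
  ellGquad G x a b + ellGlin G x v a b + (4 : ℝ) • (v a * v b)

/-- `½ (x_{paq} + x_{qpa} - x_{apq})`. -/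
def mArr (x : ι → ι → ι → A) (a p q : ι) : A := (1 / 2 : ℝ) • (x p a q + x q p a - x a p q)

/-- The partial derivative of `ell` with respect to `∂_i ℰ_{pq}`. -/
def ellx (G : Matrix ι ι A) (x : ι → ι → ι → A) (v : ι → A) (i p q : ι) : A :=
  ∑ a, ∑ b, ∑ c, G i a * G p b * G q c * mArr x a b c +
    (∑ k, G p k * v k) * G q i + (∑ k, G q k * v k) * G p i

/-- The partial derivative of `ell` with respect to `∂_n d`. -/
def ellv (G : Matrix ι ι A) (x : ι → ι → ι → A) (v : ι → A) (n : ι) : A :=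
  ∑ i, G n i * (ct G (fun j l => x l i j + x l j i) + (8 : ℝ) • v i)

variable {der : ι → Derivation ℝ A A} {g G e : Matrix ι ι A} {lam d φ : A}

theorem sum_sum_sum_eq_of_reverse {f h : ι → ι → ι → A} (hf : ∀ x y z, f x y z = h z y x) :
    ∑ x, ∑ y, ∑ z, f x y z = ∑ x, ∑ y, ∑ z, h x y z := by
  simp only [hf]
  rw [Finset.sum_comm]
  rw [Finset.sum_congr rfl fun y _ => Finset.sum_comm, Finset.sum_comm]

theorem ellG_quadratic (hG : ∀ a b, G a b = G b a) (x : ι → ι → ι → A) (p q : ι) :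
    (-1 / 2 : ℝ) • (ellGquad G x p q + ellGquad G x q p) +
      ct G (fun a b => ct G fun c d => (1 / 2 : ℝ) • (x c p a + x c a p) * mArr x d b q +
        mArr x d p a * ((1 / 2 : ℝ) • (x c b q + x c q b))) =
      ct G (fun a b => ct G fun c d => mArr x b p c * mArr x d a q) := by
  have h := ct_ct_eq_zero hG (fun a b c d => (-1 / 2 : ℝ) • (
    (-1 / 4 : ℝ) • (x d q b * x c p a + x d b q * x c a p + x q b d * x p a c) +
    (1 / 4 : ℝ) • (x b c p * x d a q + x b p c * x d q a + (x q c a * x d p b + x q a c * x d b p) +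
      (x d p a * x q c b + x d a p * x q b c)) +
    ((-1 / 4 : ℝ) • (x d p b * x c q a + x d b p * x c a q + x p b d * x q a c) +
    (1 / 4 : ℝ) • (x b c q * x d a p + x b q c * x d p a + (x p c a * x d q b + x p a c * x d b q) +
      (x d q a * x p c b + x d a q * x p b c)))) +
    ((1 / 2 : ℝ) • (x c p a + x c a p) * mArr x d b q +
        mArr x d p a * ((1 / 2 : ℝ) • (x c b q + x c q b))) - mArr x b p c * mArr x d a q)
    fun a b c d => by unfold mArr; algebra
  unfold ellGquad
  simp only [ct_add, ct_sub, ct_smul] at h ⊢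
  linear_combination (norm := module) h

theorem ell_linear_x (hG : ∀ a b, G a b = G b a) (x y : ι → ι → ι → A) :
    (-1 / 4 : ℝ) • ct G (fun i k => ct G fun j l => ct G fun p r =>
      y r k l * x p i j + x r k l * y p i j) +
    (1 / 4 : ℝ) • ct G (fun k l => ct G fun j m => ct G fun i n =>
      y m i k * x n j l + x m i k * y n j l + (y m k i * x n l j + x m k i * y n l j)) =
    ct G (fun i a => ct G fun p b => ct G fun q c => y i p q * mArr x a b c) := by
  have h := ct_ct_ct_eq_zero hG (fun a a' b b' c c' =>
    (-1 / 4 : ℝ) • (y c' a' b' * x c a b + x c' a' b' * y c a b) +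
    (1 / 4 : ℝ) • (y b c a * x c' b' a' + x b c a * y c' b' a' +
      (y b a c * x c' a' b' + x b a c * y c' a' b')) - y a b c * mArr x a' b' c')
    fun a a' b b' c c' => by unfold mArr; algebra
  have hs : ct G (fun k l => ct G fun j m => ct G fun i n =>
      y m i k * x n j l + x m i k * y n j l + (y m k i * x n l j + x m k i * y n l j)) =
      ct G (fun k l => ct G fun m j => ct G fun i n =>
      y m i k * x n j l + x m i k * y n j l + (y m k i * x n l j + x m k i * y n l j)) := by
    congr 1; funext k l; exact ct_swap _ hG
  rw [hs]
  simp only [ct_add, ct_sub, ct_smul] at h ⊢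
  linear_combination (norm := module) h

/-- The variational derivative of the action with respect to `ℰ`, with lowered indices and without
the density, for fields independent of the dual coordinates. -/
def kEL (der : ι → Derivation ℝ A A) (e g G : Matrix ι ι A) (d : A) (p q : ι) : A :=
  ∑ k, ∑ l, g p k * g q l * ((-1 / 2 : ℝ) • (∑ a, ∑ b, (G a k * G l b + G a l * G k b) *
      ellG G (fun i j k => der i (e j k)) (fun i => der i d) a b) -
    ∑ i, der i (ellx G (fun i j k => der i (e j k)) (fun i => der i d) i k l) +
    (2 : ℝ) • ∑ i, der i d * ellx G (fun i j k => der i (e j k)) (fun i => der i d) i k l)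

namespace LeviCivita

variable {Γ : ι → ι → ι → A}

/-- The mixed form of `ellx`. -/
def _root_.DoubleField.ellxMat (der : ι → Derivation ℝ A A) (e G : Matrix ι ι A) (d : A) (i : ι) :
    Matrix ι ι A :=
  Matrix.of fun b c => mUp der e G i b c + (if c = i then der b d else 0) +
    (if b = i then der c d else 0)

theorem of_ellx (L : LeviCivita der g G Γ lam) (i : ι) :
    Matrix.of (ellx G (fun i j k => der i (e j k)) (fun i => der i d) i) =
      G * ellxMat der e G d i * G := by
  ext p q
  have h1 : ∑ j, (∑ b, G p b * if j = i then der b d else 0) * G j q =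
      (∑ k, G p k * der k d) * G q i := by
    rw [Finset.sum_eq_single i (fun j _ hj => by simp [hj]) (by simp)]
    simp [L.G_symm q i]
  have h2 : ∑ j, (∑ b, G p b * if b = i then der j d else 0) * G j q =
      (∑ k, G q k * der k d) * G p i := by
    simp only [mul_ite, mul_zero, Finset.sum_ite_eq', Finset.mem_univ, if_true, Finset.sum_mul]
    exact Finset.sum_congr rfl fun j _ => by rw [L.G_symm j q]; ring
  have h3 : ∑ j, (∑ b, G p b * mUp der e G i b j) * G j q =
      ∑ a, ∑ b, ∑ c, G i a * G p b * G q c * mLow der e a b c := by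
    simp only [mUp, Finset.mul_sum, Finset.sum_mul]
    rw [Finset.sum_comm]
    rw [Finset.sum_congr rfl fun b _ => Finset.sum_comm, Finset.sum_comm]
    exact Finset.sum_congr rfl fun a _ => Finset.sum_congr rfl fun b _ =>
      Finset.sum_congr rfl fun c _ => by rw [L.G_symm c q]; ring
  simp only [ellx, ellxMat, Matrix.of_apply, Matrix.mul_apply, mul_add, Finset.sum_add_distrib,
    add_mul, h1, h2, h3]
  rfl

theorem lower_two (L : LeviCivita der g G Γ lam) (X : Matrix ι ι A) (p q : ι) :
    ∑ k, ∑ l, g p k * g q l * X k l = (g * X * g) p q := by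
  simp only [Matrix.mul_apply, Finset.sum_mul]
  exact sum_sum_eq_of_swap fun k l => by rw [L.g_symm q l]; ring

theorem lower_ellxMat (L : LeviCivita der g G Γ lam) (i : ι) :
    g * Matrix.of (ellx G (fun i j k => der i (e j k)) (fun i => der i d) i) * g =
      ellxMat der e G d i := by
  rw [L.of_ellx, ← mul_assoc, ← mul_assoc, L.mul_G, one_mul, mul_assoc, L.G_mul, mul_one]

theorem lower_derMat_ellx (L : LeviCivita der g G Γ lam) (i : ι) :
    g * derMat (der i) (Matrix.of (ellx G (fun i j k => der i (e j k)) (fun i => der i d) i)) * g =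
      derMat (der i) (ellxMat der e G d i) - derMat (der i) g * G * ellxMat der e G d i -
        ellxMat der e G d i * G * derMat (der i) g := by
  have h := congrArg (derMat (der i)) (L.lower_ellxMat (e := e) (d := d) i)
  rw [derMat_mul, derMat_mul] at h
  rw [← h, L.of_ellx]
  simp only [mul_assoc, add_mul, L.G_mul, mul_one]
  simp only [← mul_assoc, L.mul_G, one_mul]
  abel

theorem kEL_eq (L : LeviCivita der (symPart e) G Γ lam) (p q : ι) :
    kEL der e (symPart e) G d p q =
      (-1 / 2 : ℝ) • (ellG G (fun i j k => der i (e j k)) (fun i => der i d) p q +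
        ellG G (fun i j k => der i (e j k)) (fun i => der i d) q p) -
      ∑ i, (derMat (der i) (ellxMat der e G d i) -
        derMat (der i) (symPart e) * G * ellxMat der e G d i -
        ellxMat der e G d i * G * derMat (der i) (symPart e)) p q +
      (2 : ℝ) • ∑ i, der i d * ellxMat der e G d i p q := by
  set g := symPart e
  set x : ι → ι → ι → A := fun i j k => der i (e j k)
  set v : ι → A := fun i => der i d
  have h1 : ∑ k, ∑ l, g p k * g q l * (∑ a, ∑ b, (G a k * G l b + G a l * G k b) *
      ellG G x v a b) = ellG G x v p q + ellG G x v q p := by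
    have e1 : ∀ k l, ∑ a, ∑ b, (G a k * G l b + G a l * G k b) * ellG G x v a b =
        (G * (Matrix.of (ellG G x v) + (Matrix.of (ellG G x v)).transpose) * G) k l := by
      intro k l
      simp only [mul_add, Matrix.add_apply, Matrix.mul_apply, Finset.sum_mul, add_mul,
        Finset.sum_add_distrib, Matrix.transpose_apply, Matrix.of_apply]
      congr 1
      · exact sum_sum_eq_of_swap fun a b => by rw [L.G_symm a k, L.G_symm b l]; ring
      · exact Finset.sum_congr rfl fun a _ => Finset.sum_congr rfl fun b _ => by ring
    simp only [e1]
    rw [L.lower_two, mul_assoc, mul_assoc, L.G_mul, mul_one, ← mul_assoc, L.mul_G, one_mul]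
    rfl
  have h2 : ∀ i, ∑ k, ∑ l, g p k * g q l * der i (ellx G x v i k l) =
      (derMat (der i) (ellxMat der e G d i) - derMat (der i) g * G * ellxMat der e G d i -
        ellxMat der e G d i * G * derMat (der i) g) p q := by
    intro i
    rw [← L.lower_derMat_ellx, ← L.lower_two]
    rfl
  have h3 : ∀ i, ∑ k, ∑ l, g p k * g q l * ellx G x v i k l = ellxMat der e G d i p q := by
    intro i
    rw [← L.lower_ellxMat, ← L.lower_two]
    rfl
  unfold kEL
  rw [← h1]
  simp only [← h2, ← h3, mul_add, mul_sub, Finset.sum_add_distrib, Finset.sum_sub_distrib,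
    mul_smul_comm, ← Finset.smul_sum]
  have hc : ∀ X : ι → ι → ι → A, ∑ k, ∑ l, g p k * g q l * ∑ i, X i k l =
      ∑ i, ∑ k, ∑ l, g p k * g q l * X i k l := by
    intro X
    simp only [Finset.mul_sum]
    exact (Finset.sum_congr rfl fun k _ => Finset.sum_comm).trans Finset.sum_comm
  rw [hc fun i k l => der i (ellx G x v i k l), hc fun i k l => der i d * ellx G x v i k l]
  congr 2
  refine Finset.sum_congr rfl fun i _ => ?_
  simp only [Finset.mul_sum]
  exact Finset.sum_congr rfl fun k _ => Finset.sum_congr rfl fun l _ => mul_left_comm _ _ _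

theorem _root_.DoubleField.ellG_linear (hG : ∀ a b, G a b = G b a) (x : ι → ι → ι → A)
    (v : ι → A) (p q : ι) :
    (-1 / 2 : ℝ) • (ellGlin G x v p q + ellGlin G x v q p) +
      (ct G (fun m n => (1 / 2 : ℝ) • (x q p m + x q m p) * v n) +
        ct G (fun m i => (1 / 2 : ℝ) • (x i p m + x i m p)) * v q) +
      (v p * ct G (fun i m => (1 / 2 : ℝ) • (x i m q + x i q m)) +
        ct G (fun n m => v n * ((1 / 2 : ℝ) • (x p m q + x p q m)))) = 0 := by
  have h := ct_eq_zero_of_swap (G := G) (fun a b => (-1 / 2 : ℝ) • (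
      v q * x b p a + v q * x b a p + (v b * x q a p + v b * x q p a) +
      (v p * x b q a + v p * x b a q + (v b * x p a q + v b * x p q a))) +
      (1 / 2 : ℝ) • (x q p a + x q a p) * v b + (1 / 2 : ℝ) • (x b p a + x b a p) * v q +
      v p * ((1 / 2 : ℝ) • (x a b q + x a q b)) + v a * ((1 / 2 : ℝ) • (x p b q + x p q b)))
    hG fun a b => by algebra
  unfold ellGlin
  simp only [← ct_mul_left, ← ct_mul_right]
  simp only [ct_add, ct_smul, smul_mul_assoc, mul_smul_comm, add_mul, mul_add] at h ⊢
  linear_combination (norm := module) h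

theorem kEL_eq_kInt (L : LeviCivita der (symPart e) G Γ lam) (p q : ι) :
    kEL der e (symPart e) G d p q = kInt der e G d p q := by
  have hg : ∀ i m n, der i (symPart e m n) = (1 / 2 : ℝ) • (der i (e m n) + der i (e n m)) :=
    fun i m n => by simp [symPart]
  have a : ∑ i, (derMat (der i) (symPart e) * G * ellxMat der e G d i) p q =
      ct G (fun m n => ct G fun i a => der i (symPart e p m) * mLow der e a n q) +
      (ct G (fun m n => der q (symPart e p m) * der n d) +
        ct G (fun m i => der i (symPart e p m)) * der q d) := by
    have a1 : ∑ i, ∑ n, (∑ m, der i (symPart e p m) * G m n) * mUp der e G i n q =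
        ct G (fun m n => ct G fun i a => der i (symPart e p m) * mLow der e a n q) := by
      rw [ct_comm]
      simp only [mUp, ct, Finset.sum_mul_sum]
      simp only [Finset.mul_sum]
      refine Finset.sum_congr rfl fun i _ => sum_sum_sum_eq_of_reverse fun n m a => ?_
      ring
    have a2 : ∑ i, ∑ n, (∑ m, der i (symPart e p m) * G m n) * (if q = i then der n d else 0) =
        ct G (fun m n => der q (symPart e p m) * der n d) := by
      rw [Finset.sum_eq_single q (fun i _ hi => by simp [hi.symm]) (by simp)]
      simp only [if_true, Finset.sum_mul, ct]
      exact sum_sum_eq_of_swap fun m n => by ring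
    have a3 : ∑ i, ∑ n, (∑ m, der i (symPart e p m) * G m n) * (if n = i then der q d else 0) =
        ct G (fun m i => der i (symPart e p m)) * der q d := by
      simp only [mul_ite, mul_zero, Finset.sum_ite_eq', Finset.mem_univ, if_true, Finset.sum_mul,
        ct]
      exact sum_sum_eq_of_swap fun m n => by ring
    simp only [Matrix.mul_apply, derMat_apply, ellxMat, Matrix.of_apply, mul_add,
      Finset.sum_add_distrib, a1, a2, a3, add_assoc]
  have b : ∑ i, (ellxMat der e G d i * G * derMat (der i) (symPart e)) p q =
      ct G (fun n m => ct G fun i a => mLow der e a p n * der i (symPart e m q)) +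
      (der p d * ct G (fun i m => der i (symPart e m q)) +
        ct G (fun n m => der n d * der p (symPart e m q))) := by
    have b1 : ∑ i, ∑ m, (∑ n, mUp der e G i p n * G n m) * der i (symPart e m q) =
        ct G (fun n m => ct G fun i a => mLow der e a p n * der i (symPart e m q)) := by
      rw [ct_comm]
      simp only [mUp, ct, Finset.sum_mul]
      simp only [Finset.mul_sum]
      refine Finset.sum_congr rfl fun i _ => sum_sum_sum_eq_of_reverse fun m n a => ?_
      ring
    have b2 : ∑ i, ∑ m, (∑ n, (if n = i then der p d else 0) * G n m) * der i (symPart e m q) =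
        der p d * ct G (fun i m => der i (symPart e m q)) := by
      simp only [ite_mul, zero_mul, Finset.sum_ite_eq', Finset.mem_univ, if_true, Finset.mul_sum,
        ct, mul_assoc]
    have b3 : ∑ i, ∑ m, (∑ n, (if p = i then der n d else 0) * G n m) * der i (symPart e m q) =
        ct G (fun n m => der n d * der p (symPart e m q)) := by
      rw [Finset.sum_eq_single p (fun i _ hi => by simp [hi.symm]) (by simp)]
      simp only [if_true, Finset.sum_mul, ct]
      exact sum_sum_eq_of_swap fun m n => by ring
    simp only [Matrix.mul_apply, derMat_apply, ellxMat, Matrix.of_apply, add_mul,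
      Finset.sum_add_distrib, b1, b2, b3, add_assoc]
  have c : ∑ i, derMat (der i) (ellxMat der e G d i) p q =
      ∑ i, der i (mUp der e G i p q) + (2 : ℝ) • der p (der q d) := by
    simp only [derMat_apply, ellxMat, Matrix.of_apply, map_add, Finset.sum_add_distrib,
      apply_ite (der _), map_zero, Finset.sum_ite_eq, Finset.mem_univ, if_true, L.comm q p]
    module
  have c' : ∑ i, der i d * ellxMat der e G d i p q =
      ∑ m, mUp der e G m p q * der m d + (2 : ℝ) • (der p d * der q d) := by
    simp only [ellxMat, Matrix.of_apply, mul_add, Finset.sum_add_distrib, mul_ite, mul_zero,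
      Finset.sum_ite_eq, Finset.mem_univ, if_true, mul_comm (der _ d) (mUp _ _ _ _ _ _)]
    algebra
  have h1 := ellG_quadratic L.G_symm (fun i j k => der i (e j k)) p q
  have h2 := ellG_linear L.G_symm (fun i j k => der i (e j k)) (fun i => der i d) p q
  have h3 := sum_sum_raise (G := G) (fun a m => mLow der e a p m) (fun b i => mLow der e b i q)
  have h4 : ∑ i, ∑ m, mUp der e G i p m * mUp der e G m i q =
    ∑ i, ∑ m, (∑ a, G i a * mLow der e a p m) * (∑ b, G m b * mLow der e b i q) := rfl
  have h5 : mArr (fun i j k => der i (e j k)) = mLow der e := rfl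
  rw [L.kEL_eq]
  simp only [Matrix.sub_apply, Finset.sum_sub_distrib]
  rw [a, b, c, c', kInt, h4, h3]
  simp only [hg]
  simp only [h5, ct_add] at h1
  unfold ellG
  linear_combination (norm := skip) h1 + h2
  simp only [mul_comm (der q d) (der p d)]
  module

end LeviCivita

end DoubleField

namespace DoubleField

variable {ι A : Type*} [Fintype ι] [DecidableEq ι] [CommRing A] [Algebra ℝ A]
  {der : ι → Derivation ℝ A A} {g G e : Matrix ι ι A} {lam d φ : A}

/-- `-½` times the variational derivative of the action with respect to `d`, without the density,
for fields independent of the dual coordinates. -/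
def rEL (der : ι → Derivation ℝ A A) (e G : Matrix ι ι A) (d : A) : A :=
  ell G (fun i j k => der i (e j k)) (fun i => der i d) +
    (1 / 2 : ℝ) • ∑ n, der n (ellv G (fun i j k => der i (e j k)) (fun i => der i d) n) -
    ∑ n, der n d * ellv G (fun i j k => der i (e j k)) (fun i => der i d) n

theorem ell_quadratic (hG : ∀ a b, G a b = G b a) (x : ι → ι → ι → A) (g' γ H : ι → ι → ι → A)
    (hg : ∀ i m n, g' i m n = (1 / 2 : ℝ) • (x i m n + x i n m))
    (hγ : ∀ l i j, γ l i j = (1 / 2 : ℝ) • (g' i j l + g' j i l - g' l i j))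
    (hH : ∀ i j k, H i j k = (1 / 2 : ℝ) • (x i j k - x i k j + (x j k i - x j i k) +
      (x k i j - x k j i))) :
    (-1 / 4 : ℝ) • ct G (fun i k => ct G fun j l => ct G fun p r => x r k l * x p i j) +
    (1 / 4 : ℝ) • ct G (fun k l => ct G fun j m => ct G fun i n =>
      x m i k * x n j l + x m k i * x n l j) -
    ct G (fun n c => ct G fun j a => ct G fun b l => g' n a b * γ c j l) +
    ct G (fun j l => ct G fun k a => ct G fun m b => γ a l m * γ b k j) +
    (1 / 12 : ℝ) • ct G (fun i j => ct G fun r t => ct G fun s u => H i r s * H j t u) = 0 := by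
  have h := ct_ct_ct_eq_zero hG (fun a a' b b' c c' =>
    (-1 / 4 : ℝ) • (x c' a' b' * x c a b) +
    (1 / 4 : ℝ) • (x b c a * x c' b' a' + x b a c * x c' a' b') -
    g' a b c * γ a' b' c' + γ b a c * γ c' b' a' + (1 / 12 : ℝ) • (H a b c * H a' b' c'))
    fun a a' b b' c c' => by
      simp only [hγ, hH, hg]
      algebra
  have h1 : ct G (fun k l => ct G fun j m => ct G fun i n =>
      x m i k * x n j l + x m k i * x n l j) = ct G (fun k l => ct G fun m j => ct G fun i n =>
      x m i k * x n j l + x m k i * x n l j) := by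
    congr 1; funext k l; exact ct_swap _ hG
  have h2 : ct G (fun n c => ct G fun j a => ct G fun b l => g' n a b * γ c j l) =
      ct G (fun n c => ct G fun a j => ct G fun b l => g' n a b * γ c j l) := by
    congr 1; funext k l; exact ct_swap _ hG
  have h3 : ct G (fun j l => ct G fun k a => ct G fun m b => γ a l m * γ b k j) =
      ct G (fun l j => ct G fun a k => ct G fun m b => γ a l m * γ b k j) := by
    rw [ct_swap _ hG]
    congr 1; funext k l; exact ct_swap _ hG
  rw [h1, h2, h3]
  simp only [ct_add, ct_sub, ct_smul] at h ⊢
  linear_combination (norm := module) h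

namespace LeviCivita

variable {Γ : ι → ι → ι → A}

theorem der_ct' (L : LeviCivita der g G Γ lam) (n : ι) (T : ι → ι → A) :
    der n (ct G T) = ct G (fun j l => der n (T j l)) -
      ct G (fun j a => ct G fun b l => der n (g a b) * T j l) := by
  simp only [ct, map_sum, Derivation.leibniz, smul_eq_mul, L.der_G', mul_neg,
    Finset.sum_add_distrib, Finset.sum_neg_distrib, sub_eq_add_neg]
  congr 2
  simp only [Finset.mul_sum]
  refine Finset.sum_congr rfl fun j _ => ?_
  rw [Finset.sum_comm]
  refine Finset.sum_congr rfl fun a _ => ?_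
  rw [Finset.sum_comm]
  exact Finset.sum_congr rfl fun _ _ => Finset.sum_congr rfl fun _ _ => by ring

theorem G_mul_apply (L : LeviCivita der g G Γ lam) (i j : ι) :
    ∑ k, G i k * g k j = if i = j then 1 else 0 := by
  have := congrFun (congrFun L.G_mul i) j
  simpa only [Matrix.mul_apply, Matrix.one_apply] using this

theorem sum_G_mul_g (L : LeviCivita der g G Γ lam) (C : ι → A) (n : ι) :
    ∑ i, G n i * ∑ m, g i m * C m = C n := by
  simp only [Finset.mul_sum, ← mul_assoc]
  rw [Finset.sum_comm]
  simp only [← Finset.sum_mul, L.G_mul_apply, ite_mul, one_mul, zero_mul, Finset.sum_ite_eq,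
    Finset.mem_univ, if_true]

/-- `∂^j g_{ij} = g_{im} g^{jl} Γ^m_{jl} + ∂_i λ`. -/
theorem ct_der_g (L : LeviCivita der g G Γ lam) (i : ι) :
    ct G (fun j l => der l (g i j)) = ∑ m, g i m * ct G (fun j l => Γ m j l) + der i lam := by
  have h1 : ct G (fun j l => ∑ m, Γ m l i * g m j) = der i lam := by
    rw [← L.trace, ct]
    have : ∀ j l, G j l * ∑ m, Γ m l i * g m j = ∑ m, Γ m l i * (G l j * g j m) := by
      intro j l
      rw [Finset.mul_sum]
      exact Finset.sum_congr rfl fun m _ => by rw [L.G_symm, L.g_symm j m]; ring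
    simp only [this]
    rw [sum_sum_sum_eq_of_reverse (h := fun m l j => Γ m l i * (G l j * g j m))]
    · simp only [← Finset.mul_sum, L.G_mul_apply, mul_ite, mul_one, mul_zero,
        Finset.sum_ite_eq', Finset.mem_univ, if_true]
      exact Finset.sum_congr rfl fun m _ => L.tors _ _ _
    · intro x y z; rfl
  simp only [L.compat, Finset.sum_add_distrib, ct_add, h1]
  rw [add_comm]
  congr 1
  rw [ct_sum]
  refine Finset.sum_congr rfl fun m _ => ?_
  rw [← ct_mul_left]
  congr 1; funext j l
  rw [L.tors m l j, mul_comm]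

theorem rEL_eq_rForm (L : LeviCivita der (symPart e) G (chr der (symPart e) G) lam)
    (hd : ∀ i, der i d = der i φ - (1 / 2 : ℝ) • der i lam) :
    rEL der e G d = rForm der G (chr der (symPart e) G) (formH der e) φ := by
  set Γ := chr der (symPart e) G with hΓ
  set g := symPart e with hg
  have hg' : ∀ i m n, der i (g m n) = (1 / 2 : ℝ) • (der i (e m n) + der i (e n m)) :=
    fun i m n => by simp [hg, symPart]
  have hq := ell_quadratic L.G_symm (fun i j k => der i (e j k)) (fun i m n => der i (g m n))
    (chrLow der g) (formH der e) hg' (fun _ _ _ => rfl) (fun _ _ _ => rfl)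
  set C : ι → A := fun m => ct G (fun j l => Γ m j l) with hC
  have hW := L.ct_der_g
  have hZ : ∀ i, ct G (fun j l => der l (e i j) + der l (e j i)) =
      (2 : ℝ) • (∑ m, g i m * C m + der i lam) := by
    intro i
    rw [← hW, ← ct_smul]
    congr 1; funext j l
    rw [hg']; module
  have raise := L.sum_G_mul_g C
  have hQ : ∀ n, ellv G (fun i j k => der i (e j k)) (fun i => der i d) n =
      (2 : ℝ) • C n - (2 : ℝ) • ∑ i, G n i * der i lam + (8 : ℝ) • ∑ i, G n i * der i φ := by
    intro n
    rw [← raise n]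
    simp only [Finset.smul_sum, ← Finset.sum_add_distrib, ← Finset.sum_sub_distrib, ellv, hd]
    refine Finset.sum_congr rfl fun i _ => ?_
    rw [hZ]; algebra
  have hC1 : ∑ n, der n (C n) = ct G (fun j l => ∑ n, der n (Γ n j l)) -
      ct G (fun n c => ct G fun j a => ct G fun b l => der n (g a b) * chrLow der g c j l) := by
    simp only [hC, L.der_ct', Finset.sum_sub_distrib, ct_sum]
    congr 1
    simp only [hΓ, chr, Finset.mul_sum, ct_sum, mul_left_comm _ (G _ _), ct_mul_left]
    rfl
  have hlam : ∀ Y : ι → A, ∑ n, der n lam * ∑ i, G n i * Y i = ct G fun n i => der n lam * Y i := by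
    intro Y
    simp only [ct, Finset.mul_sum, mul_left_comm]
  have hvv : ∀ Y : ι → A, ∑ n, der n d * ∑ i, G n i * Y i =
      ct G (fun n i => der n φ * Y i) - (1 / 2 : ℝ) • ct G fun n i => der n lam * Y i := by
    intro Y
    rw [← ct_smul, ← ct_sub]
    simp only [ct, Finset.mul_sum, hd]
    exact Finset.sum_congr rfl fun i _ => Finset.sum_congr rfl fun a _ => by algebra
  have hdiv : ∑ n, der n (ellv G (fun i j k => der i (e j k)) (fun i => der i d) n) =
      (2 : ℝ) • ∑ n, der n (C n) - (2 : ℝ) • ∑ n, der n (∑ i, G n i * der i lam) +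
        (8 : ℝ) • ∑ n, der n (∑ i, G n i * der i φ) := by
    simp only [hQ, map_add, map_sub, Derivation.map_smul, Finset.sum_add_distrib,
      Finset.sum_sub_distrib, ← Finset.smul_sum]
  have hv : ∑ n, der n d * ellv G (fun i j k => der i (e j k)) (fun i => der i d) n =
      (2 : ℝ) • ∑ n, der n d * C n - (2 : ℝ) • (∑ n, der n d * ∑ i, G n i * der i lam) +
        (8 : ℝ) • ∑ n, der n d * ∑ i, G n i * der i φ := by
    simp only [hQ, mul_add, mul_sub, mul_smul_comm, Finset.sum_add_distrib,
      Finset.sum_sub_distrib, ← Finset.smul_sum]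
  have hlin : ct G (fun i k => ct G fun j l => der k d * der l (e i j) + der k d * der l (e j i)) =
      (2 : ℝ) • ∑ n, der n d * C n + (2 : ℝ) • ∑ n, der n d * ∑ i, G n i * der i lam := by
    rw [ct_swap _ L.G_symm]
    simp only [← mul_add, ct_mul_left, hZ]
    rw [← smul_add, ← Finset.sum_add_distrib, ct,
      Finset.smul_sum]
    refine Finset.sum_congr rfl fun n _ => ?_
    rw [← raise n, ← mul_add, ← Finset.sum_add_distrib, Finset.mul_sum, Finset.smul_sum]
    exact Finset.sum_congr rfl fun i _ => by algebra
  have hsq : ct G (fun i j => der i d * der j d) = ct G (fun i j => der i φ * der j φ) -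
      ct G (fun i j => der i lam * der j φ) + (1 / 4 : ℝ) • ct G fun i j => der i lam * der j lam := by
    have h1 : ct G (fun i j => der i lam * der j φ) = ct G (fun i j => der i φ * der j lam) := by
      rw [ct_swap _ L.G_symm]; simp only [mul_comm]
    have h2 : ct G (fun i j => der i d * der j d) = ct G (fun i j => der i φ * der j φ) -
        (1 / 2 : ℝ) • ct G (fun i j => der i lam * der j φ) -
        (1 / 2 : ℝ) • ct G (fun i j => der i φ * der j lam) +
        (1 / 4 : ℝ) • ct G fun i j => der i lam * der j lam := by
      simp only [← ct_smul, ← ct_sub, ← ct_add, hd]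
      congr 1; funext i j; algebra
    rw [h2, ← h1]; module
  have hric : ct G (ric der Γ) = ct G (fun j l => ∑ n, der n (Γ n j l)) -
      ct G (nab1 der Γ fun k => der k lam) -
      ct G (fun j l => ct G fun k a => ct G fun m b => chrLow der g a l m * chrLow der g b k j) := by
    have h : ric der Γ = fun j l => (∑ n, der n (Γ n j l)) - nab1 der Γ (fun k => der k lam) j l -
        ct G fun k a => ct G fun m b => chrLow der g a l m * chrLow der g b k j := by
      funext j l
      rw [L.ric_eq, ← sum_sum_raise, nab1, L.comm l j,
        show ∑ i, ∑ m, (∑ a, G i a * chrLow der g a l m) * ∑ b, G m b * chrLow der g b i j =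
          ∑ k, ∑ m, Γ k l m * Γ m k j from rfl]
      simp only [L.tors _ j l, mul_comm (der _ lam)]
      ring
    rw [h, ct_sub, ct_sub]
  have hH : ct G (sqH G (formH der e)) = ct G (fun i j => ct G fun r t => ct G fun s u =>
    formH der e i r s * formH der e j t u) := rfl
  have hul : ct G (fun i j => der i lam * der j φ) = ct G (fun i j => der i φ * der j lam) := by
    rw [ct_swap _ L.G_symm]; simp only [mul_comm]
  rw [rEL, rForm, ell, hdiv, hv, hlin, hsq, hvv, hvv, hC1, L.sum_der_raise, L.sum_der_raise, hlam,
    hlam, hric, hH, ← hul]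
  linear_combination (norm := module) hq

end LeviCivita

end DoubleField

namespace DoubleField

variable {ι A : Type*} [Fintype ι] [DecidableEq ι] [CommRing A] [Algebra ℝ A]
  {der : ι → Derivation ℝ A A} {g G e : Matrix ι ι A} {lam d φ : A}

/-- The left-hand side of the first Bianchi identity of double field theory, for fields independent
of the dual coordinates. -/
def bianchiLeft (der : ι → Derivation ℝ A A) (e G : Matrix ι ι A) (d : A) (K : ι → ι → A) (R : A)
    (q : ι) : A :=
  ct G (fun p s => der s (K p q) - ∑ k, gUU der e G k s p * K k q -
    ∑ k, mUp der e G k s q * K p k) -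
  (1 / 2 : ℝ) • ct G (fun p s => (ct G (fun r t => der t (e s r)) + (4 : ℝ) • der s d) * K p q) +
  (1 / 2 : ℝ) • der q R

theorem symPart_transpose (e : Matrix ι ι A) : symPart e.transpose = symPart e := by
  ext i j; simp only [symPart, Matrix.of_apply, Matrix.transpose_apply, add_comm]

theorem formH_transpose (e : Matrix ι ι A) (i j k : ι) :
    formH der e.transpose i j k = -formH der e i j k := by
  simp only [formH, Matrix.transpose_apply]; algebra

theorem gUU_transpose (k i j : ι) : gUU der e.transpose G k i j = gBB der e G k i j := rfl

theorem mUp_transpose (k i j : ι) : mUp der e.transpose G k i j = mUp der e G k j i := by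
  simp only [mUp, mLow, Matrix.transpose_apply, add_comm]

theorem sqH_neg (H : ι → ι → ι → A) (p q : ι) :
    sqH G (fun i j k => -H i j k) p q = sqH G H p q := by
  simp only [sqH, neg_mul_neg]

theorem rForm_neg (Γ H : ι → ι → ι → A) :
    rForm der G Γ (fun i j k => -H i j k) φ = rForm der G Γ H φ := by
  have : sqH G (fun i j k => -H i j k) = sqH G H := by ext; exact sqH_neg _ _ _
  simp only [rForm, this]

namespace LeviCivita

variable {Γ : ι → ι → ι → A}

theorem kForm_neg (L : LeviCivita der g G Γ lam) {H : ι → ι → ι → A} (hH : ClosedForm der H)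
    (p q : ι) : kForm der G Γ (fun i j k => -H i j k) φ p q = kForm der G Γ H φ q p := by
  have h1 : divForm der G Γ (fun i j k => -H i j k) p q = divForm der G Γ H q p := by
    unfold divForm
    congr 1; funext s t
    rw [nab3_swap₂₃ hH]
    simp only [nab3, map_neg, mul_neg, Finset.sum_neg_distrib]
    ring
  have h2 : ∀ u, contrForm G (fun i j k => -H i j k) u p q = contrForm G H u q p := by
    intro u
    simp only [contrForm, ← hH.swap₂₃]
  rw [kForm, kForm, h1, h2, sqH_neg, L.ric_symm, L.sqH_symm, L.nab1_symm]

theorem ct_gUU (L : LeviCivita der (symPart e) G (chr der (symPart e) G) lam) (X : ι → A) :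
    ct G (fun p s => ∑ k, gUU der e G k s p * X k) +
      (1 / 2 : ℝ) • ct G (fun p s => ct G (fun r t => der t (e s r)) * X p) =
    ct G (fun p s => ∑ k, chr der (symPart e) G k s p * X k) +
      ct G (fun p s => der s lam * X p) := by
  set Γ := chr der (symPart e) G with hΓ
  have hg' : ∀ i m n, der i (symPart e m n) = (1 / 2 : ℝ) • (der i (e m n) + der i (e n m)) :=
    fun i m n => by simp [symPart]
  have h1 : ct G (fun p s => ∑ k, gUU der e G k s p * X k) =
      (1 / 2 : ℝ) • ct G (fun k l => ct G (fun p s => der s (e p l)) * X k) := by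
    simp only [gUU, sum_raise_mul, smul_mul_assoc, ct_smul]
    rw [ct_comm]
    simp only [ct_mul_right]
  have h2 : ct G (fun p s => ∑ k, Γ k s p * X k) =
      ∑ k, ct G (fun j l => Γ k j l) * X k := by
    simp only [← ct_mul_right, ct_sum, L.tors _ _ _]
  have h3 : (1 / 2 : ℝ) • ct G (fun k l => ct G (fun p s => der s (e p l)) * X k) +
      (1 / 2 : ℝ) • ct G (fun k l => ct G (fun p s => der s (e l p)) * X k) =
      ct G (fun k l => ct G (fun p s => der s (symPart e l p)) * X k) := by
    simp only [hg', ct_smul, ct_add, smul_mul_assoc, add_mul, smul_add]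
    module
  rw [h1, h3, h2]
  simp only [L.ct_der_g, add_mul, ct_add]
  congr 1
  simp only [ct, ← mul_assoc, ← Finset.sum_mul]
  refine Finset.sum_congr rfl fun k _ => ?_
  congr 1
  exact L.sum_G_mul_g (fun m => ct G fun j l => Γ m j l) k

theorem bianchiLeft_kForm (L : LeviCivita der (symPart e) G (chr der (symPart e) G) lam)
    (hd : ∀ i, der i d = der i φ - (1 / 2 : ℝ) • der i lam) (q : ι) :
    bianchiLeft der e G d (kForm der G (chr der (symPart e) G) (formH der e) φ)
      (rForm der G (chr der (symPart e) G) (formH der e) φ) q = 0 := by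
  have hb := L.bianchi_kForm (closedForm_formH (e := e) L.comm) φ q
  set K := kForm der G (chr der (symPart e) G) (formH der e) φ with hK
  have h1 := L.ct_gUU fun k => K k q
  have h2 : ct G (fun p s => ∑ k, hUp der e G k s q * K p k) =
      ct G (fun p s => ct G fun k l => formH der e l s q * K p k) := by
    simp only [hUp, sum_raise_mul]
  simp only [nab2, ct_sub] at hb
  simp only [bianchiLeft, mUp_eq, hd, sub_mul, add_mul, smul_mul_assoc, smul_sub, ct_sub, ct_add,
    ct_smul, Finset.sum_sub_distrib, ← Finset.smul_sum, h2]
  linear_combination (norm := module) hb - h1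

theorem bianchiLeft_transpose (L : LeviCivita der (symPart e) G (chr der (symPart e) G) lam)
    (hd : ∀ i, der i d = der i φ - (1 / 2 : ℝ) • der i lam) (q : ι) :
    bianchiLeft der e.transpose G d
      (fun p q => kForm der G (chr der (symPart e) G) (formH der e) φ q p)
      (rForm der G (chr der (symPart e) G) (formH der e) φ) q = 0 := by
  have L' := L
  rw [← symPart_transpose e] at L'
  have h := L'.bianchiLeft_kForm hd q
  have hH : formH der e.transpose = fun i j k => -formH der e i j k := by
    funext i j k; exact formH_transpose _ _ _ _
  have hK : kForm der G (chr der (symPart e) G) (fun i j k => -formH der e i j k) φ =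
      fun p q => kForm der G (chr der (symPart e) G) (formH der e) φ q p := by
    funext p q; exact L.kForm_neg (closedForm_formH L.comm) p q
  rwa [symPart_transpose, hH, rForm_neg, hK] at h

end LeviCivita

end DoubleField

namespace DoubleField

/-! ### The differential algebra of smooth functions on an open set -/

section DetDer

variable {ι A : Type*} [Fintype ι] [DecidableEq ι] [CommRing A] [Algebra ℝ A]

/-- The homomorphism to the dual numbers given by a derivation. -/
def dualHom (δ : Derivation ℝ A A) : A →+* DualNumber A where
  toFun a := TrivSqZeroExt.inl a + TrivSqZeroExt.inr (δ a)
  map_one' := by simp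
  map_zero' := by simp
  map_add' a b := by ext <;> simp
  map_mul' a b := by ext <;> simp [mul_comm]

/-- Jacobi's formula for the derivative of a determinant. -/
theorem der_det (δ : Derivation ℝ A A) {g G : Matrix ι ι A} (hG : G * g = 1) :
    δ g.det = g.det * (G * derMat δ g).trace := by
  have hG' : g * G = 1 := mul_eq_one_comm.mp hG
  set inl : A →+* DualNumber A := TrivSqZeroExt.inlHom A A
  have h1 : (dualHom δ).mapMatrix g = inl.mapMatrix g *
      (1 + (DualNumber.eps : DualNumber A) • inl.mapMatrix (G * derMat δ g)) := by
    have h2 : (dualHom δ).mapMatrix g = inl.mapMatrix g +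
        (DualNumber.eps : DualNumber A) • inl.mapMatrix (derMat δ g) := by
      ext i j <;> simp [dualHom, inl, derMat_apply]
    rw [h2, mul_add, mul_one, Matrix.mul_smul, ← map_mul, ← mul_assoc, hG', one_mul]
  have h3 := congrArg Matrix.det h1
  rw [Matrix.det_mul, Matrix.det_one_add_smul, ← RingHom.map_det, ← RingHom.map_det, pow_two,
    DualNumber.eps_mul_eps, mul_zero, add_zero] at h3
  have h4 := congrArg TrivSqZeroExt.snd h3
  have h5 : Matrix.trace (inl.mapMatrix (G * derMat δ g)) = inl (G * derMat δ g).trace := by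
    simp only [Matrix.trace, map_sum]; rfl
  rw [h5] at h4
  simpa [dualHom, inl] using h4

end DetDer

variable {D : ℕ} {V : Set (Pt D)}

theorem pd_congr (hV : IsOpen V) {F F' : Pt D → ℝ} (h : ∀ x ∈ V, F x = F' x) (i : Fin D) {x : Pt D}
    (hx : x ∈ V) : pd i F x = pd i F' x := by
  unfold pd
  rw [Filter.EventuallyEq.fderiv_eq]
  filter_upwards [hV.mem_nhds hx] with y hy using h y hy

theorem contDiffOn_pd (hV : IsOpen V) {F : Pt D → ℝ} (hF : ContDiffOn ℝ ∞ F V) (i : Fin D) :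
    ContDiffOn ℝ ∞ (pd i F) V := by
  unfold pd
  exact (hF.fderiv_of_isOpen hV (by simp)).clm_apply contDiffOn_const

theorem pd_comm (hV : IsOpen V) {F : Pt D → ℝ} (hF : ContDiffOn ℝ ∞ F V) (i j : Fin D) {x : Pt D}
    (hx : x ∈ V) : pd i (pd j F) x = pd j (pd i F) x := by
  have hc : ContDiffAt ℝ ∞ F x := hF.contDiffAt (hV.mem_nhds hx)
  have hs := hc.isSymmSndFDerivAt (by
    simp only [minSmoothness_of_isRCLikeNormedField]
    exact WithTop.coe_le_coe.mpr le_top)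
  have hd : DifferentiableAt ℝ (fderiv ℝ F) x :=
    ((hF.fderiv_of_isOpen hV (m := ∞) (by simp)).contDiffAt (hV.mem_nhds hx)).differentiableAt
      (by simp)
  have h : ∀ i j, pd i (pd j F) x = fderiv ℝ (fderiv ℝ F) x (Pi.single i 1) (Pi.single j 1) := by
    intro i j
    unfold pd
    rw [fderiv_clm_apply hd (differentiableAt_const _)]
    simp
  rw [h, h]
  exact hs _ _

/-- The algebra of restrictions to `V` of smooth functions on `V`. -/
def smoothAlg (V : Set (Pt D)) : Subalgebra ℝ (V → ℝ) where
  carrier := {f | ∃ F : Pt D → ℝ, ContDiffOn ℝ ∞ F V ∧ ∀ x : V, F x = f x}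
  mul_mem' := by
    rintro _ _ ⟨F, hF, h⟩ ⟨F', hF', h'⟩
    exact ⟨fun x => F x * F' x, hF.mul hF', fun x => by simp [h, h']⟩
  add_mem' := by
    rintro _ _ ⟨F, hF, h⟩ ⟨F', hF', h'⟩
    exact ⟨fun x => F x + F' x, hF.add hF', fun x => by simp [h, h']⟩
  algebraMap_mem' r := ⟨fun _ => r, contDiffOn_const, fun x => rfl⟩

/-- The class of a smooth function. -/
def smoothMk (F : Pt D → ℝ) (hF : ContDiffOn ℝ ∞ F V) : smoothAlg V := ⟨fun x => F x, F, hF, fun _ => rfl⟩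

/-- Evaluation at a point. -/
def ev (x : V) : smoothAlg V →ₐ[ℝ] ℝ := (Pi.evalAlgHom ℝ _ x).comp (smoothAlg V).val

theorem ev_smoothMk (F : Pt D → ℝ) (hF : ContDiffOn ℝ ∞ F V) (x : V) :
    ev x (smoothMk F hF) = F x := rfl

theorem ev_ext {a b : smoothAlg V} (h : ∀ x, ev x a = ev x b) : a = b :=
  Subtype.ext (funext h)

/-- A representative of an element of `smoothAlg V`. -/
def repr (a : smoothAlg V) : Pt D → ℝ := a.2.choose

theorem contDiffOn_repr (a : smoothAlg V) : ContDiffOn ℝ ∞ (repr a) V := a.2.choose_spec.1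

theorem repr_apply (a : smoothAlg V) (x : V) : repr a x = ev x a := a.2.choose_spec.2 x

theorem differentiableAt_repr (hV : IsOpen V) (a : smoothAlg V) (x : V) :
    DifferentiableAt ℝ (repr a) x :=
  ((contDiffOn_repr a).contDiffAt (hV.mem_nhds x.2)).differentiableAt (by simp)

/-- The partial derivatives, as derivations. -/
def smoothDer (hV : IsOpen V) (i : Fin D) : Derivation ℝ (smoothAlg V) (smoothAlg V) :=
  Derivation.mk'
    { toFun := fun a => smoothMk (pd i (repr a)) (contDiffOn_pd hV (contDiffOn_repr a) i)
      map_add' := fun a b => ev_ext fun x => by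
        rw [map_add, ev_smoothMk, ev_smoothMk, ev_smoothMk,
          pd_congr hV (F' := fun y => repr a y + repr b y)
            (fun y hy => by simp only [repr_apply _ ⟨y, hy⟩, map_add]) i x.2]
        unfold pd
        rw [fderiv_fun_add (differentiableAt_repr hV a x) (differentiableAt_repr hV b x)]
        rfl
      map_smul' := fun r a => ev_ext fun x => by
        rw [map_smul, ev_smoothMk, ev_smoothMk,
          pd_congr hV (F' := fun y => r • repr a y)
            (fun y hy => by simp only [repr_apply _ ⟨y, hy⟩, map_smul]) i x.2]
        unfold pd
        rw [fderiv_fun_const_smul (differentiableAt_repr hV a x)]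
        rfl }
    fun a b => ev_ext fun x => by
      simp only [LinearMap.coe_mk, AddHom.coe_mk, smul_eq_mul, map_add, map_mul, ev_smoothMk]
      rw [pd_congr hV (F' := fun y => repr a y * repr b y)
            (fun y hy => by simp only [repr_apply _ ⟨y, hy⟩, map_mul]) i x.2]
      unfold pd
      rw [fderiv_fun_mul (differentiableAt_repr hV a x) (differentiableAt_repr hV b x)]
      simp [repr_apply]

theorem pd_eq_ev (hV : IsOpen V) {F : Pt D → ℝ} {a : smoothAlg V} (h : ∀ x : V, F x = ev x a)
    (i : Fin D) (x : V) : pd i F x = ev x (smoothDer hV i a) :=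
  pd_congr hV (fun y hy => (h ⟨y, hy⟩).trans (repr_apply a ⟨y, hy⟩).symm) i x.2

theorem smoothDer_comm (hV : IsOpen V) (i j : Fin D) (a : smoothAlg V) :
    smoothDer hV i (smoothDer hV j a) = smoothDer hV j (smoothDer hV i a) := by
  refine ev_ext fun x => ?_
  have h := pd_comm hV (contDiffOn_repr a) i j x.2
  have h1 : ∀ j, ∀ x : V, pd j (repr a) x = ev x (smoothDer hV j a) :=
    pd_eq_ev hV (repr_apply a)
  rwa [pd_eq_ev hV (h1 j), pd_eq_ev hV (h1 i)] at h

theorem isUnit_of_ev_ne_zero {a : smoothAlg V} (h : ∀ x, ev x a ≠ 0) : IsUnit a := by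
  refine IsUnit.of_mul_eq_one (smoothMk (fun x => (repr a x)⁻¹) ((contDiffOn_repr a).inv fun x hx => ?_))
    (ev_ext fun x => ?_)
  · rw [repr_apply a ⟨x, hx⟩]; exact h _
  · rw [map_mul, ev_smoothMk, repr_apply, mul_inv_cancel₀ (h x), map_one]

theorem ev_nonsing_inv {g : Matrix (Fin D) (Fin D) (smoothAlg V)} (hg : IsUnit g.det) (x : V)
    (i j : Fin D) : ev x (g⁻¹ i j) = (g.map (ev x))⁻¹ i j := by
  have h : g⁻¹.map (ev x) * g.map (ev x) = 1 := by
    rw [← Matrix.map_mul, Matrix.nonsing_inv_mul _ hg]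
    ext i j
    by_cases h : i = j <;> simp [Matrix.one_apply, h]
  rw [Matrix.inv_eq_left_inv h]
  rfl

/-- The logarithmic volume density of a metric. -/
theorem exists_log_density (hV : IsOpen V) {g : Matrix (Fin D) (Fin D) (smoothAlg V)}
    (hg : ∀ x, ev x g.det ≠ 0) :
    ∃ lam : smoothAlg V, (∀ x, ev x lam = (1 / 2) * Real.log |ev x g.det|) ∧
      ∀ i, smoothDer hV i lam = (1 / 2 : ℝ) • (g⁻¹ * derMat (smoothDer hV i) g).trace := by
  have hne : ∀ x ∈ V, repr g.det x ≠ 0 := fun x hx => by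
    rw [repr_apply _ ⟨x, hx⟩]; exact hg _
  refine ⟨smoothMk (fun x => (1 / 2) * Real.log (repr g.det x))
    (contDiffOn_const.mul ((contDiffOn_repr g.det).log hne)), fun x => ?_, fun i => ?_⟩
  · rw [ev_smoothMk, repr_apply, Real.log_abs]
  · refine ev_ext fun x => ?_
    have hu : IsUnit g.det := isUnit_of_ev_ne_zero hg
    rw [← pd_eq_ev hV (F := fun x => (1 / 2) * Real.log (repr g.det x)) (fun _ => rfl)]
    have h1 : pd i (repr g.det) x = ev x (smoothDer hV i g.det) := pd_eq_ev hV (repr_apply _) i x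
    rw [der_det _ (Matrix.nonsing_inv_mul _ hu), map_mul] at h1
    have hd := (differentiableAt_repr hV g.det x)
    unfold pd at h1 ⊢
    rw [fderiv_const_mul (hd.log (hne x x.2)), fderiv.log hd (hne x x.2)]
    simp only [_root_.smul_apply, smul_eq_mul, h1, repr_apply, map_smul]
    rw [inv_mul_cancel_left₀ (hg x)]

end DoubleField

namespace DoubleField

/-! ### Tensor calculus in terms of the algebra of smooth functions -/

section Real

variable {ι A : Type*} [Fintype ι] [CommRing A] (G : Matrix ι ι A)

theorem ct_ct_eq_sum (F : ι → ι → ι → ι → A) :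
    ct G (fun a c => ct G fun b d => F a b c d) =
      ∑ a, ∑ b, ∑ c, ∑ d, G a c * G b d * F a b c d := by
  simp only [ct, Finset.mul_sum, mul_assoc]
  exact Finset.sum_congr rfl fun a _ => Finset.sum_comm

theorem ct_ct_eq_sum' (F : ι → ι → ι → ι → A) :
    ct G (fun a b => ct G fun c d => F a b c d) =
      ∑ a, ∑ b, ∑ c, ∑ d, G a b * G c d * F a b c d := by
  simp only [ct, Finset.mul_sum, mul_assoc]

end Real

variable {D : ℕ} {V : Set (Pt D)}

theorem ev_ct (x : V) (G : Matrix (Fin D) (Fin D) (smoothAlg V))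
    (F : Fin D → Fin D → smoothAlg V) :
    ev x (ct G F) = ct (G.map (ev x)) fun a b => ev x (F a b) := by
  simp only [ct, map_sum, map_mul, Matrix.map_apply]

/-- The fields `g`, `b`, `φ` on `V` are those given by `e = g + b` and `f`, and `G` is the inverse
metric. -/
structure Realizes (hV : IsOpen V) (g b : Pt D → Mat D) (φ : Pt D → ℝ)
    (e G : Matrix (Fin D) (Fin D) (smoothAlg V)) (f : smoothAlg V) : Prop where
  metric : ∀ (x : V) i j, g x i j = ev x (symPart e i j)
  inv : ∀ x : V, (g x)⁻¹ = G.map (ev x)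
  form : ∀ (x : V) i j k, fieldStrength b ![i, j, k] x = ev x (formH (smoothDer hV) e i j k)
  dil : ∀ x : V, φ x = ev x f

namespace Realizes

variable {hV : IsOpen V} {g b : Pt D → Mat D} {φ : Pt D → ℝ}
  {e G : Matrix (Fin D) (Fin D) (smoothAlg V)} {f : smoothAlg V}

theorem inv_apply (h : Realizes hV g b φ e G f) (x : V) (i j : Fin D) :
    (g x)⁻¹ i j = ev x (G i j) := by rw [h.inv]; rfl

theorem christoffel (h : Realizes hV g b φ e G f) (x : V) (k i j : Fin D) :
    christoffel g k i j x = ev x (chr (smoothDer hV) (symPart e) G k i j) := by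
  have hp : ∀ i j l, pd i (fun y => g y j l) x = ev x (smoothDer hV i (symPart e j l)) :=
    fun i j l => pd_eq_ev hV (F := fun y => g y j l) (fun x => h.metric x j l) i x
  simp only [DoubleField.christoffel, chr, chrLow, h.inv_apply, hp, map_sum, map_mul, map_smul, map_add, map_sub,
    Finset.mul_sum, smul_eq_mul]
  exact Finset.sum_congr rfl fun _ _ => by ring

theorem cov₁ (h : Realizes hV g b φ e G f) {T : TensorField D 1} {T' : Fin D → smoothAlg V}
    (hT : ∀ (x : V) j, T ![j] x = ev x (T' j)) (x : V) (i j : Fin D) :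
    cov g T ![i, j] x = ev x (nab1 (smoothDer hV) (chr (smoothDer hV) (symPart e) G) T' i j) := by
  have e0 : ∀ k, Function.update ![j] 0 k = ![k] := fun k => by ext a; fin_cases a; rfl
  change pd i (T ![j]) x - ∑ a, ∑ k, DoubleField.christoffel g k i (![j] a) x *
    T (Function.update ![j] a k) x = _
  simp only [Fin.sum_univ_one, e0, nab1, pd_eq_ev hV (fun x => hT x _), h.christoffel, hT, map_sub,
    map_sum, map_mul]
  rfl

theorem cov₂ (h : Realizes hV g b φ e G f) {T : TensorField D 2}
    {T' : Fin D → Fin D → smoothAlg V}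
    (hT : ∀ (x : V) j k, T ![j, k] x = ev x (T' j k)) (x : V) (i j k : Fin D) :
    cov g T ![i, j, k] x =
      ev x (nab2 (smoothDer hV) (chr (smoothDer hV) (symPart e) G) T' i j k) := by
  have e0 : ∀ m, Function.update ![j, k] 0 m = ![m, k] := fun k => by ext a; fin_cases a <;> rfl
  have e1 : ∀ m, Function.update ![j, k] 1 m = ![j, m] := fun k => by ext a; fin_cases a <;> rfl
  change pd i (T ![j, k]) x - ∑ a, ∑ m, DoubleField.christoffel g m i (![j, k] a) x *
    T (Function.update ![j, k] a m) x = _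
  simp only [Fin.sum_univ_two, e0, e1, nab2, pd_eq_ev hV (fun x => hT x _ _), h.christoffel, hT,
    map_sub, map_sum, map_mul, ← sub_sub]
  rfl

theorem cov₃ (h : Realizes hV g b φ e G f) {T : TensorField D 3}
    {T' : Fin D → Fin D → Fin D → smoothAlg V}
    (hT : ∀ (x : V) j k l, T ![j, k, l] x = ev x (T' j k l)) (x : V) (i j k l : Fin D) :
    cov g T ![i, j, k, l] x =
      ev x (nab3 (smoothDer hV) (chr (smoothDer hV) (symPart e) G) T' i j k l) := by
  have e0 : ∀ m, Function.update ![j, k, l] 0 m = ![m, k, l] :=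
    fun k => by ext a; fin_cases a <;> rfl
  have e1 : ∀ m, Function.update ![j, k, l] 1 m = ![j, m, l] :=
    fun k => by ext a; fin_cases a <;> rfl
  have e2 : ∀ m, Function.update ![j, k, l] 2 m = ![j, k, m] :=
    fun k => by ext a; fin_cases a <;> rfl
  change pd i (T ![j, k, l]) x - ∑ a, ∑ m, DoubleField.christoffel g m i (![j, k, l] a) x *
    T (Function.update ![j, k, l] a m) x = _
  simp only [Fin.sum_univ_three, e0, e1, e2, nab3, pd_eq_ev hV (fun x => hT x _ _ _),
    h.christoffel, hT, map_sub, map_sum, map_mul, ← sub_sub]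
  rfl

theorem cov₄ (h : Realizes hV g b φ e G f) {T : TensorField D 4}
    {T' : Fin D → Fin D → Fin D → Fin D → smoothAlg V}
    (hT : ∀ (x : V) j k l n, T ![j, k, l, n] x = ev x (T' j k l n)) (x : V) (i j k l n : Fin D) :
    cov g T ![i, j, k, l, n] x =
      ev x (nab4 (smoothDer hV) (chr (smoothDer hV) (symPart e) G) T' i j k l n) := by
  have e0 : ∀ m, Function.update ![j, k, l, n] 0 m = ![m, k, l, n] :=
    fun k => by ext a; fin_cases a <;> rfl
  have e1 : ∀ m, Function.update ![j, k, l, n] 1 m = ![j, m, l, n] :=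
    fun k => by ext a; fin_cases a <;> rfl
  have e2 : ∀ m, Function.update ![j, k, l, n] 2 m = ![j, k, m, n] :=
    fun k => by ext a; fin_cases a <;> rfl
  have e3 : ∀ m, Function.update ![j, k, l, n] 3 m = ![j, k, l, m] :=
    fun k => by ext a; fin_cases a <;> rfl
  change pd i (T ![j, k, l, n]) x - ∑ a, ∑ m, DoubleField.christoffel g m i (![j, k, l, n] a) x *
    T (Function.update ![j, k, l, n] a m) x = _
  simp only [Fin.sum_univ_four, e0, e1, e2, e3, nab4, pd_eq_ev hV (fun x => hT x _ _ _ _),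
    h.christoffel, hT, map_sub, map_sum, map_mul, ← sub_sub]
  rfl

theorem ricci (h : Realizes hV g b φ e G f) (x : V) (i j : Fin D) :
    ricci g ![i, j] x = ev x (ric (smoothDer hV) (chr (smoothDer hV) (symPart e) G) i j) := by
  change ∑ k, riemann g k i k j x = _
  simp only [riemann, ric, riem, pd_eq_ev hV (fun x => h.christoffel x _ _ _), h.christoffel,
    map_add, map_sub, map_sum, map_mul]

theorem scalarCurv (h : Realizes hV g b φ e G f) (x : V) :
    scalarCurv g x = ev x (ct G (ric (smoothDer hV) (chr (smoothDer hV) (symPart e) G))) := by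
  simp only [DoubleField.scalarCurv, ev_ct, h.inv, h.ricci]; rfl

theorem grad (h : Realizes hV g b φ e G f) (x : V) (i : Fin D) :
    pd i φ x = ev x (smoothDer hV i f) := pd_eq_ev hV h.dil i x

theorem hess (h : Realizes hV g b φ e G f) (x : V) (i j : Fin D) :
    hess g φ ![i, j] x = ev x (nab1 (smoothDer hV) (chr (smoothDer hV) (symPart e) G)
      (fun k => smoothDer hV k f) i j) :=
  h.cov₁ (fun x j => h.grad x j) x i j

theorem laplace (h : Realizes hV g b φ e G f) (x : V) :
    laplace g φ x = ev x (ct G (nab1 (smoothDer hV) (chr (smoothDer hV) (symPart e) G)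
      fun k => smoothDer hV k f)) := by
  simp only [DoubleField.laplace, ev_ct, h.inv, h.hess]; rfl

theorem gradSq (h : Realizes hV g b φ e G f) (x : V) :
    gradSq g φ x = ev x (ct G fun i j => smoothDer hV i f * smoothDer hV j f) := by
  simp only [DoubleField.gradSq, ev_ct, h.inv, h.grad, mul_assoc, map_mul]; rfl

theorem hSq (h : Realizes hV g b φ e G f) (x : V) (i j : Fin D) :
    hSq g b i j x = ev x (sqH G (formH (smoothDer hV) e) i j) := by
  simp only [sqH, ev_ct, map_mul]
  simp only [DoubleField.hSq, h.inv, h.form, mul_assoc, ct_ct_eq_sum]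

theorem hNorm (h : Realizes hV g b φ e G f) (x : V) :
    hNorm g b x = ev x (ct G (sqH G (formH (smoothDer hV) e))) := by
  simp only [DoubleField.hNorm, ev_ct, h.inv, h.hSq]; rfl

theorem divH (h : Realizes hV g b φ e G f) (x : V) (p q : Fin D) :
    divH g b p q x = ev x (divForm (smoothDer hV) G (chr (smoothDer hV) (symPart e) G)
      (formH (smoothDer hV) e) p q) := by
  simp only [DoubleField.divH, divForm, ev_ct, h.inv, h.cov₃ h.form]; rfl

theorem hGrad (h : Realizes hV g b φ e G f) (x : V) (p q : Fin D) :
    hGrad g b φ p q x =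
      ev x (contrForm G (formH (smoothDer hV) e) (fun k => smoothDer hV k f) p q) := by
  simp only [DoubleField.hGrad, contrForm, ev_ct, h.inv, h.form, h.grad, mul_assoc, map_mul]; rfl

theorem divDivH (h : Realizes hV g b φ e G f) (x : V) (q : Fin D) :
    divDivH g b q x = ev x (ct G fun p a => ct G fun s c => nab4 (smoothDer hV)
      (chr (smoothDer hV) (symPart e) G) (nab3 (smoothDer hV) (chr (smoothDer hV) (symPart e) G)
        (formH (smoothDer hV) e)) a c s p q) := by
  simp only [ev_ct]
  simp only [DoubleField.divDivH, h.inv, h.cov₄ (h.cov₃ h.form), ct_ct_eq_sum']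

theorem divDivH' (h : Realizes hV g b φ e G f) (x : V) (p : Fin D) :
    divDivH' g b p x = ev x (ct G fun q a => ct G fun s c => nab4 (smoothDer hV)
      (chr (smoothDer hV) (symPart e) G) (nab3 (smoothDer hV) (chr (smoothDer hV) (symPart e) G)
        (formH (smoothDer hV) e)) a c s p q) := by
  simp only [ev_ct]
  simp only [DoubleField.divDivH', h.inv, h.cov₄ (h.cov₃ h.form), ct_ct_eq_sum']

theorem hCovH (h : Realizes hV g b φ e G f) (x : V) (q : Fin D) :
    hCovH g b q x = ev x (ct G fun p a => ct G fun r c => ct G fun s u =>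
      formH (smoothDer hV) e p c u * nab3 (smoothDer hV) (chr (smoothDer hV) (symPart e) G)
        (formH (smoothDer hV) e) a q r s) := by
  simp only [ev_ct, map_mul]
  simp only [DoubleField.hCovH, h.inv, h.cov₃ h.form, h.form, ct, Finset.mul_sum,
    mul_assoc]

theorem divRicci (h : Realizes hV g b φ e G f) (x : V) (q : Fin D) :
    divRicci g q x = ev x (ct G fun p a => nab2 (smoothDer hV) (chr (smoothDer hV) (symPart e) G)
      (ric (smoothDer hV) (chr (smoothDer hV) (symPart e) G)) a p q) := by
  simp only [DoubleField.divRicci, ev_ct, h.inv, h.cov₂ h.ricci]; rfl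

end Realizes

end DoubleField

namespace DoubleField

variable {D : ℕ} {V : Set (Pt D)}

theorem sum_chr_eq_trace {ι A : Type*} [Fintype ι] [DecidableEq ι] [CommRing A] [Algebra ℝ A]
    {der : ι → Derivation ℝ A A} {g G : Matrix ι ι A} (hg : ∀ i j, g i j = g j i)
    (hG : ∀ i j, G i j = G j i) (i : ι) :
    ∑ k, chr der g G k i k = (1 / 2 : ℝ) • (G * derMat (der i) g).trace := by
  have h := ct_eq_zero_of_swap (G := G) (F := fun k l => chrLow der g l i k -
    (1 / 2 : ℝ) • der i (g l k)) hG fun a b => by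
      simp only [chrLow, hg b a]; algebra
  rw [ct_sub, ct_smul, sub_eq_zero] at h
  simp only [Matrix.trace, Matrix.diag, Matrix.mul_apply, derMat_apply]
  exact h

theorem exists_realizes (hV : IsOpen V) {g b : Pt D → Mat D} {φ : Pt D → ℝ}
    (hg : ∀ i j, ContDiffOn ℝ ∞ (fun x => g x i j) V)
    (hb : ∀ i j, ContDiffOn ℝ ∞ (fun x => b x i j) V) (hφ : ContDiffOn ℝ ∞ φ V)
    (hg_symm : ∀ x ∈ V, (g x).transpose = g x) (hg_det : ∀ x ∈ V, (g x).det ≠ 0)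
    (hb_anti : ∀ x ∈ V, (b x).transpose = -b x) :
    ∃ (e G : Matrix (Fin D) (Fin D) (smoothAlg V)) (f lam : smoothAlg V),
      Realizes hV g b φ e G f ∧ (∀ (x : V) i j, g x i j + b x i j = ev x (e i j)) ∧
      LeviCivita (smoothDer hV) (symPart e) G (chr (smoothDer hV) (symPart e) G) lam ∧
      ∀ x : V, (1 / 2) * Real.log |(g x).det| = ev x lam := by
  set e : Matrix (Fin D) (Fin D) (smoothAlg V) := Matrix.of fun i j =>
    smoothMk (fun x => g x i j + b x i j) ((hg i j).add (hb i j)) with he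
  have hs : ∀ (x : V) i j, g x j i = g x i j := fun x i j =>
    congrFun (congrFun (hg_symm x x.2) i) j
  have ha : ∀ (x : V) i j, b x j i = -b x i j := fun x i j =>
    congrFun (congrFun (hb_anti x x.2) i) j
  have he' : ∀ (x : V) i j, g x i j + b x i j = ev x (e i j) := fun x i j => rfl
  have hmet : ∀ (x : V) i j, g x i j = ev x (symPart e i j) := fun x i j => by
    simp only [symPart, Matrix.of_apply, map_smul, map_add, ← he', hs x i j, ha x i j, smul_eq_mul]
    ring
  have hmap : ∀ x : V, g x = (symPart e).map (ev x) := fun x => by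
    ext i j; exact hmet x i j
  have hdet : ∀ x : V, ev x (symPart e).det = (g x).det := fun x => by
    rw [AlgHom.map_det, hmap]; rfl
  have hne : ∀ x : V, ev x (symPart e).det ≠ 0 := fun x => by rw [hdet]; exact hg_det x x.2
  have hu : IsUnit (symPart e).det := isUnit_of_ev_ne_zero hne
  have hsy : (symPart e).transpose = symPart e := by
    ext1 i j; exact ev_ext fun x => by
      simp only [Matrix.transpose_apply, ← hmet, hs x i j]
  have hGs : ∀ i j, (symPart e)⁻¹ i j = (symPart e)⁻¹ j i := fun i j => by
    conv_lhs => rw [← hsy, ← Matrix.transpose_nonsing_inv]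
    rfl
  have hgs : ∀ i j, symPart e i j = symPart e j i := fun i j => congrFun (congrFun hsy j) i
  obtain ⟨lam, hl, hl'⟩ := exists_log_density hV hne
  refine ⟨e, (symPart e)⁻¹, smoothMk φ hφ, lam, ⟨hmet, fun x => ?_, fun x i j k => ?_,
    fun x => rfl⟩, he', ?_, fun x => by rw [hl, hdet]⟩
  · ext i j
    rw [Matrix.map_apply, ev_nonsing_inv hu, ← hmap]
  · have hp : ∀ i j k, pd i (fun y => b y j k) x =
        ev x (smoothDer hV i ((1 / 2 : ℝ) • (e j k - e k j))) := fun i j k =>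
      pd_eq_ev hV (F := fun y => b y j k) (fun x => by
        simp only [map_smul, map_sub, ← he', hs x j k, ha x j k, smul_eq_mul]; ring) i x
    change pd i (fun y => b y j k) x + pd j (fun y => b y k i) x + pd k (fun y => b y i j) x = _
    rw [hp, hp, hp]
    simp only [formH, Derivation.map_smul, map_smul, map_sub, map_add, smul_eq_mul]
    ring
  · exact leviCivita_chr (smoothDer_comm hV) hgs hGs (Matrix.nonsing_inv_mul _ hu) fun i => by
      rw [sum_chr_eq_trace hgs hGs, hl']

end DoubleField

namespace DoubleField

open Side

variable {D : ℕ} {V : Set (Pt D)}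

/-! ### Double field theory for fields independent of the dual coordinates -/

theorem dx_eq_ev (hV : IsOpen V) {F : DPt D → ℝ} {a : smoothAlg V}
    (h : ∀ (x : V) x', F (x, x') = ev x a) (i : Fin D) (x : V) (x' : Pt D) :
    dx i F (x, x') = ev x (smoothDer hV i a) := by
  have h1 : F =ᶠ[nhds ((x, x') : DPt D)] repr a ∘ Prod.fst := by
    filter_upwards [(hV.preimage continuous_fst).mem_nhds (x := ((x, x') : DPt D)) x.2] with Y hY
    exact (h ⟨Y.1, hY⟩ Y.2).trans (repr_apply a ⟨Y.1, hY⟩).symm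
  rw [dx, h1.fderiv_eq, fderiv_comp ((x, x') : DPt D) (differentiableAt_repr hV a x) differentiableAt_fst,
    fderiv_fst, ← pd_eq_ev hV (repr_apply a)]
  rfl

theorem dxt_eq_zero {F : DPt D → ℝ} {u : V → ℝ} (h : ∀ (x : V) x', F (x, x') = u x)
    (i : Fin D) (x : V) (x' : Pt D) : dxt i F (x, x') = 0 := by
  unfold dxt
  by_cases hd : DifferentiableAt ℝ F (x, x')
  · rw [← hd.lineDeriv_eq_fderiv, lineDeriv]
    simp [h]
  · rw [fderiv_zero_of_not_differentiableAt hd]; rfl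

theorem calD_eq_ev (hV : IsOpen V) (E : DPt D → Mat D) (s : Side) {F : DPt D → ℝ} {a : smoothAlg V}
    (h : ∀ (x : V) x', F (x, x') = ev x a) (i : Fin D) (x : V) (x' : Pt D) :
    calD E s i F (x, x') = ev x (smoothDer hV i a) := by
  cases s <;> simp [calD, dxt_eq_zero h, dx_eq_ev hV h]

/-- The fields `E`, `d` on `V × ℝ^D` are independent of the dual coordinates and given by `e`, `d'`,
and `G` is the inverse metric. -/
structure Reduces (hV : IsOpen V) (E : DPt D → Mat D) (d : DPt D → ℝ)
    (e G : Matrix (Fin D) (Fin D) (smoothAlg V)) (d' : smoothAlg V) : Prop where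
  field : ∀ (x : V) x' i j, E (x, x') i j = ev x (e i j)
  dil : ∀ (x : V) x', d (x, x') = ev x d'
  inv : ∀ (x : V) x', (metric (E (x, x')))⁻¹ = G.map (ev x)

namespace Reduces

variable {hV : IsOpen V} {E : DPt D → Mat D} {d : DPt D → ℝ}
  {e G : Matrix (Fin D) (Fin D) (smoothAlg V)} {d' : smoothAlg V}

theorem metric (h : Reduces hV E d e G d') (x : V) (x' : Pt D) (i j : Fin D) :
    metric (E (x, x')) i j = ev x (symPart e i j) := by
  simp [DoubleField.metric, symPart, h.field, mul_add]

theorem calDE (h : Reduces hV E d e G d') (s : Side) (x : V) (x' : Pt D) (i j k : Fin D) :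
    calDE E s i j k (x, x') = ev x (smoothDer hV i (e j k)) :=
  calD_eq_ev hV E s (F := fun Y => E Y j k) (fun x x' => h.field x x' j k) i x x'

theorem gam_un_un (h : Reduces hV E d e G d') (x : V) (x' : Pt D) (k i j : Fin D) :
    gam E un un k i j (x, x') = ev x (gUU (smoothDer hV) e G k i j) := by
  simp only [gam, gUU, h.inv, h.calDE, map_sum, map_mul, map_smul, Finset.mul_sum, smul_eq_mul,
    Matrix.map_apply]
  exact Finset.sum_congr rfl fun _ _ => by ring

theorem gam_bar_bar (h : Reduces hV E d e G d') (x : V) (x' : Pt D) (k i j : Fin D) :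
    gam E bar bar k i j (x, x') = ev x (gBB (smoothDer hV) e G k i j) := by
  simp only [gam, gBB, h.inv, h.calDE, map_sum, map_mul, map_smul, Finset.mul_sum, smul_eq_mul,
    Matrix.map_apply]
  exact Finset.sum_congr rfl fun _ _ => by ring

theorem gam_un_bar (h : Reduces hV E d e G d') (x : V) (x' : Pt D) (k i j : Fin D) :
    gam E un bar k i j (x, x') = ev x (mUp (smoothDer hV) e G k i j) := by
  simp only [gam, mUp, mLow, h.inv, h.calDE, map_sum, map_mul, map_smul, map_add, map_sub,
    Finset.mul_sum, smul_eq_mul, Matrix.map_apply]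
  exact Finset.sum_congr rfl fun _ _ => by ring

theorem gam_bar_un (h : Reduces hV E d e G d') (x : V) (x' : Pt D) (k i j : Fin D) :
    gam E bar un k i j (x, x') = ev x (mUp (smoothDer hV) e G k j i) := by
  simp only [gam, mUp, mLow, h.inv, h.calDE, map_sum, map_mul, map_smul, map_add, map_sub,
    Finset.mul_sum, smul_eq_mul, Matrix.map_apply]
  exact Finset.sum_congr rfl fun _ _ => by ring

theorem calCov₁ (E : DPt D → Mat D) (s : Side) (κ : Fin 1 → Side)
    (T : (Fin 1 → Fin D) → DPt D → ℝ) (i j : Fin D) (X : DPt D) :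
    calCov E s κ T i ![j] X = calD E s i (T ![j]) X - ∑ k, gam E s (κ 0) k i j X * T ![k] X := by
  have e0 : ∀ k, Function.update ![j] 0 k = ![k] := fun k => by ext a; fin_cases a; rfl
  simp only [calCov, Fin.sum_univ_one, e0]
  rfl

theorem calCov₂ (E : DPt D → Mat D) (s : Side) (κ : Fin 2 → Side)
    (T : (Fin 2 → Fin D) → DPt D → ℝ) (i j k : Fin D) (X : DPt D) :
    calCov E s κ T i ![j, k] X = calD E s i (T ![j, k]) X -
      ∑ m, gam E s (κ 0) m i j X * T ![m, k] X - ∑ m, gam E s (κ 1) m i k X * T ![j, m] X := by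
  have e0 : ∀ m, Function.update ![j, k] 0 m = ![m, k] := fun k => by ext a; fin_cases a <;> rfl
  have e1 : ∀ m, Function.update ![j, k] 1 m = ![j, m] := fun k => by ext a; fin_cases a <;> rfl
  simp only [calCov, Fin.sum_univ_two, e0, e1, ← sub_sub]
  rfl

theorem calCov₃ (E : DPt D → Mat D) (s : Side) (κ : Fin 3 → Side)
    (T : (Fin 3 → Fin D) → DPt D → ℝ) (i j k l : Fin D) (X : DPt D) :
    calCov E s κ T i ![j, k, l] X = calD E s i (T ![j, k, l]) X -
      ∑ m, gam E s (κ 0) m i j X * T ![m, k, l] X - ∑ m, gam E s (κ 1) m i k X * T ![j, m, l] X -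
      ∑ m, gam E s (κ 2) m i l X * T ![j, k, m] X := by
  have e0 : ∀ m, Function.update ![j, k, l] 0 m = ![m, k, l] :=
    fun k => by ext a; fin_cases a <;> rfl
  have e1 : ∀ m, Function.update ![j, k, l] 1 m = ![j, m, l] :=
    fun k => by ext a; fin_cases a <;> rfl
  have e2 : ∀ m, Function.update ![j, k, l] 2 m = ![j, k, m] :=
    fun k => by ext a; fin_cases a <;> rfl
  simp only [calCov, Fin.sum_univ_three, e0, e1, e2, ← sub_sub]
  rfl

theorem covDE_un (h : Reduces hV E d e G d') (x : V) (x' : Pt D) (t i j k : Fin D) :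
    covDE E un t i j k (x, x') = ev x (covU (smoothDer hV) e G t i j k) := by
  rw [covDE, calCov₃, calD_eq_ev hV E un (fun x x' => h.calDE un x x' _ _ _)]
  change _ - ∑ m, gam E un un m t i _ * DoubleField.calDE E un m j k _ -
    ∑ m, gam E un un m t j _ * DoubleField.calDE E un i m k _ -
    ∑ m, gam E un bar m t k _ * DoubleField.calDE E un i j m _ = _
  simp only [h.gam_un_un, h.gam_un_bar, h.calDE, covU, map_sub, map_sum, map_mul]
  rfl

theorem covDE_bar (h : Reduces hV E d e G d') (x : V) (x' : Pt D) (t i j k : Fin D) :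
    covDE E bar t i j k (x, x') = ev x (covB (smoothDer hV) e G t i j k) := by
  rw [covDE, calCov₃, calD_eq_ev hV E bar (fun x x' => h.calDE bar x x' _ _ _)]
  change _ - ∑ m, gam E bar bar m t i _ * DoubleField.calDE E bar m j k _ -
    ∑ m, gam E bar un m t j _ * DoubleField.calDE E bar i m k _ -
    ∑ m, gam E bar bar m t k _ * DoubleField.calDE E bar i j m _ = _
  simp only [h.gam_bar_bar, h.gam_bar_un, h.calDE, covB, map_sub, map_sum, map_mul]
  rfl

theorem calD_dil (h : Reduces hV E d e G d') (s : Side) (x : V) (x' : Pt D) (i : Fin D) :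
    calD E s i d (x, x') = ev x (smoothDer hV i d') :=
  calD_eq_ev hV E s h.dil i x x'

theorem covariantK (h : Reduces hV E d e G d') (x : V) (x' : Pt D) (p q : Fin D) :
    covariantK E d p q (x, x') = ev x (covK (smoothDer hV) e G d' p q) := by
  have h1 : calCov E bar ![un] (fun J => calD E un (J 0) d) q ![p] (x, x') =
      ev x (smoothDer hV q (smoothDer hV p d') -
        ∑ k, mUp (smoothDer hV) e G k p q * smoothDer hV k d') := by
    rw [calCov₁, calD_eq_ev hV E bar (fun x x' => h.calD_dil un x x' _)]
    change _ - ∑ k, gam E bar un k q p _ * calD E un k d _ = _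
    simp only [h.gam_bar_un, h.calD_dil, map_sub, map_sum, map_mul]
    rfl
  have h2 : calCov E un ![bar] (fun J => calD E bar (J 0) d) p ![q] (x, x') =
      ev x (smoothDer hV p (smoothDer hV q d') -
        ∑ k, mUp (smoothDer hV) e G k p q * smoothDer hV k d') := by
    rw [calCov₁, calD_eq_ev hV E un (fun x x' => h.calD_dil bar x x' _)]
    change _ - ∑ k, gam E un bar k p q _ * calD E bar k d _ = _
    simp only [h.gam_un_bar, h.calD_dil, map_sub, map_sum, map_mul]
    rfl
  simp only [covK, map_sub, map_add, map_smul, ev_ct, map_mul, smul_eq_mul]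
  simp only [DoubleField.covariantK, h1, h2, h.inv, h.covDE_un, h.covDE_bar, h.calDE,
    ct_ct_eq_sum', map_sub, map_sum, map_mul]
  refine congrArg₂ (· - ·) ?_ (congrArg _ ?_)
  · simp only [ct, mul_assoc]
  · rw [← ct_ct_eq_sum' (G.map (ev x)) fun a b c d =>
      ev x (smoothDer hV q (e a c)) * ev x (smoothDer hV p (e b d)), ct_ct_eq_sum]
    simp only [mul_assoc]

theorem bianchi₁ (h : Reduces hV E d e G d') {k : Fin D → Fin D → smoothAlg V} {r : smoothAlg V}
    (hK : ∀ (x : V) x' p q, K E d p q (x, x') = ev x (k p q))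
    (hR : ∀ (x : V) x', R E d (x, x') = ev x r) (x : V) (x' : Pt D) (q : Fin D) :
    bianchi₁ E d q (x, x') = ev x (bianchiLeft (smoothDer hV) e G d' k r q) := by
  have h1 : ∀ s p, calCov E un ![un, bar] (fun J => K E d (J 0) (J 1)) s ![p, q] (x, x') =
      ev x (smoothDer hV s (k p q) - ∑ m, gUU (smoothDer hV) e G m s p * k m q -
        ∑ m, mUp (smoothDer hV) e G m s q * k p m) := by
    intro s p
    rw [calCov₂, calD_eq_ev hV E un (fun x x' => hK x x' _ _)]
    change _ - ∑ m, gam E un un m s p _ * K E d m q _ - ∑ m, gam E un bar m s q _ * K E d p m _ = _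
    simp only [h.gam_un_un, h.gam_un_bar, hK, map_sub, map_sum, map_mul]
    rfl
  simp only [bianchiLeft, map_sub, map_add, map_smul, ev_ct, map_mul, smul_eq_mul]
  simp only [DoubleField.bianchi₁, h1, h.inv, h.calDE, h.calD_dil, hK, calD_eq_ev hV E _ hR,
    map_sub, map_sum, map_mul, ct, mul_assoc]

theorem bianchi₂ (h : Reduces hV E d e G d') {k : Fin D → Fin D → smoothAlg V} {r : smoothAlg V}
    (hK : ∀ (x : V) x' p q, K E d p q (x, x') = ev x (k p q))
    (hR : ∀ (x : V) x', R E d (x, x') = ev x r) (x : V) (x' : Pt D) (p : Fin D) :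
    bianchi₂ E d p (x, x') =
      ev x (bianchiLeft (smoothDer hV) e.transpose G d' (fun i j => k j i) r p) := by
  have h1 : ∀ s q, calCov E bar ![un, bar] (fun J => K E d (J 0) (J 1)) s ![p, q] (x, x') =
      ev x (smoothDer hV s (k p q) - ∑ m, gBB (smoothDer hV) e G m s q * k p m -
        ∑ m, mUp (smoothDer hV) e G m p s * k m q) := by
    intro s q
    rw [calCov₂, calD_eq_ev hV E bar (fun x x' => hK x x' _ _)]
    change _ - ∑ m, gam E bar un m s p _ * K E d m q _ -
      ∑ m, gam E bar bar m s q _ * K E d p m _ = _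
    simp only [h.gam_bar_bar, h.gam_bar_un, hK, map_sub, map_sum, map_mul]
    exact sub_right_comm _ _ _
  simp only [bianchiLeft, map_sub, map_add, map_smul, ev_ct, map_mul, smul_eq_mul, gUU_transpose,
    mUp_transpose, Matrix.transpose_apply]
  simp only [DoubleField.bianchi₂, h1, h.inv, h.calDE, h.calD_dil, hK, calD_eq_ev hV E _ hR,
    map_sub, map_sum, map_mul, ct, mul_assoc]

end Reduces

end DoubleField

namespace DoubleField

/-! ### Derivatives of the Lagrangian -/

section Real

variable {ι : Type*} [Fintype ι]

theorem hasDerivAt_ct {G : ℝ → Matrix ι ι ℝ} {G' : Matrix ι ι ℝ} {F : ℝ → ι → ι → ℝ}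
    {F' : ι → ι → ℝ} {t : ℝ} (hG : ∀ a b, HasDerivAt (fun ε => G ε a b) (G' a b) t)
    (hF : ∀ a b, HasDerivAt (fun ε => F ε a b) (F' a b) t) :
    HasDerivAt (fun ε => ct (G ε) (F ε)) (ct G' (F t) + ct (G t) F') t := by
  simp only [ct, ← Finset.sum_add_distrib]
  exact HasDerivAt.fun_sum fun a _ => HasDerivAt.fun_sum fun b _ => (hG a b).mul (hF a b)

theorem hasDerivAt_ct_right (G : Matrix ι ι ℝ) {F : ℝ → ι → ι → ℝ}
    {F' : ι → ι → ℝ} {t : ℝ} (hF : ∀ a b, HasDerivAt (fun ε => F ε a b) (F' a b) t) :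
    HasDerivAt (fun ε => ct G (F ε)) (ct G F') t := by
  simp only [ct]
  exact HasDerivAt.fun_sum fun a _ => HasDerivAt.fun_sum fun b _ => (hF a b).const_mul _

variable [DecidableEq ι]

theorem hasDerivAt_ell_metric {G : ℝ → Matrix ι ι ℝ} {G' : Matrix ι ι ℝ} {t : ℝ}
    (hG : ∀ a b, HasDerivAt (fun ε => G ε a b) (G' a b) t) (x : ι → ι → ι → ℝ) (v : ι → ℝ) :
    HasDerivAt (fun ε => ell (G ε) x v) (ct G' (ellG (G t) x v)) t := by
  have c : ∀ r : ℝ, HasDerivAt (fun _ => r) 0 t := fun r => hasDerivAt_const t r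
  have h1 := ((hasDerivAt_ct hG fun i k => hasDerivAt_ct hG fun j l => hasDerivAt_ct hG fun p r =>
    c (x r k l * x p i j)).const_smul (-1 / 4 : ℝ)).fun_add
    ((hasDerivAt_ct hG fun k l => hasDerivAt_ct hG fun j m => hasDerivAt_ct hG fun i n =>
      c (x m i k * x n j l + x m k i * x n l j)).const_smul (1 / 4 : ℝ))
  have h2 := (h1.fun_add (hasDerivAt_ct hG fun i k => hasDerivAt_ct hG fun j l =>
    c (v k * x l i j + v k * x l j i))).fun_add
    ((hasDerivAt_ct hG fun i j => c (v i * v j)).const_smul (4 : ℝ))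
  refine h2.congr_deriv ?_
  change _ = ct G' fun a b => ellG (G t) x v a b
  simp only [ellG, ellGquad, ellGlin, ct_add, ct_smul, ct_zero, add_zero]
  simp only [ct_comm (G t) G']
  module

theorem hasDerivAt_ell_x {G : Matrix ι ι ℝ} (hG : ∀ a b, G a b = G b a) {x : ℝ → ι → ι → ι → ℝ}
    {y : ι → ι → ι → ℝ} {t : ℝ} (hx : ∀ i j k, HasDerivAt (fun ε => x ε i j k) (y i j k) t)
    (v : ι → ℝ) :
    HasDerivAt (fun ε => ell G (x ε) v) (∑ i, ∑ p, ∑ q, y i p q * ellx G (x t) v i p q) t := by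
  have h1 := ((hasDerivAt_ct_right G fun i k => hasDerivAt_ct_right G fun j l =>
    hasDerivAt_ct_right G fun p r => (hx r k l).fun_mul (hx p i j)).const_smul (-1 / 4 : ℝ)).fun_add
    ((hasDerivAt_ct_right G fun k l => hasDerivAt_ct_right G fun j m =>
      hasDerivAt_ct_right G fun i n => ((hx m i k).fun_mul (hx n j l)).fun_add
        ((hx m k i).fun_mul (hx n l j))).const_smul (1 / 4 : ℝ))
  have h2 := (h1.fun_add (hasDerivAt_ct_right G fun i k => hasDerivAt_ct_right G fun j l =>
    ((hx l i j).const_mul (v k)).fun_add ((hx l j i).const_mul (v k)))).fun_add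
    (hasDerivAt_const t ((4 : ℝ) • ct G fun i j => v i * v j))
  refine h2.congr_deriv ?_
  have h3 := ell_linear_x hG (x t) y
  have h4 : ct G (fun i a => ct G fun p b => ct G fun q c => y i p q * mArr (x t) a b c) =
      ∑ i, ∑ p, ∑ q, y i p q * ∑ a, ∑ b, ∑ c, G i a * G p b * G q c * mArr (x t) a b c := by
    simp only [ct, Finset.mul_sum]
    refine Finset.sum_congr rfl fun i _ => ?_
    rw [Finset.sum_comm]
    refine Finset.sum_congr rfl fun p _ => ?_
    rw [Finset.sum_congr rfl fun a _ => Finset.sum_comm, Finset.sum_comm]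
    exact Finset.sum_congr rfl fun q _ => Finset.sum_congr rfl fun a _ =>
      Finset.sum_congr rfl fun b _ => Finset.sum_congr rfl fun c _ => by ring
  have h5 : ∀ y : ι → ι → ι → ℝ, ct G (fun i k => ct G fun j l => v k * y l i j) =
      ∑ l, ∑ i, ∑ j, y l i j * ((∑ k, G i k * v k) * G j l) := by
    intro y
    simp only [ct, Finset.mul_sum, Finset.sum_mul]
    rw [Finset.sum_comm (γ := ι) (f := fun l i => ∑ j, ∑ k, y l i j * (G i k * v k * G j l))]
    exact Finset.sum_congr rfl fun i _ => sum_sum_sum_eq_of_reverse fun k j l => by ring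
  have h6 : ct G (fun i k => ct G fun j l => v k * y l j i) =
      ∑ l, ∑ i, ∑ j, y l i j * ((∑ k, G j k * v k) * G i l) := by
    rw [h5 fun l i j => y l j i]
    exact Finset.sum_congr rfl fun l _ => sum_sum_eq_of_swap fun _ _ => rfl
  have h7 : ∑ i, ∑ p, ∑ q, y i p q * ellx G (x t) v i p q =
      ∑ i, ∑ p, ∑ q, y i p q * ∑ a, ∑ b, ∑ c, G i a * G p b * G q c * mArr (x t) a b c +
      ∑ l, ∑ i, ∑ j, y l i j * ((∑ k, G i k * v k) * G j l) +
      ∑ l, ∑ i, ∑ j, y l i j * ((∑ k, G j k * v k) * G i l) := by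
    simp only [ellx, mul_add, Finset.sum_add_distrib]
  rw [h7, ← h4, ← h5, ← h6, ← h3]
  simp only [ct_add]
  module

theorem hasDerivAt_ell_v {G : Matrix ι ι ℝ} (hG : ∀ a b, G a b = G b a) (x : ι → ι → ι → ℝ)
    {v : ℝ → ι → ℝ} {w : ι → ℝ} {t : ℝ} (hv : ∀ i, HasDerivAt (fun ε => v ε i) (w i) t) :
    HasDerivAt (fun ε => ell G x (v ε)) (∑ n, w n * ellv G x (v t) n) t := by
  have h1 := ((hasDerivAt_const t ((-1 / 4 : ℝ) • ct G (fun i k => ct G fun j l => ct G fun p r =>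
    x r k l * x p i j) + (1 / 4 : ℝ) • ct G (fun k l => ct G fun j m => ct G fun i n =>
      x m i k * x n j l + x m k i * x n l j))).fun_add
    (hasDerivAt_ct_right G fun i k => hasDerivAt_ct_right G fun j l =>
      ((hv k).mul_const (x l i j)).fun_add ((hv k).mul_const (x l j i)))).fun_add
    ((hasDerivAt_ct_right G fun i j => (hv i).fun_mul (hv j)).const_smul (4 : ℝ))
  refine h1.congr_deriv ?_
  have h2 : ct G (fun i j => v t i * w j) = ct G (fun i j => w i * v t j) := by
    rw [ct_swap _ hG]; simp only [mul_comm]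
  have h3 : ∑ n, w n * ellv G x (v t) n =
      ct G fun n i => w n * (ct G (fun j l => x l i j + x l j i) + (8 : ℝ) • v t i) := by
    simp only [ct, ellv, Finset.mul_sum, mul_left_comm]
  rw [h3, zero_add, ct_swap _ hG]
  simp only [← mul_add, ct_mul_left]
  simp only [mul_add, ct_add, h2, mul_smul_comm, ct_smul]
  module

end Real

end DoubleField

namespace DoubleField

open Side

variable {D : ℕ}

theorem lagrangian_eq {J : Jet D} (h : ∀ l j k, J.dte l j k = 0) (h' : ∀ l, J.ddt l = 0) :
    lagrangian J = Real.exp (-2 * J.d) *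
      ell (metric J.e)⁻¹ (fun i j k => J.de i j k) fun i => J.dd i := by
  have hE : ∀ s i j k, J.DE s i j k = J.de i j k := by
    intro s i j k; cases s <;> simp [Jet.DE, h]
  have hd : ∀ s i, J.Dd s i = J.dd i := by
    intro s i; cases s <;> simp [Jet.Dd, h']
  simp only [lagrangian, hE, hd, ell]
  set G := (metric J.e)⁻¹
  have h1 : ct G (fun i k => ct G fun j l => ct G fun p r => J.de r k l * J.de p i j) =
      ∑ i, ∑ j, ∑ k, ∑ l, ∑ p, ∑ r, G i k * G j l * G p r * J.de r k l * J.de p i j := by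
    rw [ct_ct_eq_sum]
    simp only [ct, Finset.mul_sum, mul_assoc]
  have h2 : ct G (fun k l => ct G fun j m => ct G fun i n =>
      J.de m i k * J.de n j l + J.de m k i * J.de n l j) =
      ∑ i, ∑ j, ∑ k, ∑ l, ∑ m, ∑ n, G k l * G j m * G i n *
        (J.de m i k * J.de n j l + J.de m k i * J.de n l j) := by
    have e1 : ∀ f : Fin D → Fin D → Fin D → Fin D → Fin D → Fin D → ℝ,
        ∑ i, ∑ j, ∑ k, ∑ l, ∑ m, ∑ n, f i j k l m n =
        ∑ y : Fin D × Fin D × Fin D × Fin D × Fin D × Fin D,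
          f y.1 y.2.1 y.2.2.1 y.2.2.2.1 y.2.2.2.2.1 y.2.2.2.2.2 := by
      intro f
      simp only [Fintype.sum_prod_type]
    simp only [ct, Finset.mul_sum]
    rw [e1 fun k l j m i n => G k l * (G j m * (G i n *
      (J.de m i k * J.de n j l + J.de m k i * J.de n l j))), e1]
    refine Fintype.sum_equiv
      { toFun := fun y => (y.2.2.2.2.1, y.2.2.1, y.1, y.2.1, y.2.2.2.1, y.2.2.2.2.2)
        invFun := fun y => (y.2.2.1, y.2.2.2.1, y.2.1, y.2.2.2.2.1, y.1, y.2.2.2.2.2)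
        left_inv := fun _ => rfl
        right_inv := fun _ => rfl } _ _ fun y => ?_
    simp only [Equiv.coe_fn_mk]
    ring
  have h3 : ct G (fun i k => ct G fun j l => J.dd k * J.de l i j + J.dd k * J.de l j i) =
      ∑ i, ∑ j, ∑ k, ∑ l, G i k * G j l * (J.dd k * J.de l i j + J.dd k * J.de l j i) := by
    rw [ct_ct_eq_sum]
  have h4 : ct G (fun i j => J.dd i * J.dd j) = ∑ i, ∑ j, G i j * J.dd i * J.dd j := by
    simp only [ct, mul_assoc]
  rw [h1, h2, h3, h4]
  simp only [smul_eq_mul]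
  ring

section Inverse

attribute [local instance] Matrix.linftyOpNormedRing Matrix.linftyOpNormedAlgebra

theorem hasDerivAt_inv_apply {g : Mat D} (hg : IsUnit g.det) (M : Mat D) (a b : Fin D) :
    HasDerivAt (fun ε : ℝ => (g + ε • M)⁻¹ a b) (-(g⁻¹ * M * g⁻¹) a b) 0 := by
  obtain ⟨u, rfl⟩ := (Matrix.isUnit_iff_isUnit_det _).mpr hg
  have h1 : HasDerivAt (fun ε : ℝ => (u : Mat D) + ε • M) M 0 := by
    exact (((hasDerivAt_id (0 : ℝ)).smul_const M).const_add (u : Mat D)).congr_deriv (one_smul ℝ M)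
  have h2 := hasFDerivAt_ringInverse (𝕜 := ℝ) u
  have h3 : HasFDerivAt Ring.inverse (-ContinuousLinearMap.mulLeftRight ℝ (Mat D) ↑u⁻¹ ↑u⁻¹)
    ((u : Mat D) + (0 : ℝ) • M) := by simpa using h2
  have h4 := h3.comp_hasDerivAt (0 : ℝ) h1
  have h5 := (LinearMap.toContinuousLinearMap
    (Matrix.entryLinearMap ℝ ℝ a b)).hasFDerivAt.comp_hasDerivAt (0 : ℝ) h4
  have h6 : (u : Mat D)⁻¹ = ↑u⁻¹ := by
    rw [Matrix.nonsing_inv_eq_ringInverse, Ring.inverse_unit]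
  simp only [Matrix.nonsing_inv_eq_ringInverse] at h6 ⊢
  rw [h6]
  refine HasDerivAt.congr_deriv h5 ?_
  simp
  rfl

end Inverse

variable {J : Jet D}

theorem lagE_eq (h : ∀ l j k, J.dte l j k = 0) (h' : ∀ l, J.ddt l = 0)
    (hg : IsUnit (metric J.e).det) (p q : Fin D) :
    lagE p q J = Real.exp (-2 * J.d) * ((-1 / 2) * ∑ a, ∑ b,
      ((metric J.e)⁻¹ a p * (metric J.e)⁻¹ q b + (metric J.e)⁻¹ a q * (metric J.e)⁻¹ p b) *
        ellG (metric J.e)⁻¹ (fun i j k => J.de i j k) (fun i => J.dd i) a b) := by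
  set M : Mat D := metric (Matrix.single p q 1) with hM
  have h1 : ∀ ε : ℝ, metric (J.e + ε • Matrix.single p q 1) = metric J.e + ε • M := by
    intro ε
    simp only [hM, metric, Matrix.transpose_add, Matrix.transpose_smul]
    module
  have h2 : (fun ε : ℝ => lagrangian { J with e := J.e + ε • Matrix.single p q 1 }) =
      fun ε => Real.exp (-2 * J.d) *
        ell (metric J.e + ε • M)⁻¹ (fun i j k => J.de i j k) fun i => J.dd i := by
    funext ε
    refine (lagrangian_eq (J := { J with e := J.e + ε • Matrix.single p q 1 }) h h').trans ?_
    rw [h1]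
  rw [lagE, h2, ((hasDerivAt_ell_metric (G' := -((metric J.e)⁻¹ * M * (metric J.e)⁻¹))
    (hasDerivAt_inv_apply hg M) _ _).const_mul _).deriv]
  congr 1
  simp only [zero_smul, add_zero, ct, Finset.mul_sum]
  refine Finset.sum_congr rfl fun a _ => Finset.sum_congr rfl fun b _ => ?_
  rw [← mul_assoc]
  congr 1
  set G : Mat D := (metric J.e)⁻¹
  have h3 : ∀ p q : Fin D, (G * Matrix.single p q 1 * G : Mat D) a b = G a p * G q b := by
    intro p q
    simp [Matrix.mul_apply, Matrix.single_apply, ite_and]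
  simp only [hM, metric, Matrix.transpose_single, Matrix.mul_smul, Matrix.smul_mul, mul_add,
    add_mul, Matrix.neg_apply, Matrix.smul_apply, Matrix.add_apply, h3, smul_eq_mul]
  ring

theorem lagDE_eq (h : ∀ l j k, J.dte l j k = 0) (h' : ∀ l, J.ddt l = 0)
    (hG : ∀ a b, (metric J.e)⁻¹ a b = (metric J.e)⁻¹ b a) (i p q : Fin D) :
    lagDE i p q J = Real.exp (-2 * J.d) *
      ellx (metric J.e)⁻¹ (fun i j k => J.de i j k) (fun i => J.dd i) i p q := by
  have h2 : (fun ε : ℝ => lagrangian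
      { J with de := Function.update J.de i (J.de i + ε • Matrix.single p q 1) }) =
      fun ε => Real.exp (-2 * J.d) * ell (metric J.e)⁻¹ (fun l j k => J.de l j k + ε *
        (if i = l ∧ p = j ∧ q = k then 1 else 0)) fun i => J.dd i := by
    funext ε
    refine (lagrangian_eq (J := { J with
      de := Function.update J.de i (J.de i + ε • Matrix.single p q 1) }) h h').trans ?_
    congr 2
    funext l j k
    by_cases hl : i = l
    · subst hl; simp [Matrix.single_apply]
    · simp [Function.update_of_ne (Ne.symm hl), hl]
  have h3 := hasDerivAt_ell_x hG (t := 0) (x := fun ε l j k => J.de l j k + ε *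
    (if i = l ∧ p = j ∧ q = k then 1 else 0))
    (y := fun l j k => if i = l ∧ p = j ∧ q = k then 1 else 0) (fun l j k => by
      simpa using ((hasDerivAt_id (0 : ℝ)).mul_const
        (if i = l ∧ p = j ∧ q = k then (1 : ℝ) else 0)).const_add (J.de l j k)) fun i => J.dd i
  rw [lagDE, h2, (h3.const_mul _).deriv]
  simp [ite_and]

theorem lagDd_eq (h : ∀ l j k, J.dte l j k = 0) (h' : ∀ l, J.ddt l = 0)
    (hG : ∀ a b, (metric J.e)⁻¹ a b = (metric J.e)⁻¹ b a) (i : Fin D) :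
    lagDd i J = Real.exp (-2 * J.d) *
      ellv (metric J.e)⁻¹ (fun i j k => J.de i j k) (fun i => J.dd i) i := by
  have h2 : (fun ε : ℝ => lagrangian { J with dd := Function.update J.dd i (J.dd i + ε) }) =
      fun ε => Real.exp (-2 * J.d) * ell (metric J.e)⁻¹ (fun l j k => J.de l j k)
        fun l => J.dd l + ε * (if i = l then 1 else 0) := by
    funext ε
    refine (lagrangian_eq (J := { J with
      dd := Function.update J.dd i (J.dd i + ε) }) h h').trans ?_
    congr 2
    funext l
    by_cases hl : i = l
    · subst hl; simp
    · simp [Function.update_of_ne (Ne.symm hl), hl]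
  have h3 := hasDerivAt_ell_v hG (t := 0) (v := fun ε l => J.dd l + ε * (if i = l then 1 else 0))
    (w := fun l => if i = l then 1 else 0) (x := fun i j k => J.de i j k) (fun l => by
      simpa using ((hasDerivAt_id (0 : ℝ)).mul_const
        (if i = l then (1 : ℝ) else 0)).const_add (J.dd l))
  rw [lagDd, h2, (h3.const_mul _).deriv]
  simp

theorem lagd_eq (h : ∀ l j k, J.dte l j k = 0) (h' : ∀ l, J.ddt l = 0) :
    lagd J = -2 * (Real.exp (-2 * J.d) *
      ell (metric J.e)⁻¹ (fun i j k => J.de i j k) fun i => J.dd i) := by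
  have h2 : (fun ε : ℝ => lagrangian { J with d := J.d + ε }) =
      fun ε => Real.exp (-2 * (J.d + ε)) *
        ell (metric J.e)⁻¹ (fun i j k => J.de i j k) fun i => J.dd i := by
    funext ε
    exact lagrangian_eq (J := { J with d := J.d + ε }) h h'
  have h3 : HasDerivAt (fun ε : ℝ => -2 * (J.d + ε)) (-2) 0 := by
    simpa using ((hasDerivAt_id (0 : ℝ)).const_add J.d).const_mul (-2)
  rw [lagd, h2, (h3.exp.mul_const _).deriv]
  simp only [add_zero]
  ring

end DoubleField

namespace DoubleField

open Side

variable {D : ℕ} {V : Set (Pt D)}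

section Eval

variable (x : V) (G : Matrix (Fin D) (Fin D) (smoothAlg V))
  (X : Fin D → Fin D → Fin D → smoothAlg V) (v : Fin D → smoothAlg V)

theorem ev_ell : ev x (ell G X v) =
    ell (G.map (ev x)) (fun i j k => ev x (X i j k)) fun i => ev x (v i) := by
  simp only [ell, map_add, map_smul, ev_ct, map_mul]

theorem ev_ellG (a b : Fin D) : ev x (ellG G X v a b) =
    ellG (G.map (ev x)) (fun i j k => ev x (X i j k)) (fun i => ev x (v i)) a b := by
  simp only [ellG, ellGquad, ellGlin, map_add, map_smul, ev_ct, map_mul]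

theorem ev_ellx (i p q : Fin D) : ev x (ellx G X v i p q) =
    ellx (G.map (ev x)) (fun i j k => ev x (X i j k)) (fun i => ev x (v i)) i p q := by
  simp only [ellx, mArr, map_add, map_sub, map_smul, map_sum, map_mul, Matrix.map_apply]

theorem ev_ellv (i : Fin D) : ev x (ellv G X v i) =
    ellv (G.map (ev x)) (fun i j k => ev x (X i j k)) (fun i => ev x (v i)) i := by
  simp only [ellv, map_add, map_smul, ev_ct, map_sum, map_mul, Matrix.map_apply]

end Eval

/-- The density `e^{-2d}`. -/
def density (d : smoothAlg V) : smoothAlg V :=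
  smoothMk (fun x => Real.exp (-2 * repr d x)) (contDiffOn_const.mul (contDiffOn_repr d)).exp

theorem ev_density (d : smoothAlg V) (x : V) : ev x (density d) = Real.exp (-2 * ev x d) := by
  rw [density, ev_smoothMk, repr_apply]

theorem der_density (hV : IsOpen V) (d : smoothAlg V) (i : Fin D) :
    smoothDer hV i (density d) = (-2 : ℝ) • (smoothDer hV i d * density d) := by
  refine ev_ext fun x => ?_
  rw [← pd_eq_ev hV (F := fun x => Real.exp (-2 * repr d x)) (fun _ => rfl)]
  have h1 : pd i (repr d) x = ev x (smoothDer hV i d) := pd_eq_ev hV (repr_apply d) i x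
  have hd := differentiableAt_repr hV d x
  unfold pd at h1 ⊢
  rw [fderiv_exp (hd.const_mul (-2)), fderiv_const_mul hd]
  simp only [_root_.smul_apply, smul_eq_mul, h1, map_smul, map_mul, ev_density, repr_apply]
  ring

namespace Reduces

variable {hV : IsOpen V} {E : DPt D → Mat D} {d : DPt D → ℝ}
  {e G : Matrix (Fin D) (Fin D) (smoothAlg V)} {d' lam : smoothAlg V}

/-- The jet at a point of fields independent of the dual coordinates. -/
def _root_.DoubleField.evJet (hV : IsOpen V) (e : Matrix (Fin D) (Fin D) (smoothAlg V))
    (d' : smoothAlg V) (x : V) : Jet D where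
  e := e.map (ev x)
  d := ev x d'
  de := fun i => Matrix.of fun j k => ev x (smoothDer hV i (e j k))
  dte := 0
  dd := fun i => ev x (smoothDer hV i d')
  ddt := 0

theorem jet_eq (h : Reduces hV E d e G d') (x : V) (x' : Pt D) :
    jet E d (x, x') = evJet hV e d' x := by
  have h1 : E (x, x') = e.map (ev x) := by ext i j; exact h.field x x' i j
  have h2 : ∀ i j k, dx i (fun Y => E Y j k) (x, x') = ev x (smoothDer hV i (e j k)) := fun i j k =>
    dx_eq_ev hV (F := fun Y => E Y j k) (fun x x' => h.field x x' j k) i x x'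
  have h3 : ∀ i j k, dxt i (fun Y => E Y j k) (x, x') = 0 := fun i j k =>
    dxt_eq_zero (F := fun Y => E Y j k) (fun x x' => h.field x x' j k) i x x'
  simp only [jet, evJet, h1, h2, h3, h.dil, dx_eq_ev hV h.dil, dxt_eq_zero h.dil]
  rfl

theorem inv_evJet (h : Reduces hV E d e G d') (x : V) :
    (DoubleField.metric (evJet hV e d' x).e)⁻¹ = G.map (ev x) := by
  rw [← h.jet_eq x 0]; exact h.inv x 0

theorem exp_mul_density (h : Reduces hV E d e G d') (x : V) (x' : Pt D) :
    Real.exp (2 * d (x, x')) * ev x (density d') = 1 := by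
  rw [ev_density, h.dil, ← Real.exp_add]
  simp

theorem varE_eq (h : Reduces hV E d e G d')
    (L : LeviCivita (smoothDer hV) (symPart e) G (chr (smoothDer hV) (symPart e) G) lam)
    (x : V) (x' : Pt D) (k l : Fin D) :
    varE E d k l (x, x') = ev x (density d' * ((-1 / 2 : ℝ) • (∑ a, ∑ b,
      (G a k * G l b + G a l * G k b) * ellG G (fun i j k => smoothDer hV i (e j k))
        (fun i => smoothDer hV i d') a b) -
      ∑ i, smoothDer hV i (ellx G (fun i j k => smoothDer hV i (e j k))
        (fun i => smoothDer hV i d') i k l) +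
      (2 : ℝ) • ∑ i, smoothDer hV i d' * ellx G (fun i j k => smoothDer hV i (e j k))
        (fun i => smoothDer hV i d') i k l)) := by
  have hs : ∀ (x : V) a b, (DoubleField.metric (evJet hV e d' x).e)⁻¹ a b =
      (DoubleField.metric (evJet hV e d' x).e)⁻¹ b a := fun x a b => by
    rw [h.inv_evJet, Matrix.map_apply, Matrix.map_apply, L.G_symm]
  have hu : IsUnit (DoubleField.metric (evJet hV e d' x).e).det := by
    have h1 : DoubleField.metric (evJet hV e d' x).e = (symPart e).map (ev x) := by
      rw [← h.jet_eq x x']; ext i j; exact h.metric x x' i j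
    have h2 : IsUnit (symPart e).det := Matrix.isUnit_det_of_left_inverse L.G_mul
    rw [h1]
    have h3 := h2.map (ev x)
    rwa [AlgHom.map_det] at h3
  have hx : ∀ (x : V) x' i, lagDE i k l (jet E d (x, x')) =
      ev x (density d' * ellx G (fun i j k => smoothDer hV i (e j k))
        (fun i => smoothDer hV i d') i k l) := fun x x' i => by
    rw [h.jet_eq, lagDE_eq (fun _ _ _ => rfl) (fun _ => rfl) (hs x), h.inv_evJet, map_mul,
      ev_density, ev_ellx]
    rfl
  have ht : ∀ i, dxt i (fun Y => lagDtE i k l (jet E d Y)) (x, x') = 0 := fun i =>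
    dxt_eq_zero (F := fun Y => lagDtE i k l (jet E d Y))
      (u := fun x => lagDtE i k l (evJet hV e d' x))
      (fun x x' => by simp only [h.jet_eq]) i x x'
  have hdx : ∀ i, dx i (fun Y => lagDE i k l (jet E d Y)) (x, x') = ev x (smoothDer hV i
      (density d' * ellx G (fun i j k => smoothDer hV i (e j k))
        (fun i => smoothDer hV i d') i k l)) := fun i =>
    dx_eq_ev hV (F := fun Y => lagDE i k l (jet E d Y)) (fun x x' => hx x x' i) i x x'
  have h0 : lagE k l (jet E d (x, x')) = ev x (density d' * ((-1 / 2 : ℝ) • (∑ a, ∑ b,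
      (G a k * G l b + G a l * G k b) * ellG G (fun i j k => smoothDer hV i (e j k))
        (fun i => smoothDer hV i d') a b))) := by
    rw [h.jet_eq, lagE_eq (fun _ _ _ => rfl) (fun _ => rfl) hu, h.inv_evJet, map_mul, ev_density]
    simp only [map_smul, map_sum, map_mul, map_add, ev_ellG]
    rfl
  rw [varE, h0]
  simp only [hdx, ht, Finset.sum_const_zero, sub_zero]
  rw [← map_sum, ← map_sub]
  congr 1
  simp only [Derivation.leibniz, smul_eq_mul, der_density, Finset.sum_add_distrib, mul_smul_comm,
    ← Finset.smul_sum, Finset.mul_sum, mul_add, mul_sub]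
  have h3 : ∀ i, ellx G (fun i j k => smoothDer hV i (e j k)) (fun i => smoothDer hV i d') i k l *
      (smoothDer hV i d' * density d') = density d' * (smoothDer hV i d' *
        ellx G (fun i j k => smoothDer hV i (e j k)) (fun i => smoothDer hV i d') i k l) :=
    fun i => by ring
  simp only [h3]
  module

theorem K_eq (h : Reduces hV E d e G d')
    (L : LeviCivita (smoothDer hV) (symPart e) G (chr (smoothDer hV) (symPart e) G) lam)
    (x : V) (x' : Pt D) (p q : Fin D) :
    K E d p q (x, x') = ev x (kEL (smoothDer hV) e (symPart e) G d' p q) := by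
  rw [K, kEL, map_sum]
  refine Finset.sum_congr rfl fun k _ => ?_
  rw [map_sum]
  refine Finset.sum_congr rfl fun l _ => ?_
  rw [map_mul, map_mul, ← h.metric x x', ← h.metric x x', h.varE_eq L, map_mul (ev x) (density d'),
    ← mul_assoc (Real.exp _), h.exp_mul_density, one_mul]

theorem R_eq (h : Reduces hV E d e G d')
    (L : LeviCivita (smoothDer hV) (symPart e) G (chr (smoothDer hV) (symPart e) G) lam)
    (x : V) (x' : Pt D) :
    R E d (x, x') = ev x (rEL (smoothDer hV) e G d') := by
  have hs : ∀ (x : V) a b, (DoubleField.metric (evJet hV e d' x).e)⁻¹ a b =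
      (DoubleField.metric (evJet hV e d' x).e)⁻¹ b a := fun x a b => by
    rw [h.inv_evJet, Matrix.map_apply, Matrix.map_apply, L.G_symm]
  have hx : ∀ (x : V) x' i, lagDd i (jet E d (x, x')) =
      ev x (density d' * ellv G (fun i j k => smoothDer hV i (e j k))
        (fun i => smoothDer hV i d') i) := fun x x' i => by
    rw [h.jet_eq, lagDd_eq (fun _ _ _ => rfl) (fun _ => rfl) (hs x), h.inv_evJet, map_mul,
      ev_density, ev_ellv]
    rfl
  have ht : ∀ i, dxt i (fun Y => lagDtd i (jet E d Y)) (x, x') = 0 := fun i =>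
    dxt_eq_zero (F := fun Y => lagDtd i (jet E d Y))
      (u := fun x => lagDtd i (evJet hV e d' x))
      (fun x x' => by simp only [h.jet_eq]) i x x'
  have hdx : ∀ i, dx i (fun Y => lagDd i (jet E d Y)) (x, x') = ev x (smoothDer hV i
      (density d' * ellv G (fun i j k => smoothDer hV i (e j k))
        (fun i => smoothDer hV i d') i)) := fun i =>
    dx_eq_ev hV (F := fun Y => lagDd i (jet E d Y)) (fun x x' => hx x x' i) i x x'
  have h0 : lagd (jet E d (x, x')) = ev x ((-2 : ℝ) • (density d' *
      ell G (fun i j k => smoothDer hV i (e j k)) (fun i => smoothDer hV i d'))) := by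
    rw [h.jet_eq, lagd_eq (fun _ _ _ => rfl) (fun _ => rfl), h.inv_evJet, map_smul, map_mul,
      ev_density, ev_ell]
    rfl
  have h1 : vard E d (x, x') = ev x (density d' * ((-2 : ℝ) • rEL (smoothDer hV) e G d')) := by
    rw [vard, h0]
    simp only [hdx, ht, Finset.sum_const_zero, sub_zero]
    rw [← map_sum, ← map_sub]
    congr 1
    simp only [rEL, Derivation.leibniz, smul_eq_mul, der_density, Finset.sum_add_distrib,
      mul_smul_comm, ← Finset.smul_sum, Finset.mul_sum, mul_add, mul_sub]
    have h3 : ∀ i, ellv G (fun i j k => smoothDer hV i (e j k)) (fun i => smoothDer hV i d') i *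
        (smoothDer hV i d' * density d') = density d' * (smoothDer hV i d' *
          ellv G (fun i j k => smoothDer hV i (e j k)) (fun i => smoothDer hV i d') i) :=
      fun i => by ring
    simp only [h3]
    module
  rw [R, h1, map_mul, mul_assoc, ← mul_assoc (Real.exp _), h.exp_mul_density, map_smul, smul_eq_mul]
  ring

end Reduces

end DoubleField

namespace DoubleField

/-! ### Consequences for the fields on `V` -/

section Algebra

variable {ι A : Type*} [Fintype ι] [DecidableEq ι] [CommRing A] [Algebra ℝ A]
  {der : ι → Derivation ℝ A A} {g G : Matrix ι ι A} {Γ H : ι → ι → ι → A} {lam : A}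

theorem nab4_swap₃₄ (hH : ClosedForm der H) (a c s p q : ι) :
    nab4 der Γ (nab3 der Γ H) a c s q p = -nab4 der Γ (nab3 der Γ H) a c s p q := by
  simp only [nab4, LeviCivita.nab3_swap₂₃ hH _ s p q,
    fun m => LeviCivita.nab3_swap₂₃ (Γ := Γ) hH c m p q,
    fun m => LeviCivita.nab3_swap₂₃ (Γ := Γ) hH c s m q, fun m => LeviCivita.nab3_swap₂₃ (Γ := Γ) hH c s p m,
    map_neg, mul_neg, Finset.sum_neg_distrib]
  ring

theorem divForm_antisymm (hH : ClosedForm der H) (p q : ι) :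
    divForm der G Γ H q p = -divForm der G Γ H p q := by
  unfold divForm
  rw [← ct_neg]
  congr 1; funext s t
  exact LeviCivita.nab3_swap₂₃ hH _ _ _ _

theorem contrForm_antisymm (hH : ClosedForm der H) (u : ι → A) (p q : ι) :
    contrForm G H u q p = -contrForm G H u p q := by
  unfold contrForm
  rw [← ct_neg]
  congr 1; funext s t
  rw [hH.swap₂₃, neg_mul]

namespace LeviCivita

theorem div_div' (L : LeviCivita der g G Γ lam) (hH : ClosedForm der H) (p : ι) :
    ct G (fun q a => ct G fun s c => nab4 der Γ (nab3 der Γ H) a c s p q) = 0 := by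
  rw [← neg_eq_zero, ← L.div_div hH p, ← ct_neg]
  congr 1; funext q a
  rw [← ct_neg]
  congr 1; funext s c
  rw [nab4_swap₃₄ hH, neg_neg]

theorem contracted_bianchi (L : LeviCivita der g G Γ lam) (q : ι) :
    ct G (fun p a => nab2 der Γ (ric der Γ) a p q) =
      (1 / 2 : ℝ) • der q (ct G (ric der Γ)) := by
  have h := L.div_ric q
  rw [← L.der_ct q (ric der Γ)] at h
  rw [ct_swap _ L.G_symm]
  linear_combination (norm := algebra) (1 / 2 : ℝ) • h

theorem half_contr_nab (L : LeviCivita der g G Γ lam) (hH : ClosedForm der H) (q : ι) :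
    (1 / 2 : ℝ) • ct G (fun p a => ct G fun r c => ct G fun s u =>
      H p c u * nab3 der Γ H a q r s) = (1 / 12 : ℝ) • der q (ct G (sqH G H)) := by
  rw [L.der_normH hH]
  algebra

end LeviCivita

end Algebra

variable {D : ℕ} {V : Set (Pt D)} {hV : IsOpen V} {g b : Pt D → Mat D} {φ : Pt D → ℝ}
  {e G : Matrix (Fin D) (Fin D) (smoothAlg V)} {f lam : smoothAlg V}

namespace Realizes

theorem hess_symm (h : Realizes hV g b φ e G f)
    (L : LeviCivita (smoothDer hV) (symPart e) G (chr (smoothDer hV) (symPart e) G) lam) (x : V)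
    (i j : Fin D) :
    DoubleField.ricci g ![j, i] x - (1 / 4) * DoubleField.hSq g b j i x +
        2 * DoubleField.hess g φ ![j, i] x =
      DoubleField.ricci g ![i, j] x - (1 / 4) * DoubleField.hSq g b i j x +
        2 * DoubleField.hess g φ ![i, j] x := by
  simp only [h.ricci, h.hSq, h.hess]
  rw [L.ric_symm, L.sqH_symm, L.nab1_symm]

theorem divH_antisymm (h : Realizes hV g b φ e G f)
    (L : LeviCivita (smoothDer hV) (symPart e) G (chr (smoothDer hV) (symPart e) G) lam) (x : V)
    (i j : Fin D) :
    (1 / 2) * DoubleField.divH g b j i x - DoubleField.hGrad g b φ j i x =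
      -((1 / 2) * DoubleField.divH g b i j x - DoubleField.hGrad g b φ i j x) := by
  have hH := closedForm_formH (e := e) L.comm
  simp only [h.divH, h.hGrad]
  rw [divForm_antisymm hH, contrForm_antisymm hH, map_neg, map_neg]
  ring

theorem bFieldEq_eq (h : Realizes hV g b φ e G f)
    (L : LeviCivita (smoothDer hV) (symPart e) G (chr (smoothDer hV) (symPart e) G) lam) (x : V)
    (i j : Fin D) :
    bFieldEq g b φ i j x = ∑ k, ∑ l, (g x)⁻¹ i k * (g x)⁻¹ j l *
      ((1 / 2) * DoubleField.divH g b k l x - DoubleField.hGrad g b φ k l x) := by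
  have hH := closedForm_formH (e := e) L.comm
  have h1 : ∀ p k l m, cov g (fieldStrength b) ![p, k, l, m] x =
      cov g (fieldStrength b) ![p, m, k, l] x := fun p k l m => by
    rw [h.cov₃ h.form, h.cov₃ h.form, LeviCivita.nab3_swap₂₃ hH, LeviCivita.nab3_swap₁₂ hH, neg_neg]
  have h2 : ∀ k l m, fieldStrength b ![k, l, m] x = fieldStrength b ![m, k, l] x :=
    fun k l m => by rw [h.form, h.form, hH.swap₂₃, hH.swap₁₂, neg_neg]
  refine Finset.sum_congr rfl fun k _ => Finset.sum_congr rfl fun l _ => ?_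
  simp only [DoubleField.divH, DoubleField.hGrad, Finset.mul_sum, ← Finset.sum_sub_distrib]
  refine Finset.sum_congr rfl fun m _ => Finset.sum_congr rfl fun p _ => ?_
  rw [h1, h2]; ring

end Realizes

/-- A tensor vanishes if and only if it vanishes after raising both indices. -/
theorem eq_zero_iff_raise {g : Mat D} (hg : g.det ≠ 0) (C : Fin D → Fin D → ℝ) :
    (∀ i j, C i j = 0) ↔ ∀ i j, ∑ k, ∑ l, g⁻¹ i k * g⁻¹ j l * C k l = 0 := by
  have h1 : ∀ i j, ∑ k, ∑ l, g⁻¹ i k * g⁻¹ j l * C k l =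
      (g⁻¹ * Matrix.of C * g⁻¹.transpose) i j := by
    intro i j
    simp only [Matrix.mul_apply, Matrix.transpose_apply, Matrix.of_apply, Finset.sum_mul]
    exact sum_sum_eq_of_swap fun _ _ => by ring
  have hu : IsUnit g.det := hg.isUnit
  simp only [h1]
  constructor
  · intro h i j
    have : Matrix.of C = 0 := by ext i j; exact h i j
    simp [this]
  · intro h i j
    have h2 : g⁻¹ * Matrix.of C * g⁻¹.transpose = 0 := by ext i j; exact h i j
    have h3 : g * (g⁻¹ * Matrix.of C * g⁻¹.transpose) * g.transpose = Matrix.of C := by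
      rw [mul_assoc g⁻¹, Matrix.mul_nonsing_inv_cancel_left _ _ hu, mul_assoc,
        ← Matrix.transpose_mul, Matrix.mul_nonsing_inv _ hu, Matrix.transpose_one, mul_one]
    rw [h2, mul_zero, zero_mul] at h3
    exact (congrFun (congrFun h3 i) j).symm

theorem add_eq_zero_iff_of_symm {S T : Fin D → Fin D → ℝ} (hS : ∀ i j, S j i = S i j)
    (hT : ∀ i j, T j i = -T i j) :
    (∀ i j, -S i j + T i j = 0) ↔ (∀ i j, S i j = 0) ∧ ∀ i j, T i j = 0 := by
  constructor
  · intro h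
    refine ⟨fun i j => ?_, fun i j => ?_⟩ <;>
    · have h1 := h i j
      have h2 := h j i
      rw [hS, hT] at h2
      linarith
  · rintro ⟨h1, h2⟩ i j
    rw [h1, h2]; simp

theorem metricEq_add (g b : Pt D → Mat D) (φ : Pt D → ℝ) (x : Pt D) (i j : Fin D) :
    metricEq g b φ i j x + (1 / 2) * g x i j * dilatonEq g b φ x =
      ricci g ![i, j] x + 2 * hess g φ ![i, j] x - (1 / 4) * hSq g b i j x := by
  unfold metricEq dilatonEq; ring

end DoubleField

end

theorem mainTheorem8 (D : ℕ) (V : Set (DoubleField.Pt D)) (hV : IsOpen V)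
    (g b : DoubleField.Pt D → DoubleField.Mat D) (φ : DoubleField.Pt D → ℝ)
    (hg : ∀ i j, ContDiffOn ℝ ∞ (fun x => g x i j) V)
    (hb : ∀ i j, ContDiffOn ℝ ∞ (fun x => b x i j) V)
    (hφ : ContDiffOn ℝ ∞ φ V)
    (hg_symm : ∀ x ∈ V, (g x).transpose = g x)
    (hg_det : ∀ x ∈ V, (g x).det ≠ 0)
    (hb_anti : ∀ x ∈ V, (b x).transpose = -b x)
    (E : DoubleField.DPt D → DoubleField.Mat D) (d : DoubleField.DPt D → ℝ)
    (hE : ∀ X : DoubleField.DPt D, X.1 ∈ V → E X = g X.1 + b X.1)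
    (hd : ∀ X : DoubleField.DPt D, X.1 ∈ V →
      Real.exp (-2 * d X) = Real.sqrt |(g X.1).det| * Real.exp (-2 * φ X.1)) :
    ∀ x ∈ V, ∀ x' : DoubleField.Pt D,
      -- the limit of `𝒦`, in its variational and in its covariant form
      (∀ p q, DoubleField.K E d p q (x, x') =
        (-DoubleField.ricci g ![p, q] x + (1 / 4) * DoubleField.hSq g b p q x -
          2 * DoubleField.hess g φ ![p, q] x) +
        ((1 / 2) * DoubleField.divH g b p q x - DoubleField.hGrad g b φ p q x)) ∧
      (∀ p q, DoubleField.covariantK E d p q (x, x') = DoubleField.K E d p q (x, x')) ∧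
      -- the limit of `ℛ`
      (DoubleField.R E d (x, x') = DoubleField.scalarCurv g x +
        4 * (DoubleField.laplace g φ x - DoubleField.gradSq g φ x) -
        (1 / 12) * DoubleField.hNorm g b x) ∧
      -- the equations of motion
      ((∀ p q, DoubleField.K E d p q (x, x') = 0) ↔
        (∀ i j, DoubleField.ricci g ![i, j] x - (1 / 4) * DoubleField.hSq g b i j x +
          2 * DoubleField.hess g φ ![i, j] x = 0) ∧
        (∀ i j, (1 / 2) * DoubleField.divH g b i j x - DoubleField.hGrad g b φ i j x = 0)) ∧
      (DoubleField.R E d (x, x') = 0 ↔ DoubleField.dilatonEq g b φ x = 0) ∧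
      ((∀ i j, (1 / 2) * DoubleField.divH g b i j x - DoubleField.hGrad g b φ i j x = 0) ↔
        ∀ i j, DoubleField.bFieldEq g b φ i j x = 0) ∧
      (∀ i j, DoubleField.metricEq g b φ i j x +
          (1 / 2) * g x i j * DoubleField.dilatonEq g b φ x =
        DoubleField.ricci g ![i, j] x + 2 * DoubleField.hess g φ ![i, j] x -
          (1 / 4) * DoubleField.hSq g b i j x) ∧
      (((∀ p q, DoubleField.K E d p q (x, x') = 0) ∧ DoubleField.R E d (x, x') = 0) ↔
        (∀ i j, DoubleField.metricEq g b φ i j x = 0) ∧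
        (∀ i j, DoubleField.bFieldEq g b φ i j x = 0) ∧
        DoubleField.dilatonEq g b φ x = 0) ∧
      -- the Bianchi identities
      (∀ q, DoubleField.bianchi₁ E d q (x, x') =
        (1 / 2) * (DoubleField.divDivH g b q x + ((1 / 2) * DoubleField.hCovH g b q x -
          (1 / 12) * DoubleField.pd q (DoubleField.hNorm g b) x)) +
        (-DoubleField.divRicci g q x +
          (1 / 2) * DoubleField.pd q (DoubleField.scalarCurv g) x)) ∧
      (∀ p, DoubleField.bianchi₂ E d p (x, x') =
        (1 / 2) * (DoubleField.divDivH' g b p x + ((1 / 2) * DoubleField.hCovH g b p x -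
          (1 / 12) * DoubleField.pd p (DoubleField.hNorm g b) x)) +
        (-DoubleField.divRicci g p x +
          (1 / 2) * DoubleField.pd p (DoubleField.scalarCurv g) x)) ∧
      (∀ q, DoubleField.divDivH g b q x = 0) ∧
      (∀ p, DoubleField.divDivH' g b p x = 0) ∧
      (∀ q, (1 / 2) * DoubleField.hCovH g b q x -
        (1 / 12) * DoubleField.pd q (DoubleField.hNorm g b) x = 0) ∧
      (∀ j, DoubleField.bianchi₁ E d j (x, x') =
        -(DoubleField.divRicci g j x - (1 / 2) * DoubleField.pd j (DoubleField.scalarCurv g) x)) ∧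
      (∀ j, DoubleField.bianchi₂ E d j (x, x') =
        -(DoubleField.divRicci g j x - (1 / 2) * DoubleField.pd j (DoubleField.scalarCurv g) x)) ∧
      (∀ j, DoubleField.divRicci g j x -
        (1 / 2) * DoubleField.pd j (DoubleField.scalarCurv g) x = 0) := by
  intro x hx x'
  obtain ⟨e, G, f, lam, hr, he, L, hlam⟩ :=
    DoubleField.exists_realizes hV hg hb hφ hg_symm hg_det hb_anti
  have hred : DoubleField.Reduces hV E d e G (f - (1 / 2 : ℝ) • lam) :=
    { field := fun x x' i j => by rw [hE (x, x') x.2, ← he]; rfl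
      dil := fun x x' => by
        have h1 := congrArg Real.log (hd (x, x') x.2)
        have h2 : 0 < |(g x).det| := abs_pos.mpr (hg_det x x.2)
        rw [Real.log_mul (Real.sqrt_pos.mpr h2).ne' (Real.exp_pos _).ne', Real.log_exp,
          Real.log_exp, Real.log_sqrt h2.le] at h1
        rw [map_sub, map_smul, ← hlam, ← hr.dil, smul_eq_mul]
        linarith
      inv := fun x x' => by
        rw [← hr.inv]
        congr 1
        ext i j
        have h1 := congrFun (congrFun (hg_symm x x.2) j) i
        have h2 := congrFun (congrFun (hb_anti x x.2) j) i
        simp only [Matrix.transpose_apply, Matrix.neg_apply] at h1 h2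
        rw [hE (x, x') x.2]
        simp only [DoubleField.metric, Matrix.smul_apply, Matrix.add_apply,
          Matrix.transpose_apply, smul_eq_mul]
        linarith }
  have hd' : ∀ i, DoubleField.smoothDer hV i (f - (1 / 2 : ℝ) • lam) =
      DoubleField.smoothDer hV i f - (1 / 2 : ℝ) • DoubleField.smoothDer hV i lam := fun i => by
    rw [map_sub, Derivation.map_smul]
  have hH := DoubleField.closedForm_formH (e := e) L.comm
  have hK : ∀ (x : V) x' p q, DoubleField.K E d p q (x, x') = DoubleField.ev x
      (DoubleField.kForm (DoubleField.smoothDer hV) G (DoubleField.chr (DoubleField.smoothDer hV)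
        (DoubleField.symPart e) G) (DoubleField.formH (DoubleField.smoothDer hV) e) f p q) :=
    fun x x' p q => by rw [hred.K_eq L, L.kEL_eq_kInt, L.kInt_eq_kForm hd']
  have hR : ∀ (x : V) x', DoubleField.R E d (x, x') = DoubleField.ev x
      (DoubleField.rForm (DoubleField.smoothDer hV) G (DoubleField.chr (DoubleField.smoothDer hV)
        (DoubleField.symPart e) G) (DoubleField.formH (DoubleField.smoothDer hV) e) f) :=
    fun x x' => by rw [hred.R_eq L, L.rEL_eq_rForm hd']
  lift x to V using hx
  have hK' : ∀ p q, DoubleField.K E d p q (x, x') =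
      (-DoubleField.ricci g ![p, q] x + (1 / 4) * DoubleField.hSq g b p q x -
        2 * DoubleField.hess g φ ![p, q] x) +
      ((1 / 2) * DoubleField.divH g b p q x - DoubleField.hGrad g b φ p q x) := fun p q => by
    rw [hK, DoubleField.kForm]
    simp only [map_add, map_sub, map_neg, map_smul, smul_eq_mul, hr.ricci, hr.hSq, hr.hess,
      hr.divH, hr.hGrad]
  have hR' : DoubleField.R E d (x, x') = DoubleField.dilatonEq g b φ x := by
    rw [hR, DoubleField.rForm, DoubleField.dilatonEq]
    simp only [map_add, map_sub, map_smul, smul_eq_mul, hr.scalarCurv, hr.laplace, hr.gradSq,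
      hr.hNorm]
  have hEq : (∀ p q, DoubleField.K E d p q (x, x') = 0) ↔
      (∀ i j, DoubleField.ricci g ![i, j] x - (1 / 4) * DoubleField.hSq g b i j x +
        2 * DoubleField.hess g φ ![i, j] x = 0) ∧
      (∀ i j, (1 / 2) * DoubleField.divH g b i j x - DoubleField.hGrad g b φ i j x = 0) := by
    rw [← DoubleField.add_eq_zero_iff_of_symm (hr.hess_symm L x) (hr.divH_antisymm L x)]
    refine forall_congr' fun p => forall_congr' fun q => ?_
    rw [hK', neg_add, neg_sub]
    ring_nf
  have hB : (∀ i j, (1 / 2) * DoubleField.divH g b i j x - DoubleField.hGrad g b φ i j x = 0) ↔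
      ∀ i j, DoubleField.bFieldEq g b φ i j x = 0 := by
    simp only [hr.bFieldEq_eq L]
    exact DoubleField.eq_zero_iff_raise (hg_det x x.2) fun i j =>
      (1 / 2) * DoubleField.divH g b i j x - DoubleField.hGrad g b φ i j x
  have hM := DoubleField.metricEq_add g b φ (x : DoubleField.Pt D)
  have b1 : ∀ q, DoubleField.bianchi₁ E d q (x, x') = 0 := fun q => by
    rw [hred.bianchi₁ hK hR, L.bianchiLeft_kForm hd', map_zero]
  have b2 : ∀ p, DoubleField.bianchi₂ E d p (x, x') = 0 := fun p => by
    rw [hred.bianchi₂ hK hR, L.bianchiLeft_transpose hd', map_zero]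
  have d1 : ∀ q, DoubleField.divDivH g b q x = 0 := fun q => by
    rw [hr.divDivH, L.div_div hH, map_zero]
  have d2 : ∀ p, DoubleField.divDivH' g b p x = 0 := fun p => by
    rw [hr.divDivH', L.div_div' hH, map_zero]
  have d3 : ∀ q, (1 / 2) * DoubleField.hCovH g b q x -
      (1 / 12) * DoubleField.pd q (DoubleField.hNorm g b) x = 0 := fun q => by
    have h := congrArg (DoubleField.ev x) (L.half_contr_nab hH q)
    rw [map_smul, map_smul, smul_eq_mul, smul_eq_mul, ← hr.hCovH,
      ← DoubleField.pd_eq_ev hV hr.hNorm] at h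
    exact sub_eq_zero.mpr h
  have d4 : ∀ q, DoubleField.divRicci g q x -
      (1 / 2) * DoubleField.pd q (DoubleField.scalarCurv g) x = 0 := fun q => by
    have h := congrArg (DoubleField.ev x) (L.contracted_bianchi q)
    rw [map_smul, smul_eq_mul, ← hr.divRicci, ← DoubleField.pd_eq_ev hV hr.scalarCurv] at h
    exact sub_eq_zero.mpr h
  refine ⟨hK', fun p q => ?_, hR', hEq, by rw [hR'], hB, hM, ?_, fun q => ?_, fun p => ?_, d1, d2,
    d3, fun j => ?_, fun j => ?_, d4⟩
  · rw [hred.covariantK, L.covK_eq_kInt, hK, L.kInt_eq_kForm hd']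
  · rw [hEq, hR', hB, and_assoc]
    constructor
    · rintro ⟨h1, h2, h3⟩
      refine ⟨fun i j => ?_, h2, h3⟩
      have h4 := hM i j
      rw [h3] at h4
      linarith [h1 i j]
    · rintro ⟨h1, h2, h3⟩
      refine ⟨fun i j => ?_, h2, h3⟩
      have h4 := hM i j
      rw [h3, h1] at h4
      linarith
  · rw [b1, d1, d3]; linarith [d4 q]
  · rw [b2, d2, d3]; linarith [d4 p]
  · rw [b1, d4, neg_zero]
  · rw [b2, d4, neg_zero]
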